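/- **Setting.** Let $X$ be a smooth manifold of dimension $n$ (Hausdorff, second countable, without boundary) and let $J^2(X)\to X$ be its bundle of 2-jets of real functions. There is a canonical splitting $J^2(X)=\mathbf R\oplus J^2_{\rm red}(X)$ (value of the function, reduced 2-jet), and $\mathrm{Sym}^2(T^*X)\subset J^2_{\rm red}(X)$. A chart on $U\subset X$ induces a trivialization $J^2(U)=U\times\mathbf J^2$, where $\mathbf J^2=\mathbf R\times(\mathbf R^n)^*\times \mathrm{Sym}^2((\mathbf R^n)^*)$, by $J^2_xu=(u,Du,D^2u)$. *Subequations.* A *subequation* on $X$ is a closed set $F\subset J^2(X)$ such that, fibrewise, $F+\mathcal P\subset F$, where $\mathcal P=\{A\in \mathrm{Sym}^2(T^*X): A\ge 0\}$, and $F+\mathcal N\subset F$, where $\mathcal N$ is the set of 2-jets of constant functions $\le 0$, and such that $F=\overline{\mathrm{Int}\,F}$, $F_x=\overline{\mathrm{Int}\,F_x}$ and $\mathrm{Int}\,F_x=(\mathrm{Int}\,F)_x$ for all $x\in X$. Its *dual* is $\widetilde F=-(\sim\mathrm{Int}\,F)$. A *constant coefficient subequation* is a closed set $\mathbf F\subset\mathbf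 J^2$ with $\emptyset\ne\mathbf F\neq\mathbf J^2$, $\mathbf F+(0,0,A)\subset\mathbf F$ for all $A\geq0$, $\mathbf F+(r,0,0)\subset\mathbf F$ for all $r\le0$, and $\mathbf F=\overline{\mathrm{Int}\,\mathbf F}$. A *monotonicity cone* for $F$ is a subequation $M$ on $X$ each of whose fibres is a convex cone with vertex at the origin and which satisfies $F+M\subset F$ (fibrewise sum). A function $\psi\in C^2(X)$ is *strictly $M$-subharmonic* if $J^2_x\psi\in\mathrm{Int}\,M_x$ for all $x\in X$. *Jet-equivalence.* $F$ is *locally affinely jet-equivalent to the constant coefficient subequation* $\mathbf F$ if every point of $X$ has a coordinate neighbourhood $U$ on which there are smooth maps $g,h:U\to \mathrm{GL}((\mathbf R^n)^*)$, $L:U\to\mathrm{Hom}((\mathbf R^n)^*,\mathrm{Sym}^2((\mathbf R^n)^*))$ and $S:U\to\mathbf J^2$ such that, in the trivialization $J^2(U)=U\times\mathbf J^2$, the maps $\Psi_x(r,p,A)=(r,\,g_xp,\,h_xAh_x^t+L_x(p))+S_x$ satisfy $\Psi_x(F_x)=\mathbf F$ for all $x\in U$. *Harmonic functions.* For $\Omega\subset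 X$ open, an upper semicontinuous function $u:\Omega\to[-\infty,\infty)$ is *$F$-subharmonic* on $\Omega$ if $J^2_x\varphi\in F$ for every $x\in\Omega$ and every $C^2$ function $\varphi$ defined near $x$ with $u\le\varphi$ near $x$ and $u(x)=\varphi(x)$. It is *$F$-harmonic* on $\Omega$ if $u$ is $F$-subharmonic and $-u$ is $\widetilde F$-subharmonic on $\Omega$. *Boundary convexity.* Let $\Omega\subset X$ be open. A *defining function* for $\partial\Omega$ on an open set $U$ is a $C^\infty$ function $\rho$ on $U$ with $\partial\Omega\cap U=\{\rho=0\}$, $d\rho\ne0$ on $\partial\Omega\cap U$ and $\rho<0$ on $\Omega\cap U$; $\partial\Omega$ is *smooth* if each of its points has a neighbourhood with such a function. For $\lambda\in\mathbf R$ put $F_\lambda=\{J\in J^2_{\rm red}(X):(\lambda,J)\in F\}$, and let the *asymptotic interior* $\vec F_\lambda$ be the set of those $J\in J^2_{\rm red}(X)$ that have a neighbourhood $\mathcal N(J)$ in the total space of $J^2_{\rm red}(X)$ and a number $t_0>0$ such that $t\cdot\mathcal N(J)\subset F_\lambda$ for all $t\ge t_0$. The boundary $\partial\Omega$ is *strictly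 $F$-convex* if for all $x\in\partial\Omega$ and all $\lambda\in\mathbf R$ there is a defining function $\rho$ for $\partial\Omega$ on a neighbourhood $U$ of $x$ with $J^2_{{\rm red},y}\rho\in\vec F_\lambda$ for all $y\in U$. **Theorem.** Let $F$ be a subequation on $X$ with a monotonicity cone $M$. Suppose that (i) $F$ is locally affinely jet-equivalent to some constant coefficient subequation, and (ii) $X$ carries a $C^2$ strictly $M$-subharmonic function. Let $\Omega\subset X$ be an open set (not necessarily connected) with compact closure and smooth boundary such that $\partial\Omega$ is both strictly $F$-convex and strictly $\widetilde F$-convex. Then for every $\varphi\in C(\partial\Omega)$ there exists a unique $u\in C(\overline\Omega)$ such that $u|_\Omega$ is $F$-harmonic on $\Omega$ and $u|_{\partial\Omega}=\varphi$. -/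

import Mathlib

open scoped Manifold ContDiff Topology

namespace DirichletDuality

noncomputable section

/-- Euclidean space `ℝⁿ`. -/
abbrev Rn (n : ℕ) : Type := EuclideanSpace ℝ (Fin n)

/-! ### The constant fibre `𝐉² = ℝ × (ℝⁿ)* × Sym²((ℝⁿ)*)` -/

/-- Bilinear forms on `ℝⁿ`. -/
abbrev Bil (n : ℕ) : Type := Rn n →L[ℝ] Rn n →L[ℝ] ℝ

/-- The space of symmetric bilinear forms on `ℝⁿ`. -/
def symForms (n : ℕ) : Submodule ℝ (Bil n) where
  carrier := {B | ∀ v w, B v w = B w v}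
  add_mem' := by
    intro a b ha hb v w
    simp [ha v w, hb v w]
  zero_mem' := by
    intro v w
    simp
  smul_mem' := by
    intro c a ha v w
    simp [ha v w]

instance symFormsNormedAddCommGroup (n : ℕ) : NormedAddCommGroup (symForms n) :=
  @Submodule.normedAddCommGroup ℝ (Bil n) _ _ _ (symForms n)

instance symFormsNormedSpace (n : ℕ) : NormedSpace ℝ (symForms n) :=
  @Submodule.normedSpace ℝ ℝ _ _ _ (Bil n) _ _ _ _ (symForms n)

/-- Symmetric bilinear forms on `ℝⁿ`, with the norm of `Bil n`. -/
def SymForm (n : ℕ) : Type := symForms n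

instance (n : ℕ) : NormedAddCommGroup (SymForm n) := symFormsNormedAddCommGroup n

instance (n : ℕ) : NormedSpace ℝ (SymForm n) := symFormsNormedSpace n

/-- The bilinear form underlying a symmetric form. -/
def SymForm.bil {n : ℕ} (A : SymForm n) : Bil n := Subtype.val (p := (· ∈ symForms n)) A

/-- A symmetric bilinear form, as an element of `SymForm n`. -/
def SymForm.mk {n : ℕ} (B : Bil n) (h : ∀ v w, B v w = B w v) : SymForm n :=
  (⟨B, h⟩ : symForms n)

theorem SymForm.bil_symm {n : ℕ} (A : SymForm n) (v w : Rn n) : A.bil v w = A.bil w v :=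
  Subtype.property (p := (· ∈ symForms n)) A v w

/-- The symmetric part of a bilinear form; it is the form itself when that is symmetric, as for the
second derivative of a `C²` function. -/
def SymForm.ofBilin {n : ℕ} (B : Bil n) : SymForm n :=
  SymForm.mk ((2⁻¹ : ℝ) • (B + B.flip)) (by
    intro v w
    change (2⁻¹ : ℝ) * (B v w + B w v) = (2⁻¹ : ℝ) * (B w v + B v w)
    ring)

/-- `A ≥ 0`. -/
def SymForm.Nonneg {n : ℕ} (A : SymForm n) : Prop := ∀ v, 0 ≤ A.bil v v

/-- The form `(v, w) ↦ A (k v, k w)`. With `k = hᵗ` this is `h A hᵗ`. -/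
def SymForm.pull {n : ℕ} (k : Rn n →L[ℝ] Rn n) (A : SymForm n) : SymForm n :=
  SymForm.mk (A.bil.bilinearComp k k) (by
    intro v w
    simpa using A.bil_symm (k v) (k w))

/-- Reduced 2-jets `(p, A)` at a point of `ℝⁿ`. -/
abbrev RedJet (n : ℕ) : Type := (Rn n →L[ℝ] ℝ) × SymForm n

/-- 2-jets `(r, p, A)` at a point of `ℝⁿ`. -/
abbrev Jet (n : ℕ) : Type := ℝ × RedJet n

/-- The polynomial `v ↦ r + p v + A (v, v) / 2`, whose 2-jet at the origin is `(r, p, A)`. -/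
def Jet.poly {n : ℕ} (j : Jet n) (v : Rn n) : ℝ :=
  j.1 + j.2.1 v + 2⁻¹ * j.2.2.bil v v

/-- Conditions (P) and (N) for a set of jets at one point. -/
def PosNeg {n : ℕ} (F : Set (Jet n)) : Prop :=
  (∀ j ∈ F, ∀ A : SymForm n, A.Nonneg → j + (0, 0, A) ∈ F) ∧
  (∀ j ∈ F, ∀ r : ℝ, r ≤ 0 → j + (r, 0, 0) ∈ F)

/-- Constant coefficient subequations: proper (neither empty nor everything) closed sets
satisfying (P), (N) and (T). -/
structure IsConstSubequation {n : ℕ} (F : Set (Jet n)) : Prop where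
  nonempty : F.Nonempty
  ne_univ : F ≠ Set.univ
  isClosed : IsClosed F
  posNeg : PosNeg F
  closure_interior : F = closure (interior F)

/-! ### The 2-jet bundle of a manifold -/

/-- Points of the 2-jet bundle `J²(X)`. As for Mathlib's tangent bundle, the fibre over `x` is
identified with the model fibre through the preferred chart `chartAt _ x`. -/
structure JetBundle (n : ℕ) (X : Type*) where
  /-- the base point -/
  base : X
  /-- the coordinates of the jet in the preferred chart at the base point -/
  fib : Jet n

/-- Points of the reduced 2-jet bundle `J²_red(X)`, where `J²(X) = ℝ ⊕ J²_red(X)`. -/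
structure RedJetBundle (n : ℕ) (X : Type*) where
  /-- the base point -/
  base : X
  /-- the coordinates of the jet in the preferred chart at the base point -/
  fib : RedJet n

section Manifold

variable {n : ℕ} {X : Type*} [TopologicalSpace X] [ChartedSpace (Rn n) X]

/-- The 2-jet of `f` at `x`, an element of the fibre over `x`: value, first and second derivative
of `f` in the preferred chart at `x`. -/
def jetAt (n : ℕ) {X : Type*} [TopologicalSpace X] [ChartedSpace (Rn n) X]
    (x : X) (f : X → ℝ) : Jet n :=
  (f x,
   fderiv ℝ (f ∘ (chartAt (Rn n) x).symm) (chartAt (Rn n) x x),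
   SymForm.ofBilin
    (fderiv ℝ (fderiv ℝ (f ∘ (chartAt (Rn n) x).symm)) (chartAt (Rn n) x x)))

/-- The jet over the point with coordinates `y` in the chart `e` whose coordinates in the
trivialization of the jet bundle given by `e` are `j`: it is the 2-jet of the function that in the
chart `e` is the quadratic polynomial `j` centred at `y`. -/
def ofChart (e : OpenPartialHomeomorph X (Rn n)) (y : Rn n) (j : Jet n) : JetBundle n X :=
  ⟨e.symm y, jetAt n (e.symm y) (fun z => j.poly (e z - y))⟩

/-- The topology of `J²(X)`: a set is open iff it is open in the trivialization
`J²(U) = U × 𝐉²` of every smooth chart. -/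
instance : TopologicalSpace (JetBundle n X) :=
  ⨆ e : IsManifold.maximalAtlas 𝓘(ℝ, Rn n) ∞ X,
    TopologicalSpace.coinduced
      (fun q : e.1.target × Jet n => ofChart e.1 (q.1 : Rn n) q.2) inferInstance

/-- The topology of `J²_red(X)`, as the subbundle `{0} ⊕ J²_red(X)` of `J²(X)`. -/
instance : TopologicalSpace (RedJetBundle n X) :=
  TopologicalSpace.induced (fun J => (⟨J.base, (0, J.fib)⟩ : JetBundle n X)) inferInstance

/-! ### Subequations -/

/-- The fibre `F_x`. -/
def fibre (F : Set (JetBundle n X)) (x : X) : Set (Jet n) := {j | (⟨x, j⟩ : JetBundle n X) ∈ F}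

/-- Subequations on `X`. -/
structure IsSubequation (F : Set (JetBundle n X)) : Prop where
  isClosed : IsClosed F
  posNeg : ∀ x, PosNeg (fibre F x)
  closure_interior : F = closure (interior F)
  fibre_closure_interior : ∀ x, fibre F x = closure (interior (fibre F x))
  interior_fibre : ∀ x, interior (fibre F x) = fibre (interior F) x

/-- The dual subequation `F̃ = ∼(-Int F)`. -/
def dual (F : Set (JetBundle n X)) : Set (JetBundle n X) :=
  {J | (⟨J.base, -J.fib⟩ : JetBundle n X) ∉ interior F}

/-- `M` is a monotonicity cone for `F`: a subequation whose fibres are convex cones with vertex at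
the origin, with `F + M ⊆ F` (fibrewise sum). -/
structure IsMonotonicityCone (M F : Set (JetBundle n X)) : Prop where
  isSubequation : IsSubequation M
  convex : ∀ x, Convex ℝ (fibre M x)
  cone : ∀ x, ∀ j ∈ fibre M x, ∀ t : ℝ, 0 < t → t • j ∈ fibre M x
  add_mem : ∀ x, ∀ j ∈ fibre F x, ∀ m ∈ fibre M x, j + m ∈ fibre F x

/-- `ψ` is a `C²` strictly `M`-subharmonic function on `X`. -/
def IsStrictlySubharmonic (M : Set (JetBundle n X)) (ψ : X → ℝ) : Prop :=
  ContMDiff 𝓘(ℝ, Rn n) 𝓘(ℝ, ℝ) 2 ψ ∧ ∀ x, jetAt n x ψ ∈ interior (fibre M x)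

/-- A smooth family, over a set `V` of coordinates, of affine automorphisms of `𝐉²`,
`Ψ_y (r, p, A) = (r, g p, h A hᵗ + L p) + S`, with `k = hᵗ`. -/
structure AffineJetAut (n : ℕ) (V : Set (Rn n)) where
  /-- the bundle automorphism `g` of the cotangent bundle -/
  g : Rn n → ((Rn n →L[ℝ] ℝ) ≃L[ℝ] (Rn n →L[ℝ] ℝ))
  /-- the transpose of the bundle automorphism `h` of the cotangent bundle -/
  k : Rn n → (Rn n ≃L[ℝ] Rn n)
  /-- the section `L` of `Hom(T*X, Sym² T*X)` -/
  L : Rn n → ((Rn n →L[ℝ] ℝ) →L[ℝ] SymForm n)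
  /-- the translation -/
  S : Rn n → Jet n
  smooth_g : ContDiffOn ℝ ∞
    (fun y => (g y : (Rn n →L[ℝ] ℝ) →L[ℝ] (Rn n →L[ℝ] ℝ))) V
  smooth_k : ContDiffOn ℝ ∞ (fun y => (k y : Rn n →L[ℝ] Rn n)) V
  smooth_L : ContDiffOn ℝ ∞ L V
  smooth_S : ContDiffOn ℝ ∞ S V

/-- The action of an affine automorphism on the fibre over `y`. -/
def AffineJetAut.act {V : Set (Rn n)} (Ψ : AffineJetAut n V) (y : Rn n) (j : Jet n) : Jet n :=
  (j.1, Ψ.g y j.2.1, SymForm.pull (Ψ.k y : Rn n →L[ℝ] Rn n) j.2.2 + Ψ.L y j.2.1) + Ψ.S y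

/-- `F` is locally affinely jet-equivalent to the constant coefficient subequation `F₀`. -/
def LocallyAffinelyJetEquivalent (F : Set (JetBundle n X)) (F₀ : Set (Jet n)) : Prop :=
  ∀ x : X, ∃ e ∈ IsManifold.maximalAtlas 𝓘(ℝ, Rn n) ∞ X, x ∈ e.source ∧
    ∃ Ψ : AffineJetAut n e.target, ∀ y ∈ e.target,
      Ψ.act y '' {j | ofChart e y j ∈ F} = F₀

/-! ### Subharmonic and harmonic functions -/

/-- `F(Ω)`: upper semicontinuous functions `u : Ω → [-∞, ∞)` such that the 2-jet at `x` of every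
`C²` test function for `u` at `x` lies in `F`, for all `x ∈ Ω` (`Ω` is open). -/
def IsSubharmonic (F : Set (JetBundle n X)) (Ω : Set X) (u : Ω → EReal) : Prop :=
  UpperSemicontinuous u ∧ (∀ x, u x < ⊤) ∧
  ∀ (x : Ω) (φ : X → ℝ), ContMDiffAt 𝓘(ℝ, Rn n) 𝓘(ℝ, ℝ) 2 φ (x : X) →
    (∀ᶠ y : Ω in 𝓝 x, u y ≤ (φ y : EReal)) → u x = (φ x : EReal) →
    jetAt n (x : X) φ ∈ fibre F x

/-- `u` is `F`-harmonic on the open set `Ω`. -/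
def IsHarmonic (F : Set (JetBundle n X)) (Ω : Set X) (u : Ω → EReal) : Prop :=
  IsSubharmonic F Ω u ∧ IsSubharmonic (dual F) Ω (fun x => -u x)

/-- `u ∈ C(Ω̄)` solves the Dirichlet problem for `F`-harmonic functions on `Ω` with boundary
data `φ ∈ C(∂Ω)`. -/
def SolvesDirichlet (F : Set (JetBundle n X)) (Ω : Set X) (φ : C(frontier Ω, ℝ))
    (u : C(closure Ω, ℝ)) : Prop :=
  IsHarmonic F Ω (fun x => ((u ⟨x, subset_closure x.2⟩ : ℝ) : EReal)) ∧
  ∀ x : frontier Ω, u ⟨x, frontier_subset_closure x.2⟩ = φ x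

/-! ### Boundary convexity -/

/-- `ρ` is a (smooth) defining function for `∂Ω` on the open set `U`. -/
structure IsDefiningFunction (n : ℕ) {X : Type*} [TopologicalSpace X] [ChartedSpace (Rn n) X]
    (Ω U : Set X) (ρ : X → ℝ) : Prop where
  isOpen : IsOpen U
  smooth : ContMDiffOn 𝓘(ℝ, Rn n) 𝓘(ℝ, ℝ) ∞ ρ U
  frontier_iff : ∀ x ∈ U, x ∈ frontier Ω ↔ ρ x = 0
  mfderiv_ne_zero : ∀ x ∈ U, x ∈ frontier Ω → mfderiv 𝓘(ℝ, Rn n) 𝓘(ℝ, ℝ) ρ x ≠ 0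
  neg : ∀ x ∈ U, x ∈ Ω → ρ x < 0

/-- The boundary of `Ω` is smooth. -/
def HasSmoothBoundary (n : ℕ) {X : Type*} [TopologicalSpace X] [ChartedSpace (Rn n) X]
    (Ω : Set X) : Prop :=
  ∀ x ∈ frontier Ω, ∃ (U : Set X) (ρ : X → ℝ), x ∈ U ∧ IsDefiningFunction n Ω U ρ

/-- The slice `F_λ ⊆ J²_red(X)` obtained by fixing the value of the jet to be `l`. -/
def slice (F : Set (JetBundle n X)) (l : ℝ) : Set (RedJetBundle n X) :=
  {J | (⟨J.base, (l, J.fib)⟩ : JetBundle n X) ∈ F}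

/-- The asymptotic interior of `G ⊆ J²_red(X)`. -/
def asymptoticInterior (G : Set (RedJetBundle n X)) : Set (RedJetBundle n X) :=
  {J | ∃ N ∈ 𝓝 J, ∃ t₀ : ℝ, 0 < t₀ ∧ ∀ t : ℝ, t₀ ≤ t →
    ∀ K ∈ N, (⟨K.base, t • K.fib⟩ : RedJetBundle n X) ∈ G}

/-- `∂Ω` is strictly `G`-convex at `x`, for `G ⊆ J²_red(X)`. -/
def StrictlyConvexAtRed (G : Set (RedJetBundle n X)) (Ω : Set X) (x : X) : Prop :=
  ∃ (U : Set X) (ρ : X → ℝ), x ∈ U ∧ IsDefiningFunction n Ω U ρ ∧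
    ∀ y ∈ U, (⟨y, (jetAt n y ρ).2⟩ : RedJetBundle n X) ∈ asymptoticInterior G

/-- `∂Ω` is strictly `F`-convex at each of its points. -/
def StrictlyConvexBoundary (F : Set (JetBundle n X)) (Ω : Set X) : Prop :=
  ∀ x ∈ frontier Ω, ∀ l : ℝ, StrictlyConvexAtRed (slice F l) Ω x

end Manifold

end

end DirichletDuality

/-!
Perron's method. The solution is the upper semicontinuous envelope `U` of the supremum of all
`F`-subharmonic functions on `Ω` lying below `φ` on `∂Ω`. Strict convexity of the boundary produces
barriers, of the form `c + t (ρ - η d²)` near a boundary point, with `ρ` a defining function, `d`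
the distance to the point in a chart and `t` large, which force the right boundary values. If the
envelope of `-U` failed to be subharmonic for the dual of `F` at a point, then the failing test
function, turned upside down and pushed up slightly, would give a member of the family exceeding `U`
near that point, contradicting maximality. So both `U` and `-U` are subharmonic for their respective
subequations, and comparison makes `U` continuous and unique.

Comparison: if `u` is `F`-subharmonic, `v` is subharmonic for the dual and `u + v` has a positive
interior maximum exceeding its boundary values, then so does `u + v + ε ψ` for small `ε`. In a
chart, the jet-equivalence straightens `F` to a constant coefficient subequation. Doubling the
variables and applying the theorem on sums (sup-convolution and Jensen's lemma) gives points close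
to the maximum with upper jets of `u` and `v` whose sum is almost minus the jet of `ε ψ`. As that
jet is interior to `M`, this puts minus the jet of `v` in the interior of `F`, which the definition
of the dual excludes.
-/

namespace DirichletDuality

noncomputable section

open Set Filter MeasureTheory Asymptotics
open scoped RealInnerProductSpace

section TaylorTwo

variable {E E' : Type*} [NormedAddCommGroup E] [NormedSpace ℝ E]
  [NormedAddCommGroup E'] [NormedSpace ℝ E'] {f g : E → ℝ} {l m : E →L[ℝ] ℝ}
  {A B : E →L[ℝ] E →L[ℝ] ℝ} {x : E}

/-- Second order Taylor (Peano) expansion of `f` at `x`, with differential `l` and Hessian `B`.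
Only the quadratic form of `B` matters; differentiability of `f` away from `x` is not required. -/
def HasTaylorTwoAt (f : E → ℝ) (l : E →L[ℝ] ℝ) (B : E →L[ℝ] E →L[ℝ] ℝ) (x : E) : Prop :=
  (fun h => f (x + h) - f x - l h - 2⁻¹ * B h h) =o[𝓝 0] fun h => ‖h‖ ^ 2

theorem isLittleO_norm_sq_of_hasFDerivAt {r : E → ℝ} {r' : E → E →L[ℝ] ℝ}
    (hr : ∀ᶠ h in 𝓝 0, HasFDerivAt r (r' h) h) (hr' : r' =o[𝓝 0] fun h => h) :
    (fun h => r h - r 0) =o[𝓝 0] fun h => ‖h‖ ^ 2 := by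
  refine isLittleO_iff.2 fun ε hε => ?_
  obtain ⟨ρ, hρ, hball⟩ := Metric.eventually_nhds_iff_ball.1 (hr.and (hr'.def hε))
  refine Metric.eventually_nhds_iff_ball.2 ⟨ρ, hρ, fun h hh => ?_⟩
  have hsub : Metric.closedBall (0 : E) ‖h‖ ⊆ Metric.ball 0 ρ :=
    Metric.closedBall_subset_ball (mem_ball_zero_iff.1 hh)
  have hbound : ∀ k ∈ Metric.closedBall (0 : E) ‖h‖, ‖r' k‖ ≤ ε * ‖h‖ := fun k hk =>
    (hball k (hsub hk)).2.trans (by gcongr; exact mem_closedBall_zero_iff.1 hk)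
  calc ‖r h - r 0‖ ≤ ε * ‖h‖ * ‖h - 0‖ :=
        (convex_closedBall (0 : E) ‖h‖).norm_image_sub_le_of_norm_hasFDerivWithin_le
          (fun k hk => (hball k (hsub hk)).1.hasFDerivWithinAt) hbound
          (Metric.mem_closedBall_self (norm_nonneg h)) (by simp)
    _ = ε * ‖‖h‖ ^ 2‖ := by rw [sub_zero, norm_pow, norm_norm]; ring

theorem hasTaylorTwoAt_of_hasFDerivAt {f' : E → E →L[ℝ] ℝ}
    (hf : ∀ᶠ y in 𝓝 x, HasFDerivAt f (f' y) y) (hf' : HasFDerivAt f' B x) :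
    HasTaylorTwoAt f (f' x) B x := by
  have hsymm : ∀ v w, B v w = B w v := second_derivative_symmetric_of_eventually hf hf'
  have htend : Tendsto (fun h => x + h) (𝓝 0) (𝓝 x) := by
    simpa using (continuous_const_add x).tendsto 0
  have hderiv : ∀ᶠ k in 𝓝 0, HasFDerivAt (fun h => f (x + h) - f x - f' x h - 2⁻¹ * B h h)
      (f' (x + k) - f' x - B k) k := by
    filter_upwards [htend.eventually hf] with k hk
    have hquad : HasFDerivAt (fun h => B h h) (B.flip k + B k) k :=
      (B.hasFDerivAt.clm_apply (hasFDerivAt_id k)).congr_fderiv (by ext v; simp [add_comm])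
    refine (((((hasFDerivAt_comp_add_left x).2 hk).sub_const (f x)).sub
      (f' x).hasFDerivAt).sub (hquad.const_mul 2⁻¹)).congr_fderiv ?_
    ext v
    simp only [_root_.sub_apply, _root_.smul_apply, _root_.add_apply,
      ContinuousLinearMap.flip_apply, smul_eq_mul, hsymm v k]
    ring
  simpa [HasTaylorTwoAt] using isLittleO_norm_sq_of_hasFDerivAt hderiv
    (hasFDerivAt_iff_isLittleO_nhds_zero.1 hf')

/-- The inner product as a bilinear form, i.e. `innerSL ℝ` with the (trivial) conjugation of `ℝ`
removed from its type. -/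
def innerBil (V : Type*) [NormedAddCommGroup V] [InnerProductSpace ℝ V] : V →L[ℝ] V →L[ℝ] ℝ :=
  innerSL ℝ

@[simp]
theorem innerBil_apply {V : Type*} [NormedAddCommGroup V] [InnerProductSpace ℝ V] (v w : V) :
    innerBil V v w = ⟪v, w⟫ :=
  rfl

theorem hasTaylorTwoAt_norm_sub_sq {V : Type*} [NormedAddCommGroup V] [InnerProductSpace ℝ V]
    (a x : V) : HasTaylorTwoAt (fun y => ‖y - a‖ ^ 2) ((2 : ℝ) • innerBil V (x - a))
      ((2 : ℝ) • innerBil V) x := by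
  refine (isLittleO_zero _ _).congr_left fun h => ?_
  simp only [_root_.smul_apply, innerBil_apply, smul_eq_mul, real_inner_self_eq_norm_sq]
  rw [add_sub_right_comm, norm_add_sq_real]
  ring

theorem hasTaylorTwoAt_const (c : ℝ) (x : E) : HasTaylorTwoAt (fun _ => c) 0 0 x :=
  (isLittleO_zero _ _).congr_left fun h => by simp

namespace HasTaylorTwoAt

theorem add (hf : HasTaylorTwoAt f l A x) (hg : HasTaylorTwoAt g m B x) :
    HasTaylorTwoAt (fun y => f y + g y) (l + m) (A + B) x :=
  (IsLittleO.add hf hg).congr_left fun h => by simp only [_root_.add_apply]; ring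

theorem const_mul (hf : HasTaylorTwoAt f l A x) (c : ℝ) :
    HasTaylorTwoAt (fun y => c * f y) (c • l) (c • A) x :=
  (IsLittleO.const_mul_left hf c).congr_left fun h => by
    simp only [_root_.smul_apply, smul_eq_mul]; ring

theorem sub (hf : HasTaylorTwoAt f l A x) (hg : HasTaylorTwoAt g m B x) :
    HasTaylorTwoAt (fun y => f y - g y) (l - m) (A - B) x :=
  (IsLittleO.sub hf hg).congr_left fun h => by simp only [_root_.sub_apply]; ring

theorem comp_affine {L : E' →L[ℝ] E} {a : E} {y : E'} (hf : HasTaylorTwoAt f l A x)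
    (hx : a + L y = x) :
    HasTaylorTwoAt (fun z => f (a + L z)) (l ∘L L) (A.bilinearComp L L) y := by
  subst hx
  have htend : Tendsto L (𝓝 0) (𝓝 0) := by simpa using L.continuous.tendsto 0
  refine ((IsLittleO.comp_tendsto hf htend).congr_left fun h => ?_).trans_isBigO ?_
  · simp [add_assoc]
  · exact L.isBigO_id _ |>.norm_left.norm_right.pow 2

theorem comp_clm {L : E' →L[ℝ] E} {y : E'} (hf : HasTaylorTwoAt f l A (L y)) :
    HasTaylorTwoAt (fun z => f (L z)) (l ∘L L) (A.bilinearComp L L) y := by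
  simpa using hf.comp_affine (zero_add (L y))

theorem hasFDerivAt (hf : HasTaylorTwoAt f l A x) : HasFDerivAt f l x := by
  rw [hasFDerivAt_iff_isLittleO_nhds_zero]
  have hquad : (fun k => 2⁻¹ * A k k) =O[𝓝 0] fun k : E => ‖k‖ ^ 2 := by
    refine IsBigO.of_bound (2⁻¹ * ‖A‖) (Eventually.of_forall fun k => ?_)
    rw [norm_mul, norm_pow, norm_norm, Real.norm_of_nonneg (by norm_num : (0 : ℝ) ≤ 2⁻¹)]
    linarith [A.le_opNorm₂ k k]
  exact (((IsLittleO.isBigO hf).add hquad).trans_isLittleO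
    (isLittleO_norm_pow_id one_lt_two)).congr_left fun k => by ring

theorem hessian_nonpos (hf : HasTaylorTwoAt f l A x) (hle : ∀ᶠ h in 𝓝 0, f (x + h) ≤ f x + l h)
    (v : E) : A v v ≤ 0 := by
  have htend : Tendsto (fun t : ℝ => t • v) (𝓝[≠] 0) (𝓝 0) :=
    tendsto_nhdsWithin_of_tendsto_nhds <| by
      simpa using (continuous_id.smul continuous_const).tendsto (0 : ℝ) (f := fun t : ℝ => t • v)
  have hray : Tendsto (fun t : ℝ => (f (x + t • v) - f x - l (t • v)) / t ^ 2 - 2⁻¹ * A v v)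
      (𝓝[≠] 0) (𝓝 0) := by
    have h1 : (fun t : ℝ => f (x + t • v) - f x - l (t • v) - 2⁻¹ * A (t • v) (t • v))
        =o[𝓝[≠] 0] fun t : ℝ => t ^ 2 :=
      (IsLittleO.comp_tendsto hf htend).trans_isBigO <| by
        refine IsBigO.of_bound (‖v‖ ^ 2) (Eventually.of_forall fun t => ?_)
        simp [norm_smul, mul_pow, mul_comm]
    refine h1.tendsto_div_nhds_zero.congr' ?_
    filter_upwards [self_mem_nhdsWithin] with t (ht : t ≠ 0)
    simp only [map_smul, _root_.smul_apply, smul_eq_mul]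
    field_simp
  have hbound : ∀ᶠ t in 𝓝[≠] (0 : ℝ),
      (f (x + t • v) - f x - l (t • v)) / t ^ 2 - 2⁻¹ * A v v ≤ -(2⁻¹ * A v v) := by
    filter_upwards [htend.eventually hle] with t ht
    have := div_nonpos_of_nonpos_of_nonneg (sub_nonpos.2 (sub_le_iff_le_add'.2 ht)) (sq_nonneg t)
    linarith
  linarith [le_of_tendsto hray hbound]

theorem hessian_unique (hA : HasTaylorTwoAt f l A x) (hB : HasTaylorTwoAt f m B x) (v : E) :
    A v v = B v v := by
  obtain rfl := hA.hasFDerivAt.unique hB.hasFDerivAt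
  have h₁ := (hA.sub hB).hessian_nonpos (by simp) v
  have h₂ := (hB.sub hA).hessian_nonpos (by simp) v
  simp only [_root_.sub_apply] at h₁ h₂
  linarith

end HasTaylorTwoAt

end TaylorTwo

section Jensen

variable {H : Type*} [NormedAddCommGroup H] [InnerProductSpace ℝ H] {g Γ : H → ℝ} {G : H → H}
  {C η δ s : ℝ} {p p₁ p₂ x x₁ x₂ : H}

/-- Semiconvexity, as a lower bound on second differences; for continuous `g` it says that
`g + (C / 2) ‖·‖²` is convex. -/
def IsSemiconvexWith (C : ℝ) (g : H → ℝ) : Prop :=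
  ∀ y h, 2 * g y - C * ‖h‖ ^ 2 ≤ g (y + h) + g (y - h)

/-- `p` is a (global) supergradient of `g` at `x`. -/
def IsSupergradient (g : H → ℝ) (p x : H) : Prop :=
  ∀ y, g y ≤ g x + ⟪p, y - x⟫

theorem IsSupergradient.le_add (hp : IsSupergradient Γ p x) (h : H) :
    Γ (x + h) ≤ Γ x + ⟪p, h⟫ := by
  simpa using hp (x + h)

theorem IsSupergradient.le_sub (hp : IsSupergradient Γ p x) (h : H) :
    Γ (x - h) ≤ Γ x - ⟪p, h⟫ := by
  simpa [sub_eq_add_neg] using hp (x - h)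

theorem IsSemiconvexWith.sub_sq_le (hΓ : IsSemiconvexWith C Γ) (hp : IsSupergradient Γ p x)
    (h : H) : Γ x + ⟪p, h⟫ - C * ‖h‖ ^ 2 ≤ Γ (x + h) := by
  linarith [hΓ x h, hp.le_sub h]

theorem IsSemiconvexWith.hasFDerivAt (hΓ : IsSemiconvexWith C Γ) (hp : IsSupergradient Γ p x) :
    HasFDerivAt Γ (innerBil H p) x := by
  rw [hasFDerivAt_iff_isLittleO_nhds_zero]
  refine (IsBigO.of_bound C (Eventually.of_forall fun h => ?_)).trans_isLittleO
    (isLittleO_norm_pow_id one_lt_two)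
  rw [norm_pow, norm_norm, Real.norm_eq_abs, abs_le, innerBil_apply]
  constructor <;> linarith [hΓ.sub_sq_le hp h, hp.le_add h]

theorem IsSemiconvexWith.norm_supergradient_sub_le (hΓ : IsSemiconvexWith C Γ) (hC : 0 < C)
    (h₁ : IsSupergradient Γ p₁ x₁) (h₂ : IsSupergradient Γ p₂ x₂) :
    ‖p₁ - p₂‖ ≤ 4 * C * ‖x₁ - x₂‖ := by
  set q := p₂ - p₁ with hq
  have hsq : ‖q‖ ^ 2 / (4 * C) ≤ ⟪q, x₁ - x₂⟫ := by
    have hlow := hΓ.sub_sq_le h₂ ((2 * C)⁻¹ • q)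
    have hup := h₁ (x₂ + (2 * C)⁻¹ • q)
    have hx₁ := h₂ x₁
    have hdir : ⟪p₂, (2 * C)⁻¹ • q⟫ - ⟪p₁, (2 * C)⁻¹ • q⟫ = (2 * C)⁻¹ * ‖q‖ ^ 2 := by
      rw [← inner_sub_left, ← hq, inner_smul_right, real_inner_self_eq_norm_sq]
    rw [add_sub_right_comm, inner_add_right, ← neg_sub x₁ x₂, inner_neg_right] at hup
    rw [norm_smul, mul_pow, Real.norm_of_nonneg (by positivity)] at hlow
    have hcoef : (2 * C)⁻¹ * ‖q‖ ^ 2 - C * ((2 * C)⁻¹ ^ 2 * ‖q‖ ^ 2) = ‖q‖ ^ 2 / (4 * C) := by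
      field_simp
      ring
    rw [hq, inner_sub_left, ← hq]
    linarith
  rw [← norm_neg, neg_sub, ← hq]
  rcases (norm_nonneg q).eq_or_lt with h0 | hpos
  · rw [← h0]
    positivity
  · have := hsq.trans (real_inner_le_norm q (x₁ - x₂))
    rw [div_le_iff₀ (by positivity), sq, mul_assoc] at this
    linarith [le_of_mul_le_mul_left this hpos]

/-- The concave conjugate of `g`, with the junk value `0` at slopes `p` for which `g - ⟪p, ·⟫` is
unbounded above. -/
def concaveConj (g : H → ℝ) (p : H) : ℝ :=
  ⨆ y, (g y - ⟪p, y⟫)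

theorem bddAbove_range_sub_inner (hη : 0 < η) (hg : ∀ y, g y ≤ -(η * ‖y‖ ^ 2)) (p : H) :
    BddAbove (range fun y => g y - ⟪p, y⟫) := by
  refine ⟨‖p‖ ^ 2 / (4 * η), forall_mem_range.2 fun y => ?_⟩
  rw [le_div_iff₀ (by positivity)]
  have hinner := neg_le_of_abs_le (abs_real_inner_le_norm p y)
  nlinarith [sq_nonneg (‖p‖ - 2 * η * ‖y‖), hg y]

theorem concaveConj_le {a : ℝ} (h : ∀ y, g y ≤ ⟪p, y⟫ + a) : concaveConj g p ≤ a :=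
  ciSup_le fun y => by linarith [h y]

theorem le_inner_add_concaveConj (hp : BddAbove (range fun y => g y - ⟪p, y⟫)) (y : H) :
    g y ≤ ⟪p, y⟫ + concaveConj g p := by
  linarith [show g y - ⟪p, y⟫ ≤ concaveConj g p from le_ciSup hp y]

theorem lowerSemicontinuous_concaveConj (h : ∀ p, BddAbove (range fun y => g y - ⟪p, y⟫)) :
    LowerSemicontinuous (concaveConj g) :=
  lowerSemicontinuous_ciSup h fun _ =>
    (continuous_const.sub (continuous_id.inner continuous_const)).lowerSemicontinuous

theorem concaveConj_midpoint_le (hbdd : ∀ p, BddAbove (range fun y => g y - ⟪p, y⟫))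
    (hg : IsSemiconvexWith C g) (p q h : H) : concaveConj g ((2⁻¹ : ℝ) • (p + q)) ≤
      2⁻¹ * (concaveConj g p + concaveConj g q + ⟪p, h⟫ - ⟪q, h⟫ + C * ‖h‖ ^ 2) := by
  refine concaveConj_le fun y => ?_
  have hp := le_inner_add_concaveConj (hbdd p) (y + h)
  have hq := le_inner_add_concaveConj (hbdd q) (y - h)
  rw [inner_add_right] at hp
  rw [inner_sub_right] at hq
  rw [real_inner_smul_left, inner_add_left]
  linarith [hg y h]

theorem exists_isMinOn_inner_add [FiniteDimensional ℝ H] {c : H → ℝ} (hc : LowerSemicontinuous c)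
    (hδ : 0 ≤ δ) (x : H) :
    ∃ p, ‖p‖ ≤ δ ∧ ∀ q, ‖q‖ ≤ δ → ⟪p, x⟫ + c p ≤ ⟪q, x⟫ + c q := by
  have hlsc : LowerSemicontinuous fun p : H => ⟪p, x⟫ + c p :=
    (continuous_id.inner continuous_const).lowerSemicontinuous.add hc
  obtain ⟨p, hp, hmin⟩ := LowerSemicontinuousOn.exists_isMinOn
    (Metric.nonempty_closedBall.2 hδ) (isCompact_closedBall (0 : H) δ)
    (hlsc.lowerSemicontinuousOn _)
  exact ⟨p, mem_closedBall_zero_iff.1 hp, fun q hq => hmin (mem_closedBall_zero_iff.2 hq)⟩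

theorem exists_eq_inner_add_concaveConj [FiniteDimensional ℝ H] (hg : Continuous g) (hη : 0 < η)
    (hle : ∀ y, g y ≤ -(η * ‖y‖ ^ 2)) (p : H) : ∃ x, g x = ⟪p, x⟫ + concaveConj g p := by
  have hcoercive : Tendsto (fun y => g y - ⟪p, y⟫) (cocompact H) atBot := by
    refine tendsto_atBot_mono (f := fun y => -(‖y‖ * (η * ‖y‖ - ‖p‖))) (fun y => ?_)
      (tendsto_neg_atTop_atBot.comp ?_)
    · have := neg_le_of_abs_le (abs_real_inner_le_norm p y)
      linarith [hle y]
    · have hnorm := tendsto_norm_cocompact_atTop (E := H)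
      exact hnorm.atTop_mul_atTop₀
        (tendsto_atTop_add_const_right _ _ (hnorm.const_mul_atTop hη))
  obtain ⟨x, hx⟩ :=
    Continuous.exists_forall_ge (hg.sub (continuous_const.inner continuous_id)) hcoercive
  refine ⟨x, le_antisymm (le_inner_add_concaveConj (bddAbove_range_sub_inner hη hle p) x) ?_⟩
  have hconj : concaveConj g p ≤ g x - ⟪p, x⟫ := ciSup_le hx
  linarith

/-- `Γ` is a concave majorant of `g` with superdifferential `G` bounded by `δ`, which inherits the
semiconvexity constant of `g`, and every slope of norm at most `δ` supports `Γ` at a point where it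
touches `g`. -/
structure IsConcaveMajorant (g Γ : H → ℝ) (G : H → H) (C δ : ℝ) : Prop where
  le : ∀ x, g x ≤ Γ x
  supergradient : ∀ x, IsSupergradient Γ (G x) x
  semiconvex : IsSemiconvexWith C Γ
  norm_le : ∀ x, ‖G x‖ ≤ δ
  exists_contact : ∀ p, ‖p‖ ≤ δ → ∃ x, Γ x = g x ∧ IsSupergradient Γ p x

theorem exists_isConcaveMajorant [FiniteDimensional ℝ H] (hg : Continuous g) (hη : 0 < η)
    (hδ : 0 ≤ δ) (hC : IsSemiconvexWith C g) (hle : ∀ y, g y ≤ -(η * ‖y‖ ^ 2)) :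
    ∃ Γ G, IsConcaveMajorant g Γ G C δ := by
  have hbdd := bddAbove_range_sub_inner hη hle
  choose G hGδ hG using exists_isMinOn_inner_add (lowerSemicontinuous_concaveConj hbdd) hδ
  have hmajor : ∀ x, g x ≤ ⟪G x, x⟫ + concaveConj g (G x) := fun x =>
    le_inner_add_concaveConj (hbdd _) x
  refine ⟨fun x => ⟪G x, x⟫ + concaveConj g (G x), G, hmajor, fun x y => ?_, fun x h => ?_, hGδ,
    fun p hp => ?_⟩
  · rw [inner_sub_right]
    linarith [hG y (G x) (hGδ x)]
  · have hball : ‖(2⁻¹ : ℝ) • (G (x + h) + G (x - h))‖ ≤ δ := by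
      rw [norm_smul, Real.norm_of_nonneg (by norm_num)]
      linarith [norm_add_le (G (x + h)) (G (x - h)), hGδ (x + h), hGδ (x - h)]
    have hmin := hG x _ hball
    have hmid := concaveConj_midpoint_le hbdd hC (G (x + h)) (G (x - h)) h
    rw [real_inner_smul_left, inner_add_left] at hmin
    simp only [inner_add_right, inner_sub_right] at hmid ⊢
    linarith
  · obtain ⟨x, hx⟩ := exists_eq_inner_add_concaveConj hg hη hle p
    refine ⟨x, le_antisymm (hx ▸ hG x p hp) (hmajor x), fun y => ?_⟩
    have hxΓ := hmajor x
    rw [inner_sub_right]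
    linarith [hG y p hp]

theorem exists_mem_notMem_of_interior_image_nonempty [FiniteDimensional ℝ H] [MeasurableSpace H]
    [BorelSpace H] {K : NNReal} (hG : LipschitzWith K G) {E Z : Set H}
    (hE : (interior (G '' E)).Nonempty) (hZ : Measure.addHaar Z = 0) : ∃ x ∈ E, x ∉ Z := by
  by_contra! hsub
  let μ : Measure H := Measure.hausdorffMeasure (Module.finrank ℝ H)
  have hac : μ ≪ Measure.addHaar := Measure.absolutelyContinuous_isAddHaarMeasure _ _
  have hnull := hG.hausdorffMeasure_image_le (d := (Module.finrank ℝ H : ℝ)) (by positivity) Z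
  rw [hac hZ, mul_zero, nonpos_iff_eq_zero] at hnull
  exact (isOpen_interior.measure_pos μ hE).ne'
    (measure_mono_null (interior_subset.trans (image_mono hsub)) hnull)

theorem isLittleO_infDist_add {E : Set H} (hx : x ∈ E)
    (hd : DifferentiableAt ℝ (fun y => Metric.infDist y E) x) :
    (fun h => Metric.infDist (x + h) E) =o[𝓝 0] fun h => h := by
  have hd0 : Metric.infDist x E = 0 := Metric.infDist_zero_of_mem hx
  have hmin : IsLocalMin (fun y => Metric.infDist y E) x :=
    Eventually.of_forall fun y => by simpa only [hd0] using Metric.infDist_nonneg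
  simpa [hmin.fderiv_eq_zero, hasFDerivAt_iff_isLittleO_nhds_zero, hd0] using hd.hasFDerivAt

namespace IsConcaveMajorant

theorem lipschitzWith (hΓ : IsConcaveMajorant g Γ G C δ) (hC : 0 < C) :
    LipschitzWith (4 * C).toNNReal G :=
  LipschitzWith.of_dist_le_mul fun x y => by
    rw [dist_eq_norm, dist_eq_norm, Real.coe_toNNReal _ (by positivity)]
    exact hΓ.semiconvex.norm_supergradient_sub_le hC (hΓ.supergradient x) (hΓ.supergradient y)

theorem closedBall_subset_image (hΓ : IsConcaveMajorant g Γ G C δ) (hC : 0 < C) :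
    Metric.closedBall 0 δ ⊆ G '' {x | Γ x = g x} := fun p hp => by
  obtain ⟨x, hx, hpx⟩ := hΓ.exists_contact p (mem_closedBall_zero_iff.1 hp)
  have := hΓ.semiconvex.norm_supergradient_sub_le hC (hΓ.supergradient x) hpx
  rw [sub_self, norm_zero, mul_zero] at this
  exact ⟨x, hx, sub_eq_zero.1 (norm_le_zero_iff.1 this)⟩

theorem sub_le_infDist_sq (hΓ : IsConcaveMajorant g Γ G C δ) (hC : 0 < C)
    (hg : IsSemiconvexWith C g) (hx : Γ x = g x) (y : H) :
    Γ y - g y ≤ C * Metric.infDist y {x | Γ x = g x} ^ 2 := by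
  have hcontact : ∀ z, Γ z = g z → Γ y - g y ≤ C * dist y z ^ 2 := fun z hz => by
    have hgz := hg z (y - z)
    rw [add_sub_cancel] at hgz
    rw [dist_eq_norm]
    linarith [hΓ.le (z - (y - z)), (hΓ.supergradient z).le_sub (y - z), hΓ.supergradient z y]
  have hsqrt : √((Γ y - g y) / C) ≤ Metric.infDist y {x | Γ x = g x} :=
    (Metric.le_infDist ⟨x, hx⟩).2 fun z hz => Real.sqrt_le_iff.2
      ⟨dist_nonneg, (div_le_iff₀' hC).2 (hcontact z hz)⟩
  exact (div_le_iff₀' hC).1 (Real.sqrt_le_iff.1 hsqrt).2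

theorem hasTaylorTwoAt (hΓ : IsConcaveMajorant g Γ G C δ) (hGx : DifferentiableAt ℝ G x) :
    HasTaylorTwoAt Γ (innerBil H (G x)) ((innerBil H).comp (fderiv ℝ G x)) x :=
  hasTaylorTwoAt_of_hasFDerivAt (f' := fun y => innerBil H (G y))
    (Eventually.of_forall fun y => hΓ.semiconvex.hasFDerivAt (hΓ.supergradient y))
    ((innerBil H).hasFDerivAt.comp x hGx.hasFDerivAt)

theorem hasTaylorTwoAt_of_contact (hΓ : IsConcaveMajorant g Γ G C δ) (hC : 0 < C)
    (hg : IsSemiconvexWith C g) (hx : Γ x = g x) (hGx : DifferentiableAt ℝ G x)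
    (hdx : DifferentiableAt ℝ (fun y => Metric.infDist y {x | Γ x = g x}) x) :
    HasTaylorTwoAt g (innerBil H (G x)) ((innerBil H).comp (fderiv ℝ G x)) x := by
  have hgap : (fun h => Γ (x + h) - g (x + h)) =o[𝓝 0] fun h => ‖h‖ ^ 2 := by
    refine IsBigO.trans_isLittleO (IsBigO.of_bound C (Eventually.of_forall fun h => ?_))
      ((isLittleO_infDist_add (E := {x | Γ x = g x}) hx hdx).norm_right.pow two_pos)
    rw [Real.norm_of_nonneg (sub_nonneg.2 (hΓ.le _)), Real.norm_of_nonneg (by positivity)]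
    exact hΓ.sub_le_infDist_sq hC hg hx _
  refine (IsLittleO.sub (hΓ.hasTaylorTwoAt hGx) hgap).congr_left fun h => ?_
  rw [hx]
  ring

theorem norm_contact_le (hΓ : IsConcaveMajorant g Γ G C δ) (h0 : g 0 = 0)
    (hle : ∀ y, g y ≤ -(η * ‖y‖ ^ 2)) (hη : 0 < η) (hδ : δ ≤ η * s) (hs : 0 ≤ s)
    (hx : Γ x = g x) : ‖x‖ ≤ s ∧ -(δ * s) ≤ g x := by
  have hgx : -(δ * ‖x‖) ≤ g x := by
    have h0x := (hΓ.supergradient x).le_sub x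
    rw [sub_self] at h0x
    have hinner := neg_le_of_abs_le (abs_real_inner_le_norm (G x) x)
    linarith [hΓ.le 0, mul_le_mul_of_nonneg_right (hΓ.norm_le x) (norm_nonneg x)]
  have hxs : ‖x‖ ≤ s := by
    by_contra! hlt
    have hpos : 0 < ‖x‖ := hs.trans_lt hlt
    have : η * s * ‖x‖ < η * ‖x‖ * ‖x‖ := by gcongr
    linarith [hle x, mul_le_mul_of_nonneg_right hδ hpos.le]
  have hδ0 : 0 ≤ δ := (norm_nonneg _).trans (hΓ.norm_le 0)
  exact ⟨hxs, by linarith [mul_le_mul_of_nonneg_left hxs hδ0]⟩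

end IsConcaveMajorant

/-- **Jensen's lemma** combined with Alexandrov's theorem. -/
theorem exists_hasTaylorTwoAt_near_max [FiniteDimensional ℝ H] (hg : Continuous g) (hC0 : 0 < C)
    (hη : 0 < η) (hs : 0 < s) (hC : IsSemiconvexWith C g) (hle : ∀ y, g y ≤ -(η * ‖y‖ ^ 2))
    (h0 : g 0 = 0) : ∃ (x : H) (l : H →L[ℝ] ℝ) (B : H →L[ℝ] H →L[ℝ] ℝ),
      ‖x‖ ≤ s ∧ ‖l‖ ≤ s ∧ -s ≤ g x ∧ (∀ v, B v v ≤ 0) ∧ HasTaylorTwoAt g l B x := by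
  borelize H
  obtain ⟨δ, hδ0, hδs, hδη, hδ1⟩ : ∃ δ, 0 < δ ∧ δ ≤ s ∧ δ ≤ η * s ∧ δ ≤ 1 :=
    ⟨min s (min (η * s) 1), by positivity, by simp, by simp, by simp⟩
  obtain ⟨Γ, G, hΓ⟩ := exists_isConcaveMajorant hg hη hδ0.le hC hle
  have hball : (interior (G '' {x | Γ x = g x})).Nonempty :=
    ⟨0, interior_mono (Metric.ball_subset_closedBall.trans (hΓ.closedBall_subset_image hC0))
      (by simpa [Metric.isOpen_ball.interior_eq] using hδ0)⟩
  -- By Rademacher, the slope and the distance to the contact set are differentiable a.e.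
  obtain ⟨x, hx, hxd⟩ := exists_mem_notMem_of_interior_image_nonempty (hΓ.lipschitzWith hC0) hball
    ((hΓ.lipschitzWith hC0).ae_differentiableAt.and
      (Metric.lipschitz_infDist_pt {x | Γ x = g x}).ae_differentiableAt)
  obtain ⟨hGx, hdx⟩ := not_not.1 hxd
  obtain ⟨hxs, hgx⟩ := hΓ.norm_contact_le h0 hle hη hδη hs.le hx
  refine ⟨x, innerBil H (G x), (innerBil H).comp (fderiv ℝ G x), hxs, ?_, ?_, ?_,
    hΓ.hasTaylorTwoAt_of_contact hC0 hC hx hGx hdx⟩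
  · exact ((innerSL_apply_norm ℝ (G x)).trans_le (hΓ.norm_le x)).trans hδs
  · nlinarith
  · exact (hΓ.hasTaylorTwoAt hGx).hessian_nonpos (.of_forall (hΓ.supergradient x).le_add)

end Jensen

section UpperJets

variable {E : Type*} [NormedAddCommGroup E] [NormedSpace ℝ E] {u v : E → ℝ} {y : E}
  {p : E →L[ℝ] ℝ} {A : E →L[ℝ] E →L[ℝ] ℝ}

/-- The pair `(p, A)` is an upper second order jet of `u` at `y`. -/
def IsUpperJet (u : E → ℝ) (y : E) (p : E →L[ℝ] ℝ) (A : E →L[ℝ] E →L[ℝ] ℝ) : Prop :=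
  ∀ ε > 0, ∀ᶠ h in 𝓝 (0 : E), u (y + h) ≤ u y + p h + 2⁻¹ * A h h + ε * ‖h‖ ^ 2

theorem IsUpperJet.of_add_affine {a : E} {c : ℝ} {q : E →L[ℝ] ℝ}
    (h : IsUpperJet (fun z => u (a + z) + (c - q z)) y p A) :
    IsUpperJet u (a + y) (p + q) A := fun ε hε => by
  filter_upwards [h ε hε] with k hk
  rw [map_add] at hk
  rw [add_assoc, _root_.add_apply]
  linarith

end UpperJets

section SupConvolution

variable {V : Type*} [NormedAddCommGroup V] {K : Set V} {a : ℝ} {f f' : V → ℝ} {π : V → V}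

/-- `f'` is the sup-convolution of `f|K` with `a ‖·‖²`, attained at the points `π x`. -/
structure IsSupConv (K : Set V) (a : ℝ) (f f' : V → ℝ) (π : V → V) : Prop where
  mem : ∀ x, π x ∈ K
  eq : ∀ x, f' x = f (π x) - a * ‖x - π x‖ ^ 2
  le : ∀ x, ∀ z ∈ K, f z - a * ‖x - z‖ ^ 2 ≤ f' x

theorem exists_isSupConv (hK : IsCompact K) (hne : K.Nonempty) (hf : UpperSemicontinuousOn f K)
    (a : ℝ) : ∃ f' π, IsSupConv K a f f' π := by
  have hmax : ∀ x : V, ∃ y ∈ K, ∀ z ∈ K, f z - a * ‖x - z‖ ^ 2 ≤ f y - a * ‖x - y‖ ^ 2 := by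
    intro x
    have husc : UpperSemicontinuousOn (fun z => f z + -(a * ‖x - z‖ ^ 2)) K :=
      hf.add ((by fun_prop : Continuous fun z => -(a * ‖x - z‖ ^ 2)).upperSemicontinuous
        |>.upperSemicontinuousOn _)
    obtain ⟨y, hy, hmax⟩ := UpperSemicontinuousOn.exists_isMaxOn hne hK husc
    exact ⟨y, hy, fun z hz => by simpa [sub_eq_add_neg] using hmax hz⟩
  choose π hπ hmax using hmax
  exact ⟨fun x => f (π x) - a * ‖x - π x‖ ^ 2, π, hπ, fun _ => rfl, hmax⟩

theorem norm_sub_sq_le_three_mul (x y x' y' : V) :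
    ‖x' - y'‖ ^ 2 ≤ 3 * (‖x - y‖ ^ 2 + ‖x - x'‖ ^ 2 + ‖y - y'‖ ^ 2) := by
  have htri : ‖x' - y'‖ ≤ ‖x - y‖ + ‖x - x'‖ + ‖y - y'‖ := by
    rw [show x' - y' = (x - y) - (x - x') + (y - y') by abel]
    exact (norm_add_le _ _).trans (add_le_add_left (norm_sub_le _ _) _)
  have hsq : ‖x' - y'‖ ^ 2 ≤ (‖x - y‖ + ‖x - x'‖ + ‖y - y'‖) ^ 2 := by gcongr
  nlinarith [sq_nonneg (‖x - y‖ - ‖x - x'‖), sq_nonneg (‖x - y‖ - ‖y - y'‖),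
    sq_nonneg (‖x - x'‖ - ‖y - y'‖)]

namespace IsSupConv

theorem apply_le (h : IsSupConv K a f f' π) (ha : 0 ≤ a) (x : V) : f' x ≤ f (π x) := by
  have : 0 ≤ a * ‖x - π x‖ ^ 2 := by positivity
  linarith [h.eq x]

theorem add_le {L : Set V} {f₁ f₂ g₁ g₂ : V → ℝ} {π₁ π₂ : V → V} {α : ℝ}
    (h₁ : IsSupConv K (3 * α / 2) f₁ g₁ π₁) (h₂ : IsSupConv L (3 * α / 2) f₂ g₂ π₂) (hα : 0 ≤ α)
    (hle : ∀ x ∈ K, ∀ y ∈ L, f₁ x + f₂ y ≤ α / 2 * ‖x - y‖ ^ 2) (x y : V) :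
    g₁ x + g₂ y ≤ 3 * α / 2 * ‖x - y‖ ^ 2 := by
  rw [h₁.eq, h₂.eq]
  linarith [hle _ (h₁.mem x) _ (h₂.mem y),
    mul_le_mul_of_nonneg_left (norm_sub_sq_le_three_mul x y (π₁ x) (π₂ y)) hα]

variable [InnerProductSpace ℝ V] {x : V} {l : V →L[ℝ] ℝ} {A : V →L[ℝ] V →L[ℝ] ℝ}

theorem continuous (h : IsSupConv K a f f' π) (hK : IsCompact K) (ha : 0 ≤ a) :
    Continuous f' := by
  obtain ⟨R, hR⟩ := hK.isBounded.exists_norm_le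
  have hR0 : 0 ≤ R := (norm_nonneg _).trans (hR _ (h.mem 0))
  -- `f' + a ‖·‖²` is a supremum of affine functions with slopes in `2 a K`.
  have hlip : LipschitzWith (2 * a * R).toNNReal fun x => f' x + a * ‖x‖ ^ 2 := by
    refine LipschitzWith.of_le_add_mul _ fun x y => ?_
    rw [Real.coe_toNNReal _ (by positivity), dist_eq_norm]
    have hy := h.le y _ (h.mem x)
    have hx := h.eq x
    rw [norm_sub_sq_real] at hx hy
    have hinner : ⟪x - y, π x⟫ ≤ ‖x - y‖ * R :=
      (real_inner_le_norm _ _).trans (by gcongr; exact hR _ (h.mem x))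
    rw [inner_sub_left] at hinner
    linarith [mul_le_mul_of_nonneg_left hinner (by positivity : 0 ≤ 2 * a)]
  have hsub : Continuous fun x => f' x + a * ‖x‖ ^ 2 - a * ‖x‖ ^ 2 :=
    hlip.continuous.sub (by fun_prop)
  simpa only [add_sub_cancel_right] using hsub

theorem isSemiconvexWith (h : IsSupConv K a f f' π) : IsSemiconvexWith (2 * a) f' := fun x k => by
  have hpar := congrArg (a * ·) (parallelogram_law_with_norm ℝ (x - π x) k)
  rw [sub_add_eq_add_sub, sub_right_comm] at hpar
  linarith [h.le (x + k) _ (h.mem x), h.le (x - k) _ (h.mem x), h.eq x]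

theorem eq_of_hasTaylorTwoAt (h : IsSupConv K a f f' π) (hT : HasTaylorTwoAt f' l A x) :
    l = innerBil V ((2 * a) • (π x - x)) := by
  have hmin : IsLocalMin (fun y => f' y + a * ‖y - π x‖ ^ 2) x :=
    Eventually.of_forall fun y => by linarith [h.le y _ (h.mem x), h.eq x]
  have hzero := hmin.hasFDerivAt_eq_zero
    (hT.add ((hasTaylorTwoAt_norm_sub_sq (π x) x).const_mul a)).hasFDerivAt
  rw [eq_neg_of_add_eq_zero_left hzero, smul_smul, ← map_smul, ← map_neg, ← smul_neg, neg_sub,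
    mul_comm]

theorem norm_eq_of_hasTaylorTwoAt (h : IsSupConv K a f f' π) (ha : 0 ≤ a)
    (hT : HasTaylorTwoAt f' l A x) : ‖l‖ = 2 * a * ‖π x - x‖ := by
  rw [h.eq_of_hasTaylorTwoAt hT, innerBil, innerSL_apply_norm, norm_smul,
    Real.norm_of_nonneg (by positivity)]

theorem isUpperJet (h : IsSupConv K a f f' π) (hT : HasTaylorTwoAt f' l A x)
    (hx : π x ∈ interior K) : IsUpperJet f (π x) l A := by
  intro ε hε
  have htend : Tendsto (fun k => π x + k) (𝓝 0) (𝓝 (π x)) := by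
    simpa using (continuous_const_add (π x)).tendsto 0
  filter_upwards [IsLittleO.def hT hε, htend.eventually (mem_interior_iff_mem_nhds.1 hx)]
    with k hk hkK
  have hle := h.le (x + k) _ hkK
  rw [add_sub_add_right_eq_sub] at hle
  rw [norm_pow, norm_norm] at hk
  linarith [(abs_le.1 hk).2, h.eq x]

end IsSupConv

end SupConvolution

section Sums

variable {V : Type*} [NormedAddCommGroup V] [InnerProductSpace ℝ V]

/-- The left inclusion of `V` in the Hilbert sum of two copies of `V`. -/
def inlL2 (V : Type*) [NormedAddCommGroup V] [InnerProductSpace ℝ V] :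
    V →ₗᵢ[ℝ] WithLp 2 (V × V) where
  toLinearMap := (WithLp.linearEquiv 2 ℝ (V × V)).symm.toLinearMap ∘ₗ LinearMap.inl ℝ V V
  norm_map' := WithLp.norm_toLp_fst 2 V V

/-- The right inclusion of `V` in the Hilbert sum of two copies of `V`. -/
def inrL2 (V : Type*) [NormedAddCommGroup V] [InnerProductSpace ℝ V] :
    V →ₗᵢ[ℝ] WithLp 2 (V × V) where
  toLinearMap := (WithLp.linearEquiv 2 ℝ (V × V)).symm.toLinearMap ∘ₗ LinearMap.inr ℝ V V
  norm_map' := WithLp.norm_toLp_snd 2 V V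

@[simp] theorem inlL2_fst (a : V) : (inlL2 V a).fst = a := rfl
@[simp] theorem inlL2_snd (a : V) : (inlL2 V a).snd = 0 := rfl
@[simp] theorem inrL2_fst (a : V) : (inrL2 V a).fst = 0 := rfl
@[simp] theorem inrL2_snd (a : V) : (inrL2 V a).snd = a := rfl

theorem inrL2_snd_add_inlL2_fst (z : WithLp 2 (V × V)) :
    inrL2 V z.snd + inlL2 V z.fst = z :=
  WithLp.ofLp_injective 2 (Prod.ext (zero_add z.fst) (add_zero z.snd))

theorem norm_sq_add_norm_sq_sub (a b : V) :
    ‖a + b‖ ^ 2 + ‖a - b‖ ^ 2 = 2 * (‖a‖ ^ 2 + ‖b‖ ^ 2) := by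
  linarith [parallelogram_law_with_norm ℝ a b]

/-- `g₁ ⊕ g₂` with the variables doubled: penalized off the diagonal by `b ‖z₁ - z₂‖²`, and by
`η ‖z‖²` away from the origin. -/
def doubling (g₁ g₂ : V → ℝ) (b η : ℝ) (z : WithLp 2 (V × V)) : ℝ :=
  g₁ z.fst + g₂ z.snd - b * ‖z.fst - z.snd‖ ^ 2 - η * ‖z‖ ^ 2

theorem isSemiconvexWith_doubling {g₁ g₂ : V → ℝ} {C b η : ℝ} (h₁ : IsSemiconvexWith C g₁)
    (h₂ : IsSemiconvexWith C g₂) (hb : 0 ≤ b) :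
    IsSemiconvexWith (C + 4 * b + 2 * η) (doubling g₁ g₂ b η) := fun z h => by
  have hz := norm_sq_add_norm_sq_sub z h
  have hd := norm_sq_add_norm_sq_sub (z.fst - z.snd) (h.fst - h.snd)
  rw [sub_add_sub_comm, sub_sub_sub_comm] at hd
  have hh := norm_sq_add_norm_sq_sub h.fst h.snd
  have hη := congrArg (η * ·) hz
  have hbd := congrArg (b * ·) hd
  have hbh := congrArg (b * ·) hh
  have hsq := mul_nonneg hb (sq_nonneg ‖h.fst + h.snd‖)
  have hL2 := WithLp.prod_norm_sq_eq_of_L2 h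
  have hC := congrArg (C * ·) hL2
  have hbL2 := congrArg (b * ·) hL2
  simp only [doubling, WithLp.add_fst, WithLp.add_snd, WithLp.sub_fst, WithLp.sub_snd]
  linarith [h₁ z.fst h.fst, h₂ z.snd h.snd]

theorem HasTaylorTwoAt.of_comp_isometry {W : Type*} [NormedAddCommGroup W] [NormedSpace ℝ W]
    {g : W → ℝ} {f : V → ℝ} {b η k : ℝ} {z w : W} {c y : V} {L : V →ₗᵢ[ℝ] W}
    {l : W →L[ℝ] ℝ} {B : W →L[ℝ] W →L[ℝ] ℝ} (hg : HasTaylorTwoAt g l B z) (hz : w + L y = z)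
    (hb : 0 ≤ b) (hη : 0 ≤ η)
    (hf : ∀ x, f x = g (w + L x) + b * ‖x - c‖ ^ 2 + η * ‖x‖ ^ 2 + k) :
    ∃ l' A, ‖l'‖ ≤ ‖l‖ + 2 * b * ‖y - c‖ + 2 * η * ‖y‖ ∧ HasTaylorTwoAt f l' A y := by
  have hT : HasTaylorTwoAt (fun x => g (w + L x) + b * ‖x - c‖ ^ 2 + η * ‖x - 0‖ ^ 2 + k)
    _ _ y := (((hg.comp_affine (L := L.toContinuousLinearMap) hz).add
    ((hasTaylorTwoAt_norm_sub_sq c y).const_mul b)).add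
    ((hasTaylorTwoAt_norm_sub_sq 0 y).const_mul η)).add (hasTaylorTwoAt_const k y)
  simp only [sub_zero, add_zero, ← hf] at hT
  refine ⟨_, _, ?_, hT⟩
  have hl : ‖l ∘L L.toContinuousLinearMap‖ ≤ ‖l‖ :=
    ContinuousLinearMap.opNorm_le_bound _ (norm_nonneg _) fun v => by
      simpa using l.le_opNorm (L v)
  have hsq : ∀ {t : ℝ} (v : V), 0 ≤ t → ‖t • (2 : ℝ) • innerBil V v‖ = 2 * t * ‖v‖ :=
    fun {t} v ht => by
      rw [innerBil, norm_smul, norm_smul, innerSL_apply_norm, Real.norm_of_nonneg ht,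
        Real.norm_ofNat]
      ring
  refine norm_add₃_le.trans ?_
  rw [hsq _ hb, hsq _ hη]
  gcongr

theorem HasTaylorTwoAt.doubling_hessian_eq {g₁ g₂ : V → ℝ} {b η : ℝ} {z : WithLp 2 (V × V)}
    {l : WithLp 2 (V × V) →L[ℝ] ℝ} {l₁ l₂ : V →L[ℝ] ℝ} {A₁ A₂ : V →L[ℝ] V →L[ℝ] ℝ}
    {B : WithLp 2 (V × V) →L[ℝ] WithLp 2 (V × V) →L[ℝ] ℝ}
    (hg : HasTaylorTwoAt (doubling g₁ g₂ b η) l B z) (h₁ : HasTaylorTwoAt g₁ l₁ A₁ z.fst)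
    (h₂ : HasTaylorTwoAt g₂ l₂ A₂ z.snd) (h : WithLp 2 (V × V)) :
    B h h = A₁ h.fst h.fst + A₂ h.snd h.snd - 2 * b * ‖h.fst - h.snd‖ ^ 2 - 2 * η * ‖h‖ ^ 2 := by
  have hfst := HasTaylorTwoAt.comp_clm (L := WithLp.fstL 2 ℝ V V) (y := z) h₁
  have hsnd := HasTaylorTwoAt.comp_clm (L := WithLp.sndL 2 ℝ V V) (y := z) h₂
  have hdiff := HasTaylorTwoAt.comp_clm (L := WithLp.fstL 2 ℝ V V - WithLp.sndL 2 ℝ V V) (y := z)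
    (hasTaylorTwoAt_norm_sub_sq 0 _)
  have hsum := ((hfst.add hsnd).sub (hdiff.const_mul b)).sub
    ((hasTaylorTwoAt_norm_sub_sq 0 z).const_mul η)
  simp only [sub_zero] at hsum
  refine (hg.hessian_unique hsum h).trans ?_
  simp only [_root_.sub_apply, _root_.add_apply, _root_.smul_apply,
    ContinuousLinearMap.bilinearComp_apply, innerBil_apply, smul_eq_mul,
    real_inner_self_eq_norm_sq, WithLp.fstL_apply, WithLp.sndL_apply]
  ring

theorem exists_hasTaylorTwoAt_near_diagonal [FiniteDimensional ℝ V] {g₁ g₂ : V → ℝ} {C b η s : ℝ}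
    (hg₁ : Continuous g₁) (hg₂ : Continuous g₂) (h₁ : IsSemiconvexWith C g₁)
    (h₂ : IsSemiconvexWith C g₂) (hC : 0 ≤ C) (hb : 0 ≤ b) (hη : 0 < η) (hs : 0 < s)
    (hle : ∀ x y, g₁ x + g₂ y ≤ b * ‖x - y‖ ^ 2) (h0 : g₁ 0 + g₂ 0 = 0) :
    ∃ (x y : V) (p q : V →L[ℝ] ℝ) (A B : V →L[ℝ] V →L[ℝ] ℝ), ‖x‖ ≤ s ∧ ‖y‖ ≤ s ∧
      ‖p‖ ≤ (1 + 4 * b + 2 * η) * s ∧ ‖q‖ ≤ (1 + 4 * b + 2 * η) * s ∧ -s ≤ g₁ x + g₂ y ∧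
      HasTaylorTwoAt g₁ p A x ∧ HasTaylorTwoAt g₂ q B y ∧
      ∀ v w, A v v + B w w ≤ 2 * b * ‖v - w‖ ^ 2 + 2 * η * (‖v‖ ^ 2 + ‖w‖ ^ 2) := by
  have hcont : Continuous (doubling g₁ g₂ b η) := by
    have hfst := (WithLp.fstL 2 ℝ V V).continuous
    have hsnd := (WithLp.sndL 2 ℝ V V).continuous
    exact (((hg₁.comp hfst).add (hg₂.comp hsnd)).sub
      (((hfst.sub hsnd).norm.pow 2).const_mul b)).sub ((continuous_norm.pow 2).const_mul η)
  obtain ⟨z, l, D, hz, hl, hgz, hD, hT⟩ := exists_hasTaylorTwoAt_near_max hcont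
    (by positivity) hη hs (isSemiconvexWith_doubling h₁ h₂ hb)
    (fun z => by rw [doubling]; linarith [hle z.fst z.snd])
    (by simpa [doubling] using h0)
  have hnorm : ∀ h : WithLp 2 (V × V), ‖h‖ ^ 2 = ‖h.fst‖ ^ 2 + ‖h.snd‖ ^ 2 :=
    WithLp.prod_norm_sq_eq_of_L2
  have hx := (WithLp.norm_fst_le V z).trans hz
  have hy := (WithLp.norm_snd_le V z).trans hz
  have hxy := norm_sub_le z.fst z.snd
  obtain ⟨p, A, hp, hA⟩ := hT.of_comp_isometry (L := inlL2 V) (f := g₁) (b := b) (η := η)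
    (c := z.snd) (k := η * ‖z.snd‖ ^ 2 - g₂ z.snd) (inrL2_snd_add_inlL2_fst z) hb hη.le
    (fun x => by simp [doubling, hnorm]; ring)
  obtain ⟨q, B, hq, hB⟩ := hT.of_comp_isometry (L := inrL2 V) (f := g₂) (b := b) (η := η)
    (c := z.fst) (k := η * ‖z.fst‖ ^ 2 - g₁ z.fst)
    ((add_comm _ _).trans (inrL2_snd_add_inlL2_fst z)) hb hη.le
    (fun y => by simp [doubling, hnorm, norm_sub_rev z.fst y]; ring)
  have hslope : ∀ {t d : ℝ}, d ≤ 2 * s → t ≤ s →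
      ‖l‖ + 2 * b * d + 2 * η * t ≤ (1 + 4 * b + 2 * η) * s := fun hd ht => by
    linarith [mul_le_mul_of_nonneg_left hd hb, mul_le_mul_of_nonneg_left ht hη.le]
  refine ⟨z.fst, z.snd, p, q, A, B, hx, hy, hp.trans (hslope (by linarith) hx),
    hq.trans (hslope (by rw [norm_sub_rev]; linarith) hy), ?_, hA, hB, fun v w => ?_⟩
  · have hpen : 0 ≤ b * ‖z.fst - z.snd‖ ^ 2 + η * ‖z‖ ^ 2 := by positivity
    rw [doubling] at hgz
    linarith
  · have hneg := hD (inlL2 V v + inrL2 V w)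
    rw [hT.doubling_hessian_eq hA hB, hnorm] at hneg
    simp only [WithLp.add_fst, WithLp.add_snd, inlL2_fst, inlL2_snd, inrL2_fst, inrL2_snd,
      add_zero, zero_add] at hneg
    linarith

theorem theorem_on_sums_at_zero [FiniteDimensional ℝ V] {K L : Set V} (hK : IsCompact K)
    (hL : IsCompact L) (h0K : 0 ∈ interior K) (h0L : 0 ∈ interior L) {f₁ f₂ : V → ℝ}
    (hf₁ : UpperSemicontinuousOn f₁ K) (hf₂ : UpperSemicontinuousOn f₂ L) (h₁ : f₁ 0 = 0)
    (h₂ : f₂ 0 = 0) {α τ : ℝ} (hα : 0 < α) (hτ : 0 < τ)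
    (hle : ∀ x ∈ K, ∀ y ∈ L, f₁ x + f₂ y ≤ α / 2 * ‖x - y‖ ^ 2) :
    ∃ (x y : V) (p q : V →L[ℝ] ℝ) (A B : V →L[ℝ] V →L[ℝ] ℝ), x ∈ interior K ∧ y ∈ interior L ∧
      ‖x‖ ≤ τ ∧ ‖y‖ ≤ τ ∧ ‖p‖ ≤ τ ∧ ‖q‖ ≤ τ ∧ -τ ≤ f₁ x + f₂ y ∧
      IsUpperJet f₁ x p A ∧ IsUpperJet f₂ y q B ∧
      ∀ a b, A a a + B b b ≤ 3 * α * ‖a - b‖ ^ 2 + τ * (‖a‖ ^ 2 + ‖b‖ ^ 2) := by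
  obtain ⟨g₁, π₁, hS₁⟩ := exists_isSupConv hK ⟨0, interior_subset h0K⟩ hf₁ (3 * α / 2)
  obtain ⟨g₂, π₂, hS₂⟩ := exists_isSupConv hL ⟨0, interior_subset h0L⟩ hf₂ (3 * α / 2)
  have hgle := hS₁.add_le hS₂ hα.le hle
  have hg0 : g₁ 0 + g₂ 0 = 0 := le_antisymm (by simpa using hgle 0 0) <| add_nonneg
    (by simpa [h₁] using hS₁.le 0 0 (interior_subset h0K))
    (by simpa [h₂] using hS₂.le 0 0 (interior_subset h0L))
  obtain ⟨r, hr, hrKL⟩ := Metric.nhds_basis_closedBall.mem_iff.1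
    ((isOpen_interior.inter isOpen_interior).mem_nhds (mem_inter h0K h0L))
  obtain ⟨κ, hκ, hκ0⟩ : ∃ κ, κ = 1 + 4 * (3 * α / 2) + 2 * (τ / 2) ∧ 0 < κ :=
    ⟨_, rfl, by positivity⟩
  obtain ⟨s, hs0, hsτ, hκs, hsr⟩ : ∃ s, 0 < s ∧ s ≤ τ ∧ κ * s ≤ τ ∧
      s + κ * s / (3 * α) ≤ min τ r := by
    have : 0 < min τ r := lt_min hτ hr
    refine ⟨min (min τ (τ / κ)) (min τ r / (1 + κ / (3 * α))), by positivity, ?_, ?_, ?_⟩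
    · exact (min_le_left _ _).trans (min_le_left _ _)
    · exact (le_div_iff₀' hκ0).1 ((min_le_left _ _).trans (min_le_right _ _))
    · refine Eq.trans_le ?_ ((le_div_iff₀ (by positivity : 0 < 1 + κ / (3 * α))).1
        (min_le_right (min τ (τ / κ)) _))
      ring
  obtain ⟨x, y, p, q, A, B, hx, hy, hp, hq, hxy, hA, hB, hAB⟩ :=
    exists_hasTaylorTwoAt_near_diagonal (hS₁.continuous hK (by positivity))
      (hS₂.continuous hL (by positivity)) hS₁.isSemiconvexWith hS₂.isSemiconvexWith
      (by positivity) (by positivity) (half_pos hτ) hs0 hgle hg0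
  rw [← hκ] at hp hq
  have hclose : ∀ {ξ ζ : V} {l : V →L[ℝ] ℝ}, ‖l‖ = 2 * (3 * α / 2) * ‖ζ - ξ‖ → ‖l‖ ≤ κ * s →
      ‖ξ‖ ≤ s → ‖ζ‖ ≤ min τ r := fun {ξ ζ l} hl hls hξ => by
    have hdist : ‖ζ - ξ‖ ≤ κ * s / (3 * α) := by
      rw [le_div_iff₀ (by positivity)]
      linarith
    linarith [norm_le_norm_sub_add ζ ξ]
  have hζ₁ := hclose (hS₁.norm_eq_of_hasTaylorTwoAt (by positivity) hA) hp hx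
  have hζ₂ := hclose (hS₂.norm_eq_of_hasTaylorTwoAt (by positivity) hB) hq hy
  have hK₁ : π₁ x ∈ interior K := (hrKL (by simpa using hζ₁.trans (min_le_right _ _))).1
  have hL₂ : π₂ y ∈ interior L := (hrKL (by simpa using hζ₂.trans (min_le_right _ _))).2
  refine ⟨π₁ x, π₂ y, p, q, A, B, hK₁, hL₂, hζ₁.trans (min_le_left _ _),
    hζ₂.trans (min_le_left _ _), hp.trans hκs, hq.trans hκs, ?_, hS₁.isUpperJet hA hK₁,
    hS₂.isUpperJet hB hL₂, fun a b => by linarith [hAB a b]⟩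
  linarith [hS₁.apply_le (by positivity) x, hS₂.apply_le (by positivity) y]

/-- The **theorem on sums** of Crandall, Ishii and Lions, in approximate form: the jets of the
limiting statement are replaced by jets at nearby points. -/
theorem theorem_on_sums [FiniteDimensional ℝ V] {K L : Set V} (hK : IsCompact K)
    (hL : IsCompact L) {u v : V → ℝ} (hu : UpperSemicontinuousOn u K)
    (hv : UpperSemicontinuousOn v L) {x y : V} (hx : x ∈ interior K) (hy : y ∈ interior L)
    {α τ : ℝ} (hα : 0 < α) (hτ : 0 < τ) (hmax : ∀ x' ∈ K, ∀ y' ∈ L,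
      u x' + v y' - α / 2 * ‖x' - y'‖ ^ 2 ≤ u x + v y - α / 2 * ‖x - y‖ ^ 2) :
    ∃ (x₁ y₁ : V) (p q : V →L[ℝ] ℝ) (A B : V →L[ℝ] V →L[ℝ] ℝ), x₁ ∈ interior K ∧
      y₁ ∈ interior L ∧ ‖x₁ - x‖ ≤ τ ∧ ‖y₁ - y‖ ≤ τ ∧ u x + v y - τ ≤ u x₁ + v y₁ ∧
      ‖p - innerBil V (α • (x - y))‖ ≤ τ ∧ ‖q + innerBil V (α • (x - y))‖ ≤ τ ∧
      IsUpperJet u x₁ p A ∧ IsUpperJet v y₁ q B ∧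
      ∀ a b, A a a + B b b ≤ 3 * α * ‖a - b‖ ^ 2 + τ * (‖a‖ ^ 2 + ‖b‖ ^ 2) := by
  set P := innerBil V (α • (x - y)) with hP
  have hKx : IsCompact ((x + ·) ⁻¹' K) := (Homeomorph.addLeft x).isCompact_preimage.2 hK
  have hLy : IsCompact ((y + ·) ⁻¹' L) := (Homeomorph.addLeft y).isCompact_preimage.2 hL
  have hint : ∀ (S : Set V) (a b : V), b ∈ interior ((a + ·) ⁻¹' S) ↔ a + b ∈ interior S :=
    fun S a b => by
      rw [← mem_preimage (f := (a + ·)) (s := interior S)]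
      exact (Set.ext_iff.1 ((Homeomorph.addLeft a).preimage_interior S) b).symm
  have husc : ∀ {S : Set V} {w : V → ℝ} (a : V) (c : ℝ) (q : V →L[ℝ] ℝ),
      UpperSemicontinuousOn w S →
      UpperSemicontinuousOn (fun z => w (a + z) + (c - q z)) ((a + ·) ⁻¹' S) :=
    fun a c q hw => (hw.comp (continuous_const_add a).continuousOn fun _ h => h).add
      ((continuous_const.sub q.continuous).upperSemicontinuous.upperSemicontinuousOn _)
  obtain ⟨ζ, hζ0, hζτ, hζP⟩ : ∃ ζ, 0 < ζ ∧ ζ ≤ τ ∧ ζ + 2 * (‖P‖ * ζ) ≤ τ := by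
    refine ⟨τ / (1 + 2 * ‖P‖), by positivity,
      div_le_self hτ.le (by linarith [norm_nonneg P]), le_of_eq ?_⟩
    field_simp
  have hle : ∀ x' ∈ (x + ·) ⁻¹' K, ∀ y' ∈ (y + ·) ⁻¹' L,
      u (x + x') + (-u x - P x') + (v (y + y') + (-v y - (-P) y')) ≤ α / 2 * ‖x' - y'‖ ^ 2 := by
    intro x' hx' y' hy'
    have := hmax _ hx' _ hy'
    rw [add_sub_add_comm, norm_add_sq_real, inner_sub_right] at this
    simp only [hP, innerBil_apply, _root_.neg_apply, real_inner_smul_left]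
    linarith
  obtain ⟨x₁, y₁, p, q, A, B, hx₁, hy₁, hxζ, hyζ, hp, hq, huv, hA, hB, hAB⟩ :=
    theorem_on_sums_at_zero hKx hLy ((hint _ _ _).2 (by simpa)) ((hint _ _ _).2 (by simpa))
      (husc x (-u x) P hu) (husc y (-v y) (-P) hv) (by simp) (by simp) hα hζ0 hle
  refine ⟨x + x₁, y + y₁, p + P, q + -P, A, B, (hint _ _ _).1 hx₁, (hint _ _ _).1 hy₁, ?_, ?_,
    ?_, ?_, ?_, hA.of_add_affine, hB.of_add_affine, fun a b => (hAB a b).trans ?_⟩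
  · simpa using hxζ.trans hζτ
  · simpa using hyζ.trans hζτ
  · have hPx := (abs_le.1 (P.le_of_opNorm_le_of_le le_rfl hxζ)).1
    have hPy := (abs_le.1 (P.le_of_opNorm_le_of_le le_rfl hyζ)).2
    rw [_root_.neg_apply] at huv
    linarith
  · simpa using hp.trans hζτ
  · simpa using hq.trans hζτ
  · gcongr

end Sums

section Doubling

theorem exists_isMaxOn_sub_const_mul_near {Z : Type*} [TopologicalSpace Z] {S U : Set Z}
    (hS : IsCompact S) {w ψ : Z → ℝ} (hw : UpperSemicontinuousOn w S) (hψ : Continuous ψ)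
    (hψ0 : ∀ z, 0 ≤ ψ z) {z₀ : Z} (hz₀ : z₀ ∈ S) (hψz₀ : ψ z₀ = 0)
    (hmax : ∀ z ∈ S, ψ z = 0 → z ≠ z₀ → w z < w z₀) (hU : U ∈ 𝓝 z₀) {ε : ℝ} (hε : 0 < ε) :
    ∃ α > 0, ∃ z ∈ S ∩ U, α * ψ z < ε ∧ IsMaxOn (fun z => w z - α * ψ z) S z := by
  have husc : ∀ k : ℝ, UpperSemicontinuousOn (fun z => w z - k * ψ z) S := fun k => by
    simp only [sub_eq_add_neg]
    exact hw.add ((hψ.const_mul k).neg.upperSemicontinuous.upperSemicontinuousOn S)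
  obtain ⟨O, hO, hzO, hOS⟩ :=
    mem_nhdsWithin.1 (inter_mem (hw z₀ hz₀ _ (lt_add_of_pos_right _ hε))
      (mem_nhdsWithin_of_mem_nhds hU))
  have hfar : ∃ k₀, ∀ k ≥ k₀, ∀ z ∈ S \ O, w z - k * ψ z < w z₀ := by
    refine (hS.diff hO).induction_on (p := fun t => ∃ k₀, ∀ k ≥ k₀, ∀ z ∈ t, w z - k * ψ z < w z₀)
      ⟨0, by simp⟩ (fun _ _ hst ⟨k₀, h⟩ => ⟨k₀, fun k hk z hz => h k hk z (hst hz)⟩)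
      (fun _ _ ⟨k₁, h₁⟩ ⟨k₂, h₂⟩ => ⟨max k₁ k₂, fun k hk z hz => hz.elim
        (h₁ k ((le_max_left _ _).trans hk) z) (h₂ k ((le_max_right _ _).trans hk) z)⟩) ?_
    rintro z ⟨hzS, hzO'⟩
    obtain ⟨k₀, hk₀⟩ : ∃ k₀ : ℝ, w z - k₀ * ψ z < w z₀ := by
      rcases (hψ0 z).eq_or_lt with h0 | hpos
      · exact ⟨0, by simpa using hmax z hzS h0.symm (ne_of_mem_of_not_mem hzO hzO').symm⟩
      · obtain ⟨k, hk⟩ := exists_gt ((w z - w z₀) / ψ z)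
        exact ⟨k, by linarith [(div_lt_iff₀ hpos).1 hk]⟩
    refine ⟨_, nhdsWithin_mono z sdiff_subset (husc k₀ z hzS _ hk₀), k₀, fun k hk y hy => ?_⟩
    exact (sub_le_sub_left (mul_le_mul_of_nonneg_right hk (hψ0 y)) _).trans_lt hy
  obtain ⟨k₀, hk₀⟩ := hfar
  obtain ⟨z, hzS, hzmax⟩ := (husc (max k₀ 1)).exists_isMaxOn ⟨z₀, hz₀⟩ hS
  have hzz₀ : w z₀ ≤ w z - max k₀ 1 * ψ z := by simpa [hψz₀] using hzmax hz₀
  have hznear : z ∈ O := by_contra fun hz =>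
    hzz₀.not_gt (hk₀ _ (le_max_left _ _) z ⟨hzS, hz⟩)
  obtain ⟨hwz, hzU⟩ := hOS ⟨hznear, hzS⟩
  exact ⟨max k₀ 1, by positivity, z, ⟨hzS, hzU⟩, by linarith [mem_ofPred.1 hwz], hzmax⟩

variable {V : Type*} [NormedAddCommGroup V]

theorem exists_doubling_max {K : Set V} (hK : IsCompact K) {u v : V → ℝ}
    (hu : UpperSemicontinuousOn u K) (hv : UpperSemicontinuousOn v K) {y₀ : V} (hy₀ : y₀ ∈ K)
    (hmax : ∀ x ∈ K, x ≠ y₀ → u x + v x < u y₀ + v y₀) {ε : ℝ} (hε : 0 < ε) :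
    ∃ α > 0, ∃ x ∈ K, ∃ y ∈ K, ‖x - y₀‖ < ε ∧ ‖y - y₀‖ < ε ∧ α * ‖x - y‖ ^ 2 < ε ∧
      ∀ x' ∈ K, ∀ y' ∈ K,
        u x' + v y' - α / 2 * ‖x' - y'‖ ^ 2 ≤ u x + v y - α / 2 * ‖x - y‖ ^ 2 := by
  have hw : UpperSemicontinuousOn (fun z : V × V => u z.1 + v z.2) (K ×ˢ K) :=
    (hu.comp continuous_fst.continuousOn fun _ hz => hz.1).add
      (hv.comp continuous_snd.continuousOn fun _ hz => hz.2)
  have hdiag : ∀ z ∈ K ×ˢ K, ‖z.1 - z.2‖ ^ 2 = 0 → z ≠ (y₀, y₀) →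
      u z.1 + v z.2 < u y₀ + v y₀ := by
    rintro ⟨x, y⟩ ⟨hx, _⟩ hxy hne
    obtain rfl : x = y := by simpa [sub_eq_zero] using hxy
    exact hmax x hx fun h => hne (by rw [h])
  obtain ⟨α, hα, ⟨x, y⟩, ⟨⟨hx, hy⟩, hxy⟩, hsmall, hm⟩ :=
    exists_isMaxOn_sub_const_mul_near (hK.prod hK) hw (ψ := fun z => ‖z.1 - z.2‖ ^ 2) (by fun_prop)
      (fun _ => by positivity) (mk_mem_prod hy₀ hy₀) (by simp) hdiag
      (Metric.ball_mem_nhds _ hε) (half_pos hε)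
  rw [Metric.mem_ball, Prod.dist_eq, max_lt_iff, dist_eq_norm, dist_eq_norm] at hxy
  refine ⟨2 * α, by positivity, x, hx, y, hy, hxy.1, hxy.2, ?_, fun x' hx' y' hy' => ?_⟩
  · linarith
  · simpa [mul_div_cancel_left₀] using hm (mk_mem_prod hx' hy')

theorem doubling_penalties_le {α d e τ ε : ℝ} (hα : 0 ≤ α) (hd : 0 ≤ d) (hτ : 0 ≤ τ)
    (hτα : τ * (1 + α) ≤ e) (hde : d ≤ 2 * e) (hαd : α * d ^ 2 ≤ e) (he : 24 * e ≤ min ε 1) :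
    (d + 2 * τ) * (α * d + τ) ≤ ε ∧ 3 * α * (d + 2 * τ) ^ 2 ≤ ε := by
  obtain ⟨heε, he1⟩ := le_min_iff.1 he
  have hατ : 0 ≤ α * τ := by positivity
  have hτd : τ * d ≤ τ := mul_le_of_le_one_right hτ (by linarith)
  have hταd : α * τ * d ≤ α * τ := mul_le_of_le_one_right hατ (by linarith)
  have hττ : τ * τ ≤ τ := mul_le_of_le_one_right hτ (by linarith)
  have hατe : 24 * (α * τ * τ) ≤ τ := by
    have : α * τ * τ ≤ e * τ := by gcongr; linarith
    have : 24 * e * τ ≤ τ := mul_le_of_le_one_left hτ he1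
    linarith
  refine ⟨by linarith, ?_⟩
  have := mul_le_mul_of_nonneg_left (sq_nonneg (d - 2 * τ)) hα
  linarith

variable [InnerProductSpace ℝ V]

theorem exists_doubled_jets [FiniteDimensional ℝ V] {K : Set V} (hK : IsCompact K) {u v : V → ℝ}
    (hu : UpperSemicontinuousOn u K) (hv : UpperSemicontinuousOn v K) {y₀ : V}
    (hy₀ : y₀ ∈ interior K) (hmax : ∀ x ∈ K, x ≠ y₀ → u x + v x < u y₀ + v y₀) {ε : ℝ}
    (hε : 0 < ε) :
    ∃ (x y : V) (p q : V →L[ℝ] ℝ) (A B : V →L[ℝ] V →L[ℝ] ℝ) (σ : ℝ), x ∈ interior K ∧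
      y ∈ interior K ∧ ‖x - y₀‖ ≤ ε ∧ ‖y - y₀‖ ≤ ε ∧ u y₀ + v y₀ - ε ≤ u x + v y ∧
      ‖p + q‖ ≤ ε ∧ ‖x - y‖ * ‖p‖ ≤ ε ∧ IsUpperJet u x p A ∧ IsUpperJet v y q B ∧ 0 ≤ σ ∧
      σ * ‖x - y‖ ^ 2 ≤ ε ∧
      ∀ a b, A a a + B b b ≤ σ * ‖a - b‖ ^ 2 + ε * (‖a‖ ^ 2 + ‖b‖ ^ 2) := by
  obtain ⟨r, hr, hrK⟩ := Metric.isOpen_iff.1 isOpen_interior y₀ hy₀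
  obtain ⟨e, he0, he, her⟩ : ∃ e, 0 < e ∧ 24 * e ≤ min ε 1 ∧ e ≤ r :=
    ⟨min (min ε 1 / 24) r, by positivity, by linarith [min_le_left (min ε 1 / 24) r],
      min_le_right _ _⟩
  have heε := he.trans (min_le_left _ _)
  obtain ⟨α, hα, x, -, y, -, hx, hy, hαd, hm⟩ :=
    exists_doubling_max hK hu hv (interior_subset hy₀) hmax he0
  obtain ⟨τ, hτ0, hτα⟩ : ∃ τ, 0 < τ ∧ τ * (1 + α) = e :=
    ⟨e / (1 + α), by positivity, div_mul_cancel₀ _ (by positivity)⟩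
  have hτe : τ ≤ e := by linarith [mul_pos hτ0 hα]
  obtain ⟨x₁, y₁, p, q, A, B, hx₁, hy₁, hxx, hyy, huv, hp, hq, hju, hjv, hAB⟩ :=
    theorem_on_sums hK hK hu hv (hrK (mem_ball_iff_norm.2 (hx.trans_le her)))
      (hrK (mem_ball_iff_norm.2 (hy.trans_le her))) hα hτ0 hm
  have hxy : ‖x - y‖ ≤ 2 * e :=
    (norm_sub_le_norm_sub_add_norm_sub x y₀ y).trans (by linarith [norm_sub_rev y₀ y])
  have hx₁y₁ : ‖x₁ - y₁‖ ≤ ‖x - y‖ + 2 * τ := by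
    rw [show x₁ - y₁ = (x₁ - x) + (x - y) - (y₁ - y) by abel]
    exact (norm_sub_le _ _).trans (by linarith [norm_add_le (x₁ - x) (x - y)])
  have hp₁ : ‖p‖ ≤ α * ‖x - y‖ + τ := by
    have hP : ‖innerBil V (α • (x - y))‖ = α * ‖x - y‖ := by
      rw [innerBil, innerSL_apply_norm, norm_smul, Real.norm_of_nonneg hα.le]
    linarith [norm_le_norm_sub_add p (innerBil V (α • (x - y)))]
  obtain ⟨hpd, hσd⟩ := doubling_penalties_le hα.le (norm_nonneg (x - y)) hτ0.le hτα.le hxy hαd.le he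
  refine ⟨x₁, y₁, p, q, A, B, 3 * α, hx₁, hy₁,
    (norm_sub_le_norm_sub_add_norm_sub x₁ x y₀).trans (by linarith),
    (norm_sub_le_norm_sub_add_norm_sub y₁ y y₀).trans (by linarith), ?_, ?_,
    (mul_le_mul hx₁y₁ hp₁ (norm_nonneg _) (by positivity)).trans hpd, hju, hjv, by positivity,
    le_trans (by gcongr) hσd, fun a b => (hAB a b).trans ?_⟩
  · have hm₀ := hm y₀ (interior_subset hy₀) y₀ (interior_subset hy₀)
    rw [sub_self, norm_zero] at hm₀
    have : 0 ≤ α / 2 * ‖x - y‖ ^ 2 := by positivity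
    linarith
  · rw [show p + q = (p - innerBil V (α • (x - y))) + (q + innerBil V (α • (x - y))) by abel]
    exact (norm_add_le _ _).trans (by linarith)
  · gcongr
    linarith

end Doubling

section SymForm

variable {n : ℕ}

namespace SymForm

theorem ext {A B : SymForm n} (h : ∀ v w, A.bil v w = B.bil v w) : A = B :=
  Subtype.ext (p := (· ∈ symForms n))
    (ContinuousLinearMap.ext fun v => ContinuousLinearMap.ext fun w => h v w)

@[simp] theorem bil_add (A B : SymForm n) : (A + B).bil = A.bil + B.bil := rfl
@[simp] theorem bil_sub (A B : SymForm n) : (A - B).bil = A.bil - B.bil := rfl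
@[simp] theorem bil_neg (A : SymForm n) : (-A).bil = -A.bil := rfl
@[simp] theorem bil_smul (t : ℝ) (A : SymForm n) : (t • A).bil = t • A.bil := rfl

theorem norm_bil (A : SymForm n) : ‖A.bil‖ = ‖A‖ := rfl

@[simp] theorem pull_apply (k : Rn n →L[ℝ] Rn n) (A : SymForm n) (v w : Rn n) :
    (A.pull k).bil v w = A.bil (k v) (k w) := rfl

theorem ofBilin_self (B : Bil n) (v : Rn n) : (ofBilin B).bil v v = B v v := by
  change (2⁻¹ : ℝ) * (B v v + B v v) = B v v
  ring

theorem pull_add (k : Rn n →L[ℝ] Rn n) (A B : SymForm n) :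
    (A + B).pull k = A.pull k + B.pull k := ext fun v w => by simp

theorem pull_neg (k : Rn n →L[ℝ] Rn n) (A : SymForm n) : (-A).pull k = -A.pull k :=
  ext fun v w => by simp

theorem pull_pull_symm (k : Rn n ≃L[ℝ] Rn n) (A : SymForm n) :
    (A.pull (k.symm : Rn n →L[ℝ] Rn n)).pull (k : Rn n →L[ℝ] Rn n) = A :=
  ext fun v w => by simp

theorem norm_pull_le (k : Rn n →L[ℝ] Rn n) (A : SymForm n) : ‖A.pull k‖ ≤ ‖A‖ * ‖k‖ * ‖k‖ := by
  rw [← norm_bil, ← norm_bil]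
  refine ContinuousLinearMap.opNorm_le_bound₂ _ (by positivity) fun v w => ?_
  calc ‖(A.pull k).bil v w‖ ≤ ‖A.bil‖ * ‖k v‖ * ‖k w‖ := A.bil.le_opNorm₂ _ _
    _ ≤ ‖A.bil‖ * (‖k‖ * ‖v‖) * (‖k‖ * ‖w‖) := by gcongr <;> exact k.le_opNorm _
    _ = _ := by ring

/-- The Euclidean inner product as a symmetric form. -/
def one (n : ℕ) : SymForm n := SymForm.mk (innerBil (Rn n)) fun v w => by
  rw [innerBil_apply, innerBil_apply, real_inner_comm]

theorem one_apply (v w : Rn n) : (one n).bil v w = ⟪v, w⟫ := rfl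

theorem norm_one_le : ‖one n‖ ≤ 1 := by
  rw [← norm_bil]
  refine ContinuousLinearMap.opNorm_le_bound₂ _ zero_le_one fun v w => ?_
  rw [one_apply, one_mul]
  exact norm_inner_le_norm v w

end SymForm

theorem IsUpperJet.ofBilin {u : Rn n → ℝ} {y : Rn n} {p : Rn n →L[ℝ] ℝ} {A : Bil n}
    (h : IsUpperJet u y p A) : IsUpperJet u y p (SymForm.ofBilin A).bil := fun ε hε => by
  simpa only [SymForm.ofBilin_self] using h ε hε

end SymForm

section LocalComparison

theorem exists_lipschitz_bound {V E : Type*} [NormedAddCommGroup V] [NormedSpace ℝ V]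
    [NormedAddCommGroup E] [NormedSpace ℝ E] {f : V → E} {y₀ : V} (hf : ContDiffAt ℝ 1 f y₀) :
    ∃ Λ, 1 ≤ Λ ∧ ∃ r > 0, ∀ y ∈ Metric.ball y₀ r, ‖f y‖ ≤ Λ ∧
      ∀ y' ∈ Metric.ball y₀ r, ‖f y - f y'‖ ≤ Λ * ‖y - y'‖ := by
  obtain ⟨K, t, ht, hK⟩ := hf.exists_lipschitzOnWith
  have hbdd : ∀ᶠ y in 𝓝 y₀, ‖f y‖ < ‖f y₀‖ + 1 :=
    hf.continuousAt.norm.eventually (gt_mem_nhds (lt_add_one _))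
  obtain ⟨r, hr, hball⟩ := Metric.eventually_nhds_iff_ball.1 (hbdd.and ht)
  have : (0 : ℝ) ≤ K := K.2
  have hf0 := norm_nonneg (f y₀)
  refine ⟨‖f y₀‖ + 1 + K, by linarith, r, hr, fun y hy => ⟨by linarith [(hball y hy).1],
    fun y' hy' => (hK.norm_sub_le (hball y hy).2 (hball y' hy').2).trans ?_⟩⟩
  gcongr
  linarith

theorem contDiffAt_symm {V E : Type*} [NormedAddCommGroup V] [NormedSpace ℝ V]
    [NormedAddCommGroup E] [NormedSpace ℝ E] [CompleteSpace E] {f : V → (E ≃L[ℝ] E)} {y₀ : V}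
    {m : WithTop ℕ∞} (hf : ContDiffAt ℝ m (fun y => (f y : E →L[ℝ] E)) y₀) :
    ContDiffAt ℝ m (fun y => ((f y).symm : E →L[ℝ] E)) y₀ :=
  ((contDiffAt_map_inverse (f y₀)).comp y₀ hf).congr_of_eventuallyEq
    (Eventually.of_forall fun y => by simp)

theorem norm_apply_sub_apply_le {V E : Type*} [NormedAddCommGroup V] [NormedSpace ℝ V]
    [NormedAddCommGroup E] [NormedSpace ℝ E] {S T : V →L[ℝ] E} {p q : V} {Λ δ ε : ℝ}
    (hΛ : 0 ≤ Λ) (hT : ‖T‖ ≤ Λ) (hST : ‖S - T‖ ≤ Λ * δ) (hpq : ‖q - p‖ ≤ ε)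
    (hp : δ * ‖p‖ ≤ ε) : ‖T q - S p‖ ≤ 2 * (Λ * ε) := by
  have hdiff : ‖(S - T) p‖ ≤ Λ * ε := ((S - T).le_of_opNorm_le hST p).trans <| by
    rw [mul_assoc]
    gcongr
  have hTpq : ‖T (q - p)‖ ≤ Λ * ε := T.le_of_opNorm_le_of_le hT hpq
  rw [show T q - S p = T (q - p) - (S - T) p by rw [map_sub, _root_.sub_apply]; abel, two_mul]
  exact (norm_sub_le _ _).trans (add_le_add hTpq hdiff)

theorem norm_zero_mk_le {E F : Type*} [NormedAddCommGroup E] [NormedAddCommGroup F] {u : E}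
    {v : F} {C : ℝ} (hu : ‖u‖ ≤ C) (hv : ‖v‖ ≤ C) : ‖((0 : ℝ), u, v)‖ ≤ C :=
  norm_prod_le_iff.2 ⟨norm_zero.trans_le ((norm_nonneg u).trans hu),
    norm_prod_le_iff.2 ⟨hu, hv⟩⟩

theorem add_mem_interior_of_forall {E : Type*} [NormedAddCommGroup E] {S : Set E} {m j : E}
    (h : ∀ x ∈ S, x + m ∈ S) (hj : j ∈ interior S) : j + m ∈ interior S := by
  have himage : (· + m) '' interior S ⊆ S :=
    image_subset_iff.2 fun x hx => h x (interior_subset hx)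
  exact interior_maximal himage ((Homeomorph.addRight m).isOpenMap _ isOpen_interior)
    (mem_image_of_mem _ hj)

variable {n : ℕ}

theorem SymForm.nonneg_of_doubled {A B : SymForm n} {k l : Rn n →L[ℝ] Rn n} {Λ δ σ ε : ℝ}
    (hk : ‖k‖ ≤ Λ) (hl : ‖l‖ ≤ Λ) (hkl : ‖k - l‖ ≤ Λ * δ) (hσ : 0 ≤ σ) (hσδ : σ * δ ^ 2 ≤ ε)
    (hε : 0 ≤ ε)
    (hAB : ∀ a b, A.bil a a + B.bil b b ≤ σ * ‖a - b‖ ^ 2 + ε * (‖a‖ ^ 2 + ‖b‖ ^ 2)) :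
    (-(B.pull l) - A.pull k + (3 * Λ ^ 2 * ε) • SymForm.one n).Nonneg := fun w => by
  have hkw : ‖k w‖ ≤ Λ * ‖w‖ := k.le_of_opNorm_le hk w
  have hlw : ‖l w‖ ≤ Λ * ‖w‖ := l.le_of_opNorm_le hl w
  have hdiff : σ * ‖k w - l w‖ ^ 2 ≤ Λ ^ 2 * ‖w‖ ^ 2 * ε :=
    calc σ * ‖k w - l w‖ ^ 2 ≤ σ * (Λ * δ * ‖w‖) ^ 2 := by
          gcongr
          exact (k - l).le_of_opNorm_le hkl w
      _ = Λ ^ 2 * ‖w‖ ^ 2 * (σ * δ ^ 2) := by ring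
      _ ≤ _ := by gcongr
  have hsum : ε * (‖k w‖ ^ 2 + ‖l w‖ ^ 2) ≤ ε * ((Λ * ‖w‖) ^ 2 + (Λ * ‖w‖) ^ 2) := by gcongr
  have happly : (-(B.pull l) - A.pull k + (3 * Λ ^ 2 * ε) • SymForm.one n).bil w w =
      -B.bil (l w) (l w) - A.bil (k w) (k w) + 3 * Λ ^ 2 * ε * ‖w‖ ^ 2 := by
    rw [← real_inner_self_eq_norm_sq]
    rfl
  rw [happly]
  linarith [hAB (k w) (l w)]

namespace AffineJetAut

variable {V W : Set (Rn n)}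

/-- The linear parts of `Ψ` and their inverses are bounded by `Λ` on `W`, and `Ψ` is
`Λ`-Lipschitz there. -/
structure IsLipschitzOn (Ψ : AffineJetAut n V) (Λ : ℝ) (W : Set (Rn n)) : Prop where
  one_le : 1 ≤ Λ
  bound : ∀ y ∈ W, ‖(Ψ.g y : (Rn n →L[ℝ] ℝ) →L[ℝ] (Rn n →L[ℝ] ℝ))‖ ≤ Λ ∧
    ‖(Ψ.k y : Rn n →L[ℝ] Rn n)‖ ≤ Λ ∧ ‖Ψ.L y‖ ≤ Λ
  bound_symm : ∀ y ∈ W, ‖((Ψ.g y).symm : (Rn n →L[ℝ] ℝ) →L[ℝ] (Rn n →L[ℝ] ℝ))‖ ≤ Λ ∧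
    ‖((Ψ.k y).symm : Rn n →L[ℝ] Rn n)‖ ≤ Λ
  lipschitz : ∀ x ∈ W, ∀ y ∈ W,
    ‖(Ψ.g x - Ψ.g y : (Rn n →L[ℝ] ℝ) →L[ℝ] (Rn n →L[ℝ] ℝ))‖ ≤ Λ * ‖x - y‖ ∧
    ‖(Ψ.k x - Ψ.k y : Rn n →L[ℝ] Rn n)‖ ≤ Λ * ‖x - y‖ ∧
    ‖Ψ.L x - Ψ.L y‖ ≤ Λ * ‖x - y‖ ∧ ‖Ψ.S x - Ψ.S y‖ ≤ Λ * ‖x - y‖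

theorem exists_isLipschitzOn_ball (Ψ : AffineJetAut n V) {y₀ : Rn n} (hV : V ∈ 𝓝 y₀) :
    ∃ Λ, ∃ r > 0, Ψ.IsLipschitzOn Λ (Metric.ball y₀ r) := by
  have cg := (Ψ.smooth_g.contDiffAt hV).of_le (m := 1) (by norm_cast)
  have ck := (Ψ.smooth_k.contDiffAt hV).of_le (m := 1) (by norm_cast)
  have cL := (Ψ.smooth_L.contDiffAt hV).of_le (m := 1) (by norm_cast)
  have cS := (Ψ.smooth_S.contDiffAt hV).of_le (m := 1) (by norm_cast)
  obtain ⟨Λ, hΛ, r, hr, hball⟩ := exists_lipschitz_bound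
    ((cg.prodMk (contDiffAt_symm cg)).prodMk ((ck.prodMk (contDiffAt_symm ck)).prodMk
      (cL.prodMk cS)))
  simp only [Prod.mk_sub_mk, Prod.norm_mk, sup_le_iff] at hball
  refine ⟨Λ, r, hr, hΛ, fun y hy => ?_, fun y hy => ?_, fun x hx y hy => ?_⟩
  · obtain ⟨⟨⟨hg, -⟩, ⟨hk, -⟩, hL, -⟩, -⟩ := hball y hy
    exact ⟨hg, hk, hL⟩
  · obtain ⟨⟨⟨-, hg⟩, ⟨-, hk⟩, -⟩, -⟩ := hball y hy
    exact ⟨hg, hk⟩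
  · obtain ⟨⟨hg, -⟩, ⟨hk, -⟩, hL, hS⟩ := (hball x hx).2 y hy
    exact ⟨hg, hk, hL, hS⟩

variable {Ψ : AffineJetAut n V} {Λ : ℝ} {x y : Rn n}

theorem IsLipschitzOn.exists_act_add_eq (h : Ψ.IsLipschitzOn Λ W) (hy : y ∈ W) (j d : Jet n) :
    ∃ d' : Jet n, ‖d'‖ ≤ 2 * Λ ^ 4 * ‖d‖ ∧ Ψ.act y (j + d') = Ψ.act y j + d := by
  obtain ⟨hg, hk⟩ := h.bound_symm y hy
  have hΛ := h.one_le
  set p := (Ψ.g y).symm d.2.1 with hp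
  set A := SymForm.pull ((Ψ.k y).symm : Rn n →L[ℝ] Rn n) (d.2.2 - Ψ.L y p) with hA
  have hd₁ : ‖d.1‖ ≤ ‖d‖ := norm_fst_le d
  have hd₂ : ‖d.2.1‖ ≤ ‖d‖ := (norm_fst_le d.2).trans (norm_snd_le d)
  have hd₃ : ‖d.2.2‖ ≤ ‖d‖ := (norm_snd_le d.2).trans (norm_snd_le d)
  have hpd : ‖p‖ ≤ Λ * ‖d‖ := ContinuousLinearMap.le_of_opNorm_le_of_le _ hg hd₂
  have hLp : ‖Ψ.L y p‖ ≤ Λ * (Λ * ‖d‖) := (Ψ.L y).le_of_opNorm_le_of_le (h.bound y hy).2.2 hpd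
  have hpow : ∀ k ≤ 4, Λ ^ k * ‖d‖ ≤ Λ ^ 4 * ‖d‖ := fun k hk => by gcongr
  have hAd : ‖A‖ ≤ 2 * Λ ^ 4 * ‖d‖ := calc
    ‖A‖ ≤ (‖d‖ + Λ * (Λ * ‖d‖)) * Λ * Λ := by
      refine (SymForm.norm_pull_le _ _).trans ?_
      gcongr
      exact (norm_sub_le _ _).trans (add_le_add hd₃ hLp)
    _ = Λ ^ 2 * ‖d‖ + Λ ^ 4 * ‖d‖ := by ring
    _ ≤ _ := by linarith [hpow 2 (by norm_num)]
  refine ⟨(d.1, p, A), norm_prod_le_iff.2 ⟨?_, norm_prod_le_iff.2 ⟨?_, hAd⟩⟩, ?_⟩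
  · linarith [hpow 0 (by norm_num), norm_nonneg d]
  · linarith [hpow 1 (by norm_num), hpow 0 (by norm_num), norm_nonneg d]
  · unfold act
    refine Prod.ext ?_ (Prod.ext ?_ ?_)
    · simp only [Prod.fst_add]
      ring
    · simp only [Prod.snd_add, Prod.fst_add, map_add, hp, ContinuousLinearEquiv.apply_symm_apply]
      abel
    · simp only [Prod.snd_add, Prod.fst_add, map_add, SymForm.pull_add, hA,
        SymForm.pull_pull_symm]
      abel

theorem IsLipschitzOn.ball_act_subset (h : Ψ.IsLipschitzOn Λ W) (hx : x ∈ W) {F₀ : Set (Jet n)}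
    {j : Jet n} {c r : ℝ} (hj : ∀ d : Jet n, ‖d‖ ≤ c → Ψ.act x (j + d) ∈ F₀)
    (hrc : 2 * Λ ^ 4 * r ≤ c) : Metric.ball (Ψ.act x j) r ⊆ F₀ := fun w hw => by
  have hΛ := h.one_le
  obtain ⟨d, hd, hact⟩ := h.exists_act_add_eq hx j (w - Ψ.act x j)
  have hdc : ‖d‖ ≤ c := (hd.trans (by gcongr; exact (mem_ball_iff_norm.1 hw).le)).trans hrc
  simpa only [hact, add_sub_cancel] using hj d hdc

theorem act_neg_eq (Ψ : AffineJetAut n V) (x y : Rn n) (r s t : ℝ) (p q : Rn n →L[ℝ] ℝ)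
    (A B : SymForm n) :
    Ψ.act y (-(s, q, B)) = Ψ.act x (r, p, A) +
      (Ψ.S y - Ψ.S x + (0, Ψ.g y (-q) - Ψ.g x p, Ψ.L y (-q) - Ψ.L x p - t • SymForm.one n)) +
      (0, 0, -(B.pull (Ψ.k y : Rn n →L[ℝ] Rn n)) - A.pull (Ψ.k x : Rn n →L[ℝ] Rn n) +
        t • SymForm.one n) + (-(r + s), 0, 0) := by
  unfold act
  generalize Ψ.S x = Sx, Ψ.S y = Sy, SymForm.one n = I
  refine Prod.ext ?_ (Prod.ext ?_ ?_)
  · simp only [Prod.fst_add, Prod.fst_neg, Prod.fst_sub]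
    ring
  · simp only [Prod.fst_add, Prod.snd_add, Prod.fst_neg, Prod.snd_neg, Prod.fst_sub,
      Prod.snd_sub]
    abel
  · simp only [Prod.snd_add, Prod.fst_neg, Prod.snd_neg, Prod.snd_sub, SymForm.pull_neg]
    abel

theorem IsLipschitzOn.norm_error_le (h : Ψ.IsLipschitzOn Λ W) (hx : x ∈ W) (hy : y ∈ W)
    {p q : Rn n →L[ℝ] ℝ} {ε : ℝ} (hxy : ‖x - y‖ ≤ 2 * ε) (hpq : ‖p + q‖ ≤ ε)
    (hxyp : ‖x - y‖ * ‖p‖ ≤ ε) :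
    ‖Ψ.S y - Ψ.S x + (0, Ψ.g y (-q) - Ψ.g x p,
      Ψ.L y (-q) - Ψ.L x p - (3 * Λ ^ 2 * ε) • SymForm.one n)‖ ≤ 7 * Λ ^ 2 * ε := by
  have hΛ := h.one_le
  have hε : 0 ≤ ε := (norm_nonneg _).trans hpq
  obtain ⟨hgy, -, hLy⟩ := h.bound y hy
  obtain ⟨hgxy, -, hLxy, hSxy⟩ := h.lipschitz x hx y hy
  have hqp : ‖-q - p‖ ≤ ε := by rwa [← norm_neg, neg_sub, sub_neg_eq_add]
  have hg : ‖Ψ.g y (-q) - Ψ.g x p‖ ≤ 2 * (Λ * ε) :=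
    norm_apply_sub_apply_le (T := (Ψ.g y : (Rn n →L[ℝ] ℝ) →L[ℝ] (Rn n →L[ℝ] ℝ)))
      (S := (Ψ.g x : (Rn n →L[ℝ] ℝ) →L[ℝ] (Rn n →L[ℝ] ℝ))) (by positivity) hgy hgxy hqp hxyp
  have hL : ‖Ψ.L y (-q) - Ψ.L x p‖ ≤ 2 * (Λ * ε) :=
    norm_apply_sub_apply_le (by positivity) hLy hLxy hqp hxyp
  have hS : ‖Ψ.S y - Ψ.S x‖ ≤ Λ * (2 * ε) := by
    rw [norm_sub_rev]
    exact hSxy.trans (by gcongr)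
  have hone : ‖(3 * Λ ^ 2 * ε) • SymForm.one n‖ ≤ 3 * Λ ^ 2 * ε := by
    rw [norm_smul, Real.norm_of_nonneg (by positivity)]
    exact mul_le_of_le_one_right (by positivity) SymForm.norm_one_le
  have hΛε : Λ * ε ≤ Λ ^ 2 * ε := by
    gcongr
    exact le_self_pow₀ hΛ two_ne_zero
  have : 0 ≤ Λ * ε := by positivity
  have hred := norm_zero_mk_le (hg.trans (by linarith only [this, hΛε]))
    ((norm_sub_le_of_le hL hone).trans_eq (by ring : _ = 2 * (Λ * ε) + 3 * (Λ ^ 2 * ε)))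
  exact (norm_add_le_of_le hS hred).trans (by linarith only [hΛε])

theorem IsLipschitzOn.exists_act_neg_eq (h : Ψ.IsLipschitzOn Λ W) (hx : x ∈ W) (hy : y ∈ W)
    {p q : Rn n →L[ℝ] ℝ} {A B : SymForm n} {r s σ ε : ℝ} (hxy : ‖x - y‖ ≤ 2 * ε)
    (hpq : ‖p + q‖ ≤ ε) (hxyp : ‖x - y‖ * ‖p‖ ≤ ε) (hσ : 0 ≤ σ) (hσxy : σ * ‖x - y‖ ^ 2 ≤ ε)
    (hAB : ∀ a b, A.bil a a + B.bil b b ≤ σ * ‖a - b‖ ^ 2 + ε * (‖a‖ ^ 2 + ‖b‖ ^ 2)) :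
    ∃ d : Jet n, ‖d‖ ≤ 7 * Λ ^ 2 * ε ∧ ∃ Q : SymForm n, Q.Nonneg ∧
      Ψ.act y (-(s, q, B)) = Ψ.act x (r, p, A) + d + (0, 0, Q) + (-(r + s), 0, 0) :=
  ⟨_, h.norm_error_le hx hy hxy hpq hxyp, _,
    SymForm.nonneg_of_doubled (h.bound x hx).2.1 (h.bound y hy).2.1 (h.lipschitz x hx y hy).2.1
      hσ hσxy ((norm_nonneg _).trans hpq) hAB, Ψ.act_neg_eq x y r s _ p q A B⟩

end AffineJetAut

theorem local_comparison {F₀ : Set (Jet n)} (hF₀ : PosNeg F₀) {V : Set (Rn n)}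
    (Ψ : AffineJetAut n V) {K : Set (Rn n)} (hK : IsCompact K) {y₀ : Rn n} (hV : V ∈ 𝓝 y₀)
    (hy₀ : y₀ ∈ interior K) {u v : Rn n → ℝ}
    (hu : UpperSemicontinuousOn u K) (hv : UpperSemicontinuousOn v K)
    (hmax : ∀ x ∈ K, x ≠ y₀ → u x + v x < u y₀ + v y₀) (hpos : 0 < u y₀ + v y₀) {c : ℝ}
    (hc : 0 < c)
    (hju : ∀ y ∈ interior K, ∀ p (A : SymForm n), IsUpperJet u y p A.bil → ∀ d : Jet n,
      ‖d‖ ≤ c → Ψ.act y ((u y, p, A) + d) ∈ F₀)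
    (hjv : ∀ y ∈ interior K, ∀ p (A : SymForm n), IsUpperJet v y p A.bil →
      Ψ.act y (-(v y, p, A)) ∉ interior F₀) : False := by
  obtain ⟨Λ, r, hr, hΨ⟩ := Ψ.exists_isLipschitzOn_ball hV
  have hΛ := hΨ.one_le
  obtain ⟨ε, hε0, hεr, hεm, hεc⟩ : ∃ ε, 0 < ε ∧ ε < r ∧ ε ≤ u y₀ + v y₀ ∧
      2 * Λ ^ 4 * (8 * Λ ^ 2 * ε) ≤ c := by
    refine ⟨min (min (r / 2) (u y₀ + v y₀)) (c / (16 * Λ ^ 6)), by positivity,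
      ((min_le_left _ _).trans (min_le_left _ _)).trans_lt (half_lt_self hr),
      (min_le_left _ _).trans (min_le_right _ _), Eq.trans_le ?_
      ((le_div_iff₀ (by positivity : 0 < 16 * Λ ^ 6)).1
        (min_le_right (min (r / 2) (u y₀ + v y₀)) _))⟩
    ring
  obtain ⟨x, y, p, q, A, B, σ, hxK, hyK, hx, hy, huv, hpq, hxyp, hjx, hjy, hσ, hσxy, hAB⟩ :=
    exists_doubled_jets hK hu hv hy₀ hmax hε0
  have hxr : x ∈ Metric.ball y₀ r := mem_ball_iff_norm.2 (hx.trans_lt hεr)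
  have hyr : y ∈ Metric.ball y₀ r := mem_ball_iff_norm.2 (hy.trans_lt hεr)
  have hxy : ‖x - y‖ ≤ 2 * ε :=
    (norm_sub_le_norm_sub_add_norm_sub x y₀ y).trans (by linarith [norm_sub_rev y₀ y])
  obtain ⟨d, hd, Q, hQ, hact⟩ := hΨ.exists_act_neg_eq (A := .ofBilin A) (B := .ofBilin B)
    (r := u x) (s := v y) hxr hyr hxy hpq hxyp hσ hσxy
    (by simpa only [SymForm.ofBilin_self] using hAB)
  have hball := hΨ.ball_act_subset hxr (hju x hxK p _ hjx.ofBilin) hεc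
  have hmem : Ψ.act x (u x, p, .ofBilin A) + d ∈ interior F₀ := by
    refine interior_maximal hball Metric.isOpen_ball ?_
    rw [mem_ball_iff_norm, add_sub_cancel_left]
    have : 0 < Λ ^ 2 * ε := by positivity
    linarith
  refine hjv y hyK q _ hjy.ofBilin (hact ▸ ?_)
  exact add_mem_interior_of_forall (fun j hj => hF₀.2 j hj _ (by linarith))
    (add_mem_interior_of_forall (fun j hj => hF₀.1 j hj Q hQ) hmem)

end LocalComparison

section JetCalculus

variable {n : ℕ}

theorem SymForm.ext_self {A B : SymForm n} (h : ∀ v, A.bil v v = B.bil v v) : A = B :=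
  SymForm.ext fun v w => by
    have hvw := h (v + w)
    simp only [map_add, _root_.add_apply, h v, h w, A.bil_symm w v, B.bil_symm w v] at hvw
    linarith

theorem SymForm.continuous_ofBilin : Continuous (SymForm.ofBilin (n := n)) := by
  have hflip := (ContinuousLinearMap.flipₗᵢ ℝ (Rn n) (Rn n) ℝ).continuous
  exact Continuous.subtype_mk (p := (· ∈ symForms n))
    ((continuous_id.add hflip).const_smul (2⁻¹ : ℝ)) _

instance SymForm.instFiniteDimensional : FiniteDimensional ℝ (SymForm n) := by
  have h : FiniteDimensional ℝ (Bil n) := inferInstance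
  exact @FiniteDimensional.finiteDimensional_submodule ℝ (Bil n) _ _ _ h (symForms n)

theorem Jet.poly_zero (j : Jet n) : j.poly 0 = j.1 := by simp [Jet.poly]

theorem Jet.poly_add (j k : Jet n) (v : Rn n) : (j + k).poly v = j.poly v + k.poly v := by
  simp only [Jet.poly, Prod.fst_add, Prod.snd_add, SymForm.bil_add, _root_.add_apply]
  ring

theorem Jet.poly_smul (t : ℝ) (j : Jet n) (v : Rn n) : (t • j).poly v = t * j.poly v := by
  simp only [Jet.poly, Prod.smul_fst, Prod.smul_snd, SymForm.bil_smul, _root_.smul_apply,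
    smul_eq_mul]
  ring

theorem Jet.contDiff_poly_sub (j : Jet n) (y : Rn n) {m : WithTop ℕ∞} :
    ContDiff ℝ m fun z => j.poly (z - y) := by
  unfold Jet.poly
  fun_prop

/-- The 2-jet at `y` of a function on `ℝⁿ`. -/
def jetF (h : Rn n → ℝ) (y : Rn n) : Jet n :=
  (h y, fderiv ℝ h y, SymForm.ofBilin (fderiv ℝ (fderiv ℝ h) y))

variable {h k : Rn n → ℝ} {y : Rn n}

theorem hasTaylorTwoAt_fderiv (hh : ContDiffAt ℝ 2 h y) :
    HasTaylorTwoAt h (fderiv ℝ h y) (fderiv ℝ (fderiv ℝ h) y) y := by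
  refine hasTaylorTwoAt_of_hasFDerivAt ?_
    ((hh.fderiv_right (m := 1) (by norm_num)).differentiableAt (by simp)).hasFDerivAt
  filter_upwards [hh.eventually (by simp)] with z hz
  exact (hz.differentiableAt (by simp)).hasFDerivAt

theorem jetF_eq_iff (hh : ContDiffAt ℝ 2 h y) {j : Jet n} :
    jetF h y = j ↔ (fun v => h (y + v) - j.poly v) =o[𝓝 0] fun v => ‖v‖ ^ 2 := by
  have hT := hasTaylorTwoAt_fderiv hh
  constructor
  · rintro rfl
    refine IsLittleO.congr_left hT fun v => ?_
    simp only [jetF, Jet.poly, SymForm.ofBilin_self]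
    ring
  · intro hj
    have hval : h y = j.1 := by
      have h0 := (hj.def one_pos).self_of_nhds
      simpa [Jet.poly_zero, sub_eq_zero] using h0
    have hTj : HasTaylorTwoAt h j.2.1 j.2.2.bil y :=
      hj.congr_left fun v => by simp only [Jet.poly, hval]; ring
    refine Prod.ext hval (Prod.ext hTj.hasFDerivAt.fderiv (SymForm.ext_self fun v => ?_))
    exact (SymForm.ofBilin_self _ v).trans (hT.hessian_unique hTj v)

theorem isLittleO_sub_jetF_poly (hh : ContDiffAt ℝ 2 h y) :
    (fun v => h (y + v) - (jetF h y).poly v) =o[𝓝 0] fun v => ‖v‖ ^ 2 :=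
  (jetF_eq_iff hh).1 rfl

theorem jetF_congr (hk : h =ᶠ[𝓝 y] k) : jetF h y = jetF k y := by
  unfold jetF
  rw [hk.eq_of_nhds, hk.fderiv_eq, hk.fderiv.fderiv_eq]

theorem jetF_poly_sub (j : Jet n) (y : Rn n) : jetF (fun z => j.poly (z - y)) y = j :=
  (jetF_eq_iff (j.contDiff_poly_sub y).contDiffAt).2 <|
    (isLittleO_zero _ _).congr_left fun v => by simp

theorem jetF_const (c : ℝ) (y : Rn n) : jetF (fun _ => c) y = (c, 0, 0) :=
  (jetF_eq_iff contDiffAt_const).2 <| (isLittleO_zero _ _).congr_left fun v => by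
    have hbil : (0 : SymForm n).bil = 0 := rfl
    simp [Jet.poly, hbil]

theorem jetF_add (hh : ContDiffAt ℝ 2 h y) (hk : ContDiffAt ℝ 2 k y) :
    jetF (fun z => h z + k z) y = jetF h y + jetF k y :=
  (jetF_eq_iff (hh.add hk)).2 <|
    ((isLittleO_sub_jetF_poly hh).add (isLittleO_sub_jetF_poly hk)).congr_left fun v => by
      rw [Jet.poly_add]
      ring

theorem jetF_const_mul (hh : ContDiffAt ℝ 2 h y) (t : ℝ) :
    jetF (fun z => t * h z) y = t • jetF h y :=
  (jetF_eq_iff (contDiffAt_const.mul hh)).2 <|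
    ((isLittleO_sub_jetF_poly hh).const_mul_left t).congr_left fun v => by
      rw [Jet.poly_smul]
      ring

theorem jetF_comp_congr {τ : Rn n → Rn n} (hτ : ContDiffAt ℝ 2 τ y)
    (hh : ContDiffAt ℝ 2 h (τ y)) (hk : ContDiffAt ℝ 2 k (τ y))
    (hhk : jetF h (τ y) = jetF k (τ y)) : jetF (h ∘ τ) y = jetF (k ∘ τ) y := by
  rw [jetF_eq_iff (hh.comp y hτ)]
  have hshift : Tendsto (fun v => y + v) (𝓝 0) (𝓝 y) := by
    simpa using (continuous_const_add y).tendsto 0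
  have hdiff : (fun w => h (τ y + w) - k (τ y + w)) =o[𝓝 0] fun w => ‖w‖ ^ 2 := by
    refine ((isLittleO_sub_jetF_poly hh).sub (isLittleO_sub_jetF_poly hk)).congr_left fun w => ?_
    rw [hhk]
    ring
  have hτO : (fun v => τ (y + v) - τ y) =O[𝓝 0] fun v => v := by
    simpa [Function.comp_def] using
      (hτ.differentiableAt (by simp)).isBigO_sub.comp_tendsto hshift
  have hτ0 : Tendsto (fun v => τ (y + v) - τ y) (𝓝 0) (𝓝 0) := by
    simpa using (hτ.continuousAt.tendsto.comp hshift).sub_const (τ y)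
  refine (((hdiff.comp_tendsto hτ0).trans_isBigO (hτO.norm_norm.pow 2)).add
    (isLittleO_sub_jetF_poly (hk.comp y hτ))).congr_left fun v => ?_
  simp [Function.comp_apply]

theorem continuousAt_jetF (hh : ContDiffAt ℝ 2 h y) : ContinuousAt (jetF h) y := by
  have h1 : ContDiffAt ℝ 1 (fderiv ℝ h) y := hh.fderiv_right (by norm_num)
  have h2 : ContDiffAt ℝ 0 (fderiv ℝ (fderiv ℝ h)) y := h1.fderiv_right (by norm_num)
  exact hh.continuousAt.prodMk (h1.continuousAt.prodMk
    (SymForm.continuous_ofBilin.continuousAt.comp h2.continuousAt))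

theorem exists_jetF_eq_of_isLocalMin (hh : ContDiffAt ℝ 2 h y) (h0 : h y = 0)
    (hmin : IsLocalMin h y) : ∃ A : SymForm n, A.Nonneg ∧ jetF h y = (0, 0, A) := by
  refine ⟨_, fun v => ?_, Prod.ext h0 (Prod.ext hmin.fderiv_eq_zero rfl)⟩
  have hshift : Tendsto (fun v => y + v) (𝓝 0) (𝓝 y) := by
    simpa using (continuous_const_add y).tendsto 0
  have hneg := ((hasTaylorTwoAt_fderiv hh).const_mul (-1)).hessian_nonpos
    ((hshift.eventually hmin).mono fun w hw => by
      simp only [hmin.fderiv_eq_zero, smul_zero, _root_.zero_apply]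
      linarith) v
  rw [jetF, SymForm.ofBilin_self]
  simpa using hneg

theorem IsUpperJet.sub_contDiffAt {u : Rn n → ℝ} {p : Rn n →L[ℝ] ℝ} {A : SymForm n}
    (hj : IsUpperJet (fun z => u z + h z) y p A.bil) (hh : ContDiffAt ℝ 2 h y) :
    IsUpperJet u y (p - (jetF h y).2.1) (A - (jetF h y).2.2).bil := by
  intro ε hε
  filter_upwards [hj (ε / 2) (by positivity),
    (isLittleO_sub_jetF_poly hh).def (half_pos hε)] with v hv hT
  rw [norm_pow, norm_norm] at hT
  have hlow := (abs_le.1 hT).1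
  have hpoly : (jetF h y).poly v = h y + (jetF h y).2.1 v + 2⁻¹ * (jetF h y).2.2.bil v v := rfl
  rw [hpoly] at hlow
  simp only [SymForm.bil_sub, _root_.sub_apply]
  linarith

end JetCalculus

section Charts

theorem eventually_symm_apply_comp_symm {X Y : Type*} [TopologicalSpace X] [TopologicalSpace Y]
    {e e' : OpenPartialHomeomorph X Y} {x : X} (hx : x ∈ e.source) (hx' : x ∈ e'.source) :
    ∀ᶠ z in 𝓝 (e' x), e.symm (e (e'.symm z)) = e'.symm z := by
  have htend : Tendsto e'.symm (𝓝 (e' x)) (𝓝 x) := by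
    have := e'.continuousAt_symm (e'.map_source hx')
    rwa [ContinuousAt, e'.left_inv hx'] at this
  exact htend.eventually (e.eventually_left_inverse hx)

theorem jetF_poly_comp_symm {n : ℕ} {X : Type*} [TopologicalSpace X]
    {e : OpenPartialHomeomorph X (Rn n)} {y : Rn n} (hy : y ∈ e.target) (j : Jet n) :
    jetF ((fun z => j.poly (e z - y)) ∘ e.symm) y = j := by
  refine (jetF_congr ?_).trans (jetF_poly_sub j y)
  filter_upwards [e.open_target.mem_nhds hy] with w hw
  rw [Function.comp_apply, e.right_inv hw]

variable {n : ℕ} {X : Type*} [TopologicalSpace X] [ChartedSpace (Rn n) X] {x : X}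
  {e : OpenPartialHomeomorph X (Rn n)} {y : Rn n} {f g : X → ℝ}

theorem jetAt_eq_jetF (x : X) (f : X → ℝ) :
    jetAt n x f = jetF (f ∘ (chartAt (Rn n) x).symm) (chartAt (Rn n) x x) := by
  unfold jetAt jetF
  simp only [Function.comp_apply, (chartAt (Rn n) x).left_inv (mem_chart_source (Rn n) x)]

theorem jetAt_const (c : ℝ) (x : X) : jetAt n x (fun _ => c) = (c, 0, 0) := by
  rw [jetAt_eq_jetF]
  exact jetF_const c _

theorem contDiffAt_comp_symm (he : e ∈ IsManifold.maximalAtlas 𝓘(ℝ, Rn n) ∞ X)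
    (hy : y ∈ e.target) (hf : ContMDiffAt 𝓘(ℝ, Rn n) 𝓘(ℝ, ℝ) 2 f (e.symm y)) :
    ContDiffAt ℝ 2 (f ∘ e.symm) y := by
  have hsymm : ContMDiffAt 𝓘(ℝ, Rn n) 𝓘(ℝ, Rn n) 2 e.symm y :=
    ((contMDiffOn_symm_of_mem_maximalAtlas he).contMDiffAt (e.open_target.mem_nhds hy)).of_le
      (by norm_cast)
  exact contMDiffAt_iff_contDiffAt.1 (hf.comp y hsymm)

theorem contMDiffAt_of_mem_maximalAtlas_two (he : e ∈ IsManifold.maximalAtlas 𝓘(ℝ, Rn n) ∞ X)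
    (hx : x ∈ e.source) : ContMDiffAt 𝓘(ℝ, Rn n) 𝓘(ℝ, Rn n) 2 e x :=
  ((contMDiffOn_of_mem_maximalAtlas he).contMDiffAt (e.open_source.mem_nhds hx)).of_le
    (by norm_cast)

theorem contMDiffAt_comp_chart (he : e ∈ IsManifold.maximalAtlas 𝓘(ℝ, Rn n) ∞ X)
    (hx : x ∈ e.source) {h : Rn n → ℝ} (hh : ContDiffAt ℝ 2 h (e x)) :
    ContMDiffAt 𝓘(ℝ, Rn n) 𝓘(ℝ, ℝ) 2 (fun z => h (e z)) x :=
  (contMDiffAt_iff_contDiffAt.2 hh).comp x (contMDiffAt_of_mem_maximalAtlas_two he hx)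

theorem contMDiffAt_poly_chart_sub (he : e ∈ IsManifold.maximalAtlas 𝓘(ℝ, Rn n) ∞ X)
    (hx : x ∈ e.source) (j : Jet n) (y : Rn n) :
    ContMDiffAt 𝓘(ℝ, Rn n) 𝓘(ℝ, ℝ) 2 (fun z => j.poly (e z - y)) x :=
  contMDiffAt_comp_chart he hx (h := fun w => j.poly (w - y)) (j.contDiff_poly_sub y).contDiffAt

theorem continuous_ofChart (he : e ∈ IsManifold.maximalAtlas 𝓘(ℝ, Rn n) ∞ X) :
    Continuous fun q : e.target × Jet n => ofChart e (q.1 : Rn n) q.2 := by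
  rw [continuous_iff_coinduced_le]
  exact le_iSup (fun e : IsManifold.maximalAtlas 𝓘(ℝ, Rn n) ∞ X =>
    TopologicalSpace.coinduced
      (fun q : e.1.target × Jet n => ofChart e.1 (q.1 : Rn n) q.2) inferInstance) ⟨e, he⟩

theorem isOpen_jetBundle_iff {O : Set (JetBundle n X)} :
    IsOpen O ↔ ∀ e ∈ IsManifold.maximalAtlas 𝓘(ℝ, Rn n) ∞ X,
      IsOpen {q : e.target × Jet n | ofChart e (q.1 : Rn n) q.2 ∈ O} := by
  refine isOpen_iSup_iff.trans ?_
  rw [Subtype.forall]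
  exact forall₂_congr fun e he => isOpen_coinduced

theorem exists_ball_ofChart_mem (he : e ∈ IsManifold.maximalAtlas 𝓘(ℝ, Rn n) ∞ X)
    {O : Set (JetBundle n X)} (hO : IsOpen O) (hy : y ∈ e.target) {j₀ : Jet n}
    (hj₀ : ofChart e y j₀ ∈ O) :
    ∃ r > 0, Metric.ball y r ⊆ e.target ∧ ∀ z ∈ Metric.ball y r, ∀ j, ‖j - j₀‖ < r →
      ofChart e z j ∈ O := by
  have hpre := (hO.preimage (continuous_ofChart he)).mem_nhds
    (show ((⟨y, hy⟩ : e.target), j₀) ∈ _ from hj₀)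
  have hemb : Topology.IsOpenEmbedding fun q : e.target × Jet n => ((q.1 : Rn n), q.2) :=
    e.open_target.isOpenEmbedding_subtypeVal.prodMap .id
  obtain ⟨r, hr, hball⟩ := Metric.mem_nhds_iff.1 ((hemb.image_mem_nhds).2 hpre)
  have hmem : ∀ z ∈ Metric.ball y r, ∀ j, ‖j - j₀‖ < r → z ∈ e.target ∧ ofChart e z j ∈ O := by
    intro z hz j hj
    obtain ⟨⟨w, k⟩, hwk, hzj⟩ := hball (show (z, j) ∈ Metric.ball (y, j₀) r by
      rw [← ball_prod_same]
      exact ⟨hz, mem_ball_iff_norm.2 hj⟩)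
    obtain ⟨rfl, rfl⟩ := Prod.mk.inj hzj
    exact ⟨w.2, hwk⟩
  exact ⟨r, hr, fun z hz => (hmem z hz j₀ (by simpa using hr)).1,
    fun z hz j hj => (hmem z hz j hj).2⟩

variable [IsManifold 𝓘(ℝ, Rn n) ∞ X]

theorem contDiffAt_comp_chartAt_symm (hf : ContMDiffAt 𝓘(ℝ, Rn n) 𝓘(ℝ, ℝ) 2 f x) :
    ContDiffAt ℝ 2 (f ∘ (chartAt (Rn n) x).symm) (chartAt (Rn n) x x) :=
  contDiffAt_comp_symm (IsManifold.chart_mem_maximalAtlas x) (mem_chart_target (Rn n) x)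
    (by rwa [(chartAt (Rn n) x).left_inv (mem_chart_source (Rn n) x)])

theorem jetAt_add (hf : ContMDiffAt 𝓘(ℝ, Rn n) 𝓘(ℝ, ℝ) 2 f x)
    (hg : ContMDiffAt 𝓘(ℝ, Rn n) 𝓘(ℝ, ℝ) 2 g x) :
    jetAt n x (fun z => f z + g z) = jetAt n x f + jetAt n x g := by
  simp only [jetAt_eq_jetF]
  exact jetF_add (contDiffAt_comp_chartAt_symm hf) (contDiffAt_comp_chartAt_symm hg)

theorem jetAt_const_mul (hf : ContMDiffAt 𝓘(ℝ, Rn n) 𝓘(ℝ, ℝ) 2 f x) (t : ℝ) :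
    jetAt n x (fun z => t * f z) = t • jetAt n x f := by
  simp only [jetAt_eq_jetF]
  exact jetF_const_mul (contDiffAt_comp_chartAt_symm hf) t

theorem jetAt_add_const (hf : ContMDiffAt 𝓘(ℝ, Rn n) 𝓘(ℝ, ℝ) 2 f x) (c : ℝ) :
    jetAt n x (fun z => f z + c) = jetAt n x f + (c, 0, 0) := by
  rw [jetAt_add hf contMDiffAt_const, jetAt_const]

theorem jetAt_eq_of_jetF_eq (he : e ∈ IsManifold.maximalAtlas 𝓘(ℝ, Rn n) ∞ X)
    (hy : y ∈ e.target) (hf : ContMDiffAt 𝓘(ℝ, Rn n) 𝓘(ℝ, ℝ) 2 f (e.symm y))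
    (hg : ContMDiffAt 𝓘(ℝ, Rn n) 𝓘(ℝ, ℝ) 2 g (e.symm y))
    (hfg : jetF (f ∘ e.symm) y = jetF (g ∘ e.symm) y) :
    jetAt n (e.symm y) f = jetAt n (e.symm y) g := by
  set x := e.symm y with hx
  set χ := chartAt (Rn n) x
  have hxe : x ∈ e.source := e.map_target hy
  have hxχ : x ∈ χ.source := mem_chart_source (Rn n) x
  have hτ : ContDiffAt ℝ 2 (e ∘ χ.symm) (χ x) := by
    have hχ := IsManifold.chart_mem_maximalAtlas (I := 𝓘(ℝ, Rn n)) (n := ∞) x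
    have hsymm : ContMDiffAt 𝓘(ℝ, Rn n) 𝓘(ℝ, Rn n) 2 χ.symm (χ x) :=
      ((contMDiffOn_symm_of_mem_maximalAtlas hχ).contMDiffAt
        (χ.open_target.mem_nhds (χ.map_source hxχ))).of_le (by norm_cast)
    refine contMDiffAt_iff_contDiffAt.1 (ContMDiffAt.comp _ ?_ hsymm)
    rw [χ.left_inv hxχ]
    exact contMDiffAt_of_mem_maximalAtlas_two he hxe
  have hτx : (e ∘ χ.symm) (χ x) = y := by
    rw [Function.comp_apply, χ.left_inv hxχ, hx, e.right_inv hy]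
  have hcomp : ∀ f : X → ℝ, f ∘ χ.symm =ᶠ[𝓝 (χ x)] (f ∘ e.symm) ∘ (e ∘ χ.symm) := fun f => by
    filter_upwards [eventually_symm_apply_comp_symm hxe hxχ] with z hz
    simp only [Function.comp_apply, hz]
  rw [jetAt_eq_jetF, jetAt_eq_jetF, jetF_congr (hcomp f), jetF_congr (hcomp g)]
  refine jetF_comp_congr hτ ?_ ?_ ?_ <;> rw [hτx]
  exacts [contDiffAt_comp_symm he hy hf, contDiffAt_comp_symm he hy hg, hfg]

theorem ofChart_jetF (he : e ∈ IsManifold.maximalAtlas 𝓘(ℝ, Rn n) ∞ X) (hy : y ∈ e.target)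
    (hf : ContMDiffAt 𝓘(ℝ, Rn n) 𝓘(ℝ, ℝ) 2 f (e.symm y)) :
    ofChart e y (jetF (f ∘ e.symm) y) = ⟨e.symm y, jetAt n (e.symm y) f⟩ :=
  congrArg (JetBundle.mk _) <|
    jetAt_eq_of_jetF_eq he hy (contMDiffAt_poly_chart_sub he (e.map_target hy) _ y) hf
      (jetF_poly_comp_symm hy _)

/-- The change of fibre coordinates over `e.symm y`, from the trivialization given by the chart
`e` to the one given by the preferred chart. -/
def fibreMap (he : e ∈ IsManifold.maximalAtlas 𝓘(ℝ, Rn n) ∞ X) (hy : y ∈ e.target) :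
    Jet n →ₗ[ℝ] Jet n where
  toFun j := (ofChart e y j).fib
  map_add' j k := by
    simp only [ofChart, Jet.poly_add]
    exact jetAt_add (contMDiffAt_poly_chart_sub he (e.map_target hy) j y)
      (contMDiffAt_poly_chart_sub he (e.map_target hy) k y)
  map_smul' t j := by
    simp only [ofChart, Jet.poly_smul]
    exact jetAt_const_mul (contMDiffAt_poly_chart_sub he (e.map_target hy) j y) t

theorem ofChart_eq (he : e ∈ IsManifold.maximalAtlas 𝓘(ℝ, Rn n) ∞ X) (hy : y ∈ e.target)
    (j : Jet n) : ofChart e y j = ⟨e.symm y, fibreMap he hy j⟩ :=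
  rfl

theorem ofChart_mem_iff (he : e ∈ IsManifold.maximalAtlas 𝓘(ℝ, Rn n) ∞ X) (hy : y ∈ e.target)
    (j : Jet n) (G : Set (JetBundle n X)) :
    ofChart e y j ∈ G ↔ fibreMap he hy j ∈ fibre G (e.symm y) :=
  Iff.rfl

theorem fibreMap_surjective (he : e ∈ IsManifold.maximalAtlas 𝓘(ℝ, Rn n) ∞ X)
    (hy : y ∈ e.target) : Function.Surjective (fibreMap he hy) := fun j => by
  have hx := mem_chart_source (Rn n) (e.symm y)
  have hf := contMDiffAt_poly_chart_sub (IsManifold.chart_mem_maximalAtlas (e.symm y)) hx j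
    (chartAt (Rn n) (e.symm y) (e.symm y))
  refine ⟨_, (congrArg JetBundle.fib (ofChart_jetF he hy hf)).trans ?_⟩
  rw [jetAt_eq_jetF, jetF_poly_comp_symm (mem_chart_target (Rn n) _)]

theorem isOpenMap_fibreMap (he : e ∈ IsManifold.maximalAtlas 𝓘(ℝ, Rn n) ∞ X)
    (hy : y ∈ e.target) : IsOpenMap (fibreMap he hy) :=
  (fibreMap he hy).isOpenMap_of_finiteDimensional (fibreMap_surjective he hy)

end Charts

namespace AffineJetAut

variable {n : ℕ} {V : Set (Rn n)} (Ψ : AffineJetAut n V)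

theorem act_injective (y : Rn n) : Function.Injective (Ψ.act y) := by
  rintro ⟨r, p, A⟩ ⟨r', p', A'⟩ h
  obtain ⟨rfl, hp, hA⟩ : r = r' ∧ Ψ.g y p = Ψ.g y p' ∧
      SymForm.pull (Ψ.k y : Rn n →L[ℝ] Rn n) A + Ψ.L y p =
        SymForm.pull (Ψ.k y : Rn n →L[ℝ] Rn n) A' + Ψ.L y p' := by
    simpa only [Prod.mk.injEq] using add_right_cancel h
  obtain rfl := (Ψ.g y).injective hp
  have hpull : Function.Injective (SymForm.pull (Ψ.k y : Rn n →L[ℝ] Rn n)) :=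
    Function.LeftInverse.injective fun B => SymForm.pull_pull_symm (Ψ.k y).symm B
  rw [hpull (add_right_cancel hA)]

theorem act_surjective (y : Rn n) : Function.Surjective (Ψ.act y) := fun d => by
  set p := (Ψ.g y).symm (d - Ψ.S y).2.1 with hp
  refine ⟨((d - Ψ.S y).1, p, SymForm.pull ((Ψ.k y).symm : Rn n →L[ℝ] Rn n)
    ((d - Ψ.S y).2.2 - Ψ.L y p)), ?_⟩
  rw [act, SymForm.pull_pull_symm, sub_add_cancel, hp, (Ψ.g y).apply_symm_apply, sub_add_cancel]

theorem continuous_act (y : Rn n) : Continuous (Ψ.act y) := by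
  have hpull : Continuous (SymForm.pull (Ψ.k y : Rn n →L[ℝ] Rn n)) := by
    let T : SymForm n →ₗ[ℝ] SymForm n :=
      { toFun := SymForm.pull (Ψ.k y : Rn n →L[ℝ] Rn n)
        map_add' := SymForm.pull_add _
        map_smul' := fun t A => SymForm.ext fun v w => by simp }
    exact T.continuous_of_finiteDimensional
  unfold AffineJetAut.act
  fun_prop

end AffineJetAut

section Viscosity

theorem Jet.poly_smul_one {n : ℕ} (t : ℝ) (v : Rn n) :
    Jet.poly (0, 0, t • SymForm.one n) v = 2⁻¹ * t * ‖v‖ ^ 2 := by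
  simp only [Jet.poly, SymForm.bil_smul, _root_.zero_apply, _root_.smul_apply,
    SymForm.one_apply, real_inner_self_eq_norm_sq, smul_eq_mul]
  ring

theorem norm_smul_one_le {n : ℕ} (t : ℝ) : ‖((0, 0, t • SymForm.one n) : Jet n)‖ ≤ |t| := by
  refine norm_zero_mk_le (by simp) ?_
  rw [norm_smul, Real.norm_eq_abs]
  exact mul_le_of_le_one_right (abs_nonneg t) SymForm.norm_one_le

theorem exists_pos_forall_abs_mul_le {X : Type*} [TopologicalSpace X] {K : Set X}
    (hK : IsCompact K) {ψ : X → ℝ} (hψ : ContinuousOn ψ K) {m : ℝ} (hm : 0 < m) :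
    ∃ ε > 0, ∀ z ∈ K, |ε * ψ z| ≤ m := by
  obtain ⟨b, hb⟩ := hK.exists_bound_of_continuousOn hψ
  refine ⟨m / (|b| + 1), by positivity, fun z hz => ?_⟩
  have hbz : |ψ z| ≤ |b| + 1 := (hb z hz).trans ((le_abs_self b).trans (by linarith))
  have hm0 : 0 < m / (|b| + 1) := by positivity
  rw [abs_mul, abs_of_pos hm0]
  exact (mul_le_mul_of_nonneg_left hbz hm0.le).trans_eq (by field_simp)

variable {n : ℕ} {X : Type*} [TopologicalSpace X] {e : OpenPartialHomeomorph X (Rn n)} {y : Rn n}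

theorem tendsto_chart_sub (hy : y ∈ e.target) :
    Tendsto (fun z => e z - y) (𝓝 (e.symm y)) (𝓝 0) := by
  have h1 := (e.continuousAt (e.map_target hy)).tendsto
  rw [e.right_inv hy] at h1
  simpa using h1.sub_const y

variable [ChartedSpace (Rn n) X]

/-- The viscosity condition at `x` for a real valued function `u`: the 2-jet at `x` of every `C²`
function touching `u` from above at `x` lies in `G`. -/
def ViscAt (G : Set (JetBundle n X)) (u : X → ℝ) (x : X) : Prop :=
  ∀ φ : X → ℝ, ContMDiffAt 𝓘(ℝ, Rn n) 𝓘(ℝ, ℝ) 2 φ x → (∀ᶠ z in 𝓝 x, u z ≤ φ z) →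
    u x = φ x → jetAt n x φ ∈ fibre G x

theorem ViscAt.ofChart_add_smul_one_mem {G : Set (JetBundle n X)}
    (he : e ∈ IsManifold.maximalAtlas 𝓘(ℝ, Rn n) ∞ X) (hy : y ∈ e.target) {u : X → ℝ}
    (hu : ViscAt G u (e.symm y)) {p : Rn n →L[ℝ] ℝ} {A : SymForm n}
    (hj : IsUpperJet (u ∘ e.symm) y p A.bil) {ε : ℝ} (hε : 0 < ε) :
    ofChart e y ((u (e.symm y), p, A) + (0, 0, (2 * ε) • SymForm.one n)) ∈ G := by
  refine hu _ (contMDiffAt_poly_chart_sub he (e.map_target hy) _ y) ?_ ?_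
  · filter_upwards [(tendsto_chart_sub hy).eventually (hj ε hε),
      e.open_source.mem_nhds (e.map_target hy)] with z hz hzs
    rw [add_sub_cancel] at hz
    simp only [Function.comp_apply, e.left_inv hzs] at hz
    rw [Jet.poly_add, Jet.poly_smul_one, inv_mul_cancel_left₀ two_ne_zero]
    exact hz
  · rw [e.right_inv hy, sub_self, Jet.poly_zero, Prod.fst_add, add_zero]

theorem ViscAt.ofChart_mem {G : Set (JetBundle n X)} (hG : IsClosed G)
    (he : e ∈ IsManifold.maximalAtlas 𝓘(ℝ, Rn n) ∞ X) (hy : y ∈ e.target) {u : X → ℝ}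
    (hu : ViscAt G u (e.symm y)) {p : Rn n →L[ℝ] ℝ} {A : SymForm n}
    (hj : IsUpperJet (u ∘ e.symm) y p A.bil) : ofChart e y (u (e.symm y), p, A) ∈ G := by
  by_contra hcon
  obtain ⟨r, hr, -, hball⟩ := exists_ball_ofChart_mem he hG.isOpen_compl hy hcon
  refine hball y (Metric.mem_ball_self hr) _ ?_
    (hu.ofChart_add_smul_one_mem he hy hj (show 0 < r / 4 by positivity))
  rw [add_sub_cancel_left]
  refine (norm_smul_one_le _).trans_lt ?_
  rw [abs_of_pos (by positivity)]
  linarith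

variable {F M : Set (JetBundle n X)}

theorem IsSubequation.mem_fibre_dual (hF : IsSubequation F) {x : X} {j : Jet n} :
    j ∈ fibre (dual F) x ↔ -j ∉ interior (fibre F x) := by
  rw [hF.interior_fibre]
  rfl

variable [IsManifold 𝓘(ℝ, Rn n) ∞ X]

theorem isClosed_dual (F : Set (JetBundle n X)) : IsClosed (dual F) := by
  rw [← isOpen_compl_iff, isOpen_jetBundle_iff]
  intro e he
  have hneg : Continuous fun q : e.target × Jet n => (q.1, -q.2) := by fun_prop
  convert (isOpen_interior (s := F)).preimage ((continuous_ofChart he).comp hneg) using 1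
  ext q
  have hfib : ofChart e (q.1 : Rn n) (-q.2) =
      ⟨(ofChart e (q.1 : Rn n) q.2).base, -(ofChart e (q.1 : Rn n) q.2).fib⟩ := by
    rw [ofChart_eq he q.1.2, ofChart_eq he q.1.2, map_neg]
  simp only [dual, mem_compl_iff, mem_ofPred_eq, not_not, mem_preimage, Function.comp_apply, hfib]

theorem ofChart_add_mem (hM : IsMonotonicityCone M F)
    (he : e ∈ IsManifold.maximalAtlas 𝓘(ℝ, Rn n) ∞ X) (hy : y ∈ e.target) {j m : Jet n}
    (hj : ofChart e y j ∈ F) (hm : ofChart e y m ∈ M) : ofChart e y (j + m) ∈ F := by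
  rw [ofChart_mem_iff he hy] at hj hm ⊢
  rw [map_add]
  exact hM.add_mem _ _ hj _ hm

theorem ofChart_smul_mem (hM : IsMonotonicityCone M F)
    (he : e ∈ IsManifold.maximalAtlas 𝓘(ℝ, Rn n) ∞ X) (hy : y ∈ e.target) {m : Jet n}
    (hm : ofChart e y m ∈ M) {t : ℝ} (ht : 0 < t) : ofChart e y (t • m) ∈ M := by
  rw [ofChart_mem_iff he hy] at hm ⊢
  rw [map_smul]
  exact hM.cone _ _ hm t ht

theorem exists_ball_ofChart_mem_cone (hM : IsMonotonicityCone M F) {ψ : X → ℝ}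
    (hψ : IsStrictlySubharmonic M ψ) (he : e ∈ IsManifold.maximalAtlas 𝓘(ℝ, Rn n) ∞ X)
    (hy : y ∈ e.target) :
    ∃ r > 0, Metric.ball y r ⊆ e.target ∧ ∀ z ∈ Metric.ball y r, ∀ t > 0, ∀ j : Jet n,
      ‖j - t • jetF (ψ ∘ e.symm) y‖ < t * r → ofChart e z j ∈ M := by
  have hint : ofChart e y (jetF (ψ ∘ e.symm) y) ∈ interior M := by
    rw [ofChart_jetF he hy hψ.1.contMDiffAt]
    have := hψ.2 (e.symm y)
    rwa [hM.isSubequation.interior_fibre] at this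
  obtain ⟨r, hr, hsub, hball⟩ := exists_ball_ofChart_mem he isOpen_interior hy hint
  refine ⟨r, hr, hsub, fun z hz t ht j hj => ?_⟩
  have hlt : ‖t⁻¹ • j - jetF (ψ ∘ e.symm) y‖ < r := by
    have heq : j - t • jetF (ψ ∘ e.symm) y = t • (t⁻¹ • j - jetF (ψ ∘ e.symm) y) := by
      rw [smul_sub, smul_inv_smul₀ ht.ne']
    rw [heq, norm_smul, Real.norm_of_nonneg ht.le] at hj
    exact lt_of_mul_lt_mul_left hj ht.le
  have hmem := ofChart_smul_mem hM he (hsub hz) (interior_subset (hball z hz _ hlt)) ht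
  rwa [smul_inv_smul₀ ht.ne'] at hmem

theorem act_neg_notMem_interior (hF : IsSubequation F)
    (he : e ∈ IsManifold.maximalAtlas 𝓘(ℝ, Rn n) ∞ X) {F₀ : Set (Jet n)}
    {Ψ : AffineJetAut n e.target} (hy : y ∈ e.target)
    (hΨ : Ψ.act y '' {j | ofChart e y j ∈ F} = F₀) {j : Jet n} (hj : ofChart e y j ∈ dual F) :
    Ψ.act y (-j) ∉ interior F₀ := fun hin => by
  rw [ofChart_mem_iff he hy, hF.mem_fibre_dual, ← map_neg] at hj
  have hsub : fibreMap he hy '' (Ψ.act y ⁻¹' interior F₀) ⊆ fibre F (e.symm y) := by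
    rintro _ ⟨k, hk, rfl⟩
    have hk' : Ψ.act y k ∈ F₀ := interior_subset hk
    rw [← hΨ] at hk'
    obtain ⟨k', hk', heq⟩ := hk'
    rw [← Ψ.act_injective y heq]
    exact hk'
  exact hj <| interior_maximal hsub
    (isOpenMap_fibreMap he hy _ (isOpen_interior.preimage (Ψ.continuous_act y))) ⟨-j, hin, rfl⟩

theorem exists_perturbation_mem_cone (hM : IsMonotonicityCone M F) {ψ : X → ℝ}
    (hψ : IsStrictlySubharmonic M ψ) (he : e ∈ IsManifold.maximalAtlas 𝓘(ℝ, Rn n) ∞ X)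
    (hy : y ∈ e.target) {ε : ℝ} (hε : 0 < ε) :
    ∃ h : Rn n → ℝ, ∃ c > 0, h y = ε * ψ (e.symm y) ∧ (∀ z ≠ y, h z < ε * ψ (e.symm z)) ∧
      ∀ᶠ z in 𝓝 y, z ∈ e.target ∧ ContDiffAt ℝ 2 h z ∧
        ∀ d, ‖d‖ ≤ c → ofChart e z (jetF h z + d) ∈ M := by
  obtain ⟨r, hr, hrt, hcone⟩ := exists_ball_ofChart_mem_cone hM hψ he hy
  set c := ε * r / 4 with hc
  have hc0 : 0 < c := by positivity
  set J : Jet n := (0, 0, (-c) • SymForm.one n) with hJ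
  have hJc : ‖J‖ ≤ c := by simpa only [abs_neg, abs_of_pos hc0] using norm_smul_one_le (n := n) (-c)
  set h : Rn n → ℝ := fun z => ε * (ψ ∘ e.symm) z + J.poly (z - y) with hh
  have hψe : ∀ z ∈ e.target, ContDiffAt ℝ 2 (ψ ∘ e.symm) z := fun z hz =>
    contDiffAt_comp_symm he hz hψ.1.contMDiffAt
  have hC2 : ∀ z ∈ e.target, ContDiffAt ℝ 2 h z := fun z hz =>
    (contDiffAt_const.mul (hψe z hz)).add (J.contDiff_poly_sub y).contDiffAt
  have hjet : jetF h y = ε • jetF (ψ ∘ e.symm) y + J := by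
    rw [hh, jetF_add (contDiffAt_const.mul (hψe y hy)) (J.contDiff_poly_sub y).contDiffAt,
      jetF_const_mul (hψe y hy), jetF_poly_sub]
  refine ⟨h, c, hc0, ?_, fun z hz => ?_, ?_⟩
  · simp only [hh, Function.comp_apply, sub_self, Jet.poly_zero, hJ, add_zero]
  · have : 0 < ‖z - y‖ := norm_pos_iff.2 (sub_ne_zero.2 hz)
    have : 0 < c * ‖z - y‖ ^ 2 := by positivity
    simp only [hh, Function.comp_apply, hJ, Jet.poly_smul_one]
    linarith
  · filter_upwards [Metric.ball_mem_nhds y hr,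
      Metric.tendsto_nhds.1 (continuousAt_jetF (hC2 y hy)) c hc0] with z hz hzc
    refine ⟨hrt hz, hC2 z (hrt hz), fun d hd => hcone z hz ε hε _ ?_⟩
    have heq : jetF h z + d - ε • jetF (ψ ∘ e.symm) y = (jetF h z - jetF h y) + J + d := by
      rw [hjet]
      abel
    rw [dist_eq_norm] at hzc
    rw [heq]
    linarith only [norm_add₃_le (a := jetF h z - jetF h y) (b := J) (c := d), hzc, hJc, hd, hc, hc0]

theorem ViscAt.act_add_mem (hF : IsSubequation F) (hM : IsMonotonicityCone M F)
    (he : e ∈ IsManifold.maximalAtlas 𝓘(ℝ, Rn n) ∞ X) {F₀ : Set (Jet n)}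
    {Ψ : AffineJetAut n e.target} (hy : y ∈ e.target)
    (hΨ : Ψ.act y '' {j | ofChart e y j ∈ F} = F₀) {u : X → ℝ} (hu : ViscAt F u (e.symm y))
    {h : Rn n → ℝ} (hh : ContDiffAt ℝ 2 h y) {p : Rn n →L[ℝ] ℝ} {A : SymForm n}
    (hj : IsUpperJet (fun z => u (e.symm z) + h z) y p A.bil) {d : Jet n}
    (hd : ofChart e y (jetF h y + d) ∈ M) :
    Ψ.act y ((u (e.symm y) + h y, p, A) + d) ∈ F₀ := by
  have hmem := ofChart_add_mem hM he hy
    (hu.ofChart_mem hF.isClosed he hy (hj.sub_contDiffAt (u := u ∘ e.symm) hh)) hd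
  have hsum : (u (e.symm y) + h y, p, A) + d =
      (u (e.symm y), p - (jetF h y).2.1, A - (jetF h y).2.2) + (jetF h y + d) := by
    rw [← add_assoc]
    refine congrArg (· + d) (Prod.ext rfl (Prod.ext ?_ ?_)) <;>
      simp only [Prod.fst_add, Prod.snd_add, sub_add_cancel]
  rw [← hΨ, hsum]
  exact mem_image_of_mem _ hmem

variable {F₀ : Set (Jet n)} {ψ u v : X → ℝ} {Ω : Set X}

theorem add_add_mul_nonpos_of_isMaxOn (hF : IsSubequation F) (hM : IsMonotonicityCone M F)
    (hF₀ : PosNeg F₀) (hjet : LocallyAffinelyJetEquivalent F F₀)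
    (hψ : IsStrictlySubharmonic M ψ) (hΩ : IsOpen Ω) (hu : UpperSemicontinuousOn u Ω)
    (hv : UpperSemicontinuousOn v Ω) (huF : ∀ x ∈ Ω, ViscAt F u x)
    (hvF : ∀ x ∈ Ω, ViscAt (dual F) v x) {ε : ℝ} (hε : 0 < ε) {x₀ : X} (hx₀ : x₀ ∈ Ω)
    (hmax : IsMaxOn (fun x => u x + v x + ε * ψ x) Ω x₀) : u x₀ + v x₀ + ε * ψ x₀ ≤ 0 := by
  by_contra! hpos
  obtain ⟨e, he, hxe, Ψ, hΨ⟩ := hjet x₀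
  obtain ⟨y₀, hy₀, rfl⟩ : ∃ y ∈ e.target, e.symm y = x₀ := ⟨e x₀, e.map_source hxe, e.left_inv hxe⟩
  obtain ⟨h, c, hc, hhy₀, hlt, hev⟩ := exists_perturbation_mem_cone hM hψ he hy₀ hε
  obtain ⟨R, hR, hball⟩ := Metric.nhds_basis_closedBall.eventually_iff.1
    (hev.and ((e.continuousAt_symm hy₀).eventually (hΩ.mem_nhds hx₀)))
  set K := Metric.closedBall y₀ R
  have hKt : K ⊆ e.target := fun y hy => (hball hy).1.1
  have hmaps : MapsTo e.symm K Ω := fun y hy => (hball hy).2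
  have hh : ∀ y ∈ K, ContDiffAt ℝ 2 h y := fun y hy => (hball hy).1.2.1
  have hsymm : ContinuousOn e.symm K := e.continuousOn_symm.mono hKt
  have hhK : ContinuousOn h K := fun y hy => (hh y hy).continuousAt.continuousWithinAt
  refine local_comparison hF₀ Ψ (isCompact_closedBall y₀ R) (e.open_target.mem_nhds hy₀)
    (mem_interior_iff_mem_nhds.2 (Metric.closedBall_mem_nhds y₀ hR))
    (u := fun z => u (e.symm z) + h z) (v := v ∘ e.symm)
    ((hu.comp hsymm hmaps).add hhK.upperSemicontinuousOn) (hv.comp hsymm hmaps)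
    (fun z hz hne => ?_) ?_ hc (fun y hy p A hj d hd => ?_) (fun y hy p A hj => ?_)
  · have := hmax (hmaps hz)
    rw [mem_ofPred_eq] at this
    rw [Function.comp_apply, Function.comp_apply, hhy₀]
    linarith [hlt z hne]
  · rw [Function.comp_apply, hhy₀]
    linarith
  · have hyK := interior_subset hy
    exact (huF _ (hmaps hyK)).act_add_mem hF hM he (hKt hyK) (hΨ y (hKt hyK)) (hh y hyK) hj
      ((hball hyK).1.2.2 d hd)
  · have hyK := interior_subset hy
    exact act_neg_notMem_interior hF he (hKt hyK) (hΨ y (hKt hyK))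
      ((hvF _ (hmaps hyK)).ofChart_mem (isClosed_dual F) he (hKt hyK) hj)

theorem comparison (hF : IsSubequation F) (hM : IsMonotonicityCone M F) (hF₀ : PosNeg F₀)
    (hjet : LocallyAffinelyJetEquivalent F F₀) (hψ : IsStrictlySubharmonic M ψ)
    (hΩ : IsOpen Ω) (hΩc : IsCompact (closure Ω)) (hu : UpperSemicontinuousOn u (closure Ω))
    (hv : UpperSemicontinuousOn v (closure Ω)) (huF : ∀ x ∈ Ω, ViscAt F u x)
    (hvF : ∀ x ∈ Ω, ViscAt (dual F) v x) (hbd : ∀ x ∈ frontier Ω, u x + v x ≤ 0) :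
    ∀ x ∈ closure Ω, u x + v x ≤ 0 := by
  intro x hx
  by_contra! hpos
  have hψc : Continuous ψ := hψ.1.continuous
  obtain ⟨ε, hε, hψε⟩ := exists_pos_forall_abs_mul_le hΩc hψc.continuousOn
    (show 0 < (u x + v x) / 4 by linarith)
  obtain ⟨x₀, hx₀, hmax⟩ := UpperSemicontinuousOn.exists_isMaxOn ⟨x, hx⟩ hΩc
    ((hu.add hv).add (continuous_const.mul hψc).continuousOn.upperSemicontinuousOn)
  have hle : u x + v x + ε * ψ x ≤ u x₀ + v x₀ + ε * ψ x₀ := hmax hx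
  have hεx := (abs_le.1 (hψε x hx)).1
  have hεx₀ := (abs_le.1 (hψε x₀ hx₀)).2
  have hx₀Ω : x₀ ∈ Ω := by
    by_contra hn
    linarith [hbd x₀ (hΩ.frontier_eq ▸ ⟨hx₀, hn⟩)]
  linarith [add_add_mul_nonpos_of_isMaxOn hF hM hF₀ hjet hψ hΩ (hu.mono subset_closure)
    (hv.mono subset_closure) huF hvF hε hx₀Ω (hmax.on_subset subset_closure)]

end Viscosity

section ChartBalls

variable {n : ℕ} {X : Type*} [TopologicalSpace X] [ChartedSpace (Rn n) X]

/-- The squared distance to `x` in the preferred chart at `x`, the quadratic function by which test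
functions are perturbed near `x`. Only its values on the chart domain matter. -/
def chartSq (n : ℕ) {X : Type*} [TopologicalSpace X] [ChartedSpace (Rn n) X] (x z : X) : ℝ :=
  ‖chartAt (Rn n) x z - chartAt (Rn n) x x‖ ^ 2

/-- The closed ball about `x` in the preferred chart at `x`, cut off at the boundary of the chart;
it is compact for small radii. -/
def chartDisc (n : ℕ) {X : Type*} [TopologicalSpace X] [ChartedSpace (Rn n) X] (x : X) (R : ℝ) :
    Set X :=
  (chartAt (Rn n) x).source ∩ chartAt (Rn n) x ⁻¹' Metric.closedBall (chartAt (Rn n) x x) R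

/-- The open ball about `x` in the preferred chart at `x`, cut off at the boundary of the chart. -/
def chartBall (n : ℕ) {X : Type*} [TopologicalSpace X] [ChartedSpace (Rn n) X] (x : X) (R : ℝ) :
    Set X :=
  (chartAt (Rn n) x).source ∩ chartAt (Rn n) x ⁻¹' Metric.ball (chartAt (Rn n) x x) R

theorem chartSq_self (x : X) : chartSq n x x = 0 := by simp [chartSq]

theorem chartSq_nonneg (x z : X) : 0 ≤ chartSq n x z := sq_nonneg _

variable {x z : X} {R R' : ℝ}

theorem mem_chartBall_of_chartSq_lt (hR : 0 ≤ R) (hz : z ∈ (chartAt (Rn n) x).source)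
    (h : chartSq n x z < R ^ 2) : z ∈ chartBall n x R :=
  ⟨hz, mem_ball_iff_norm.2 (lt_of_pow_lt_pow_left₀ 2 hR h)⟩

theorem sq_lt_chartSq_of_notMem_chartDisc (hR : 0 ≤ R) (hz : z ∈ (chartAt (Rn n) x).source)
    (h : z ∉ chartDisc n x R) : R ^ 2 < chartSq n x z :=
  pow_lt_pow_left₀ (not_le.1 fun hle => h ⟨hz, mem_closedBall_iff_norm.2 hle⟩) hR two_ne_zero

theorem chartBall_subset_chartDisc (x : X) (R : ℝ) : chartBall n x R ⊆ chartDisc n x R :=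
  inter_subset_inter_right _ (preimage_mono Metric.ball_subset_closedBall)

theorem chartDisc_subset_chartBall (x : X) (h : R < R') : chartDisc n x R ⊆ chartBall n x R' :=
  inter_subset_inter_right _ (preimage_mono (Metric.closedBall_subset_ball h))

theorem isOpen_chartBall (x : X) (R : ℝ) : IsOpen (chartBall n x R) :=
  (chartAt (Rn n) x).isOpen_inter_preimage Metric.isOpen_ball

theorem chartBall_mem_nhds (x : X) (hR : 0 < R) : chartBall n x R ∈ 𝓝 x :=
  (isOpen_chartBall x R).mem_nhds ⟨mem_chart_source (Rn n) x, Metric.mem_ball_self hR⟩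

theorem exists_chartDisc_subset {A : Set X} (hA : A ∈ 𝓝 x) :
    ∃ R > 0, (∀ R' ≤ R, IsCompact (chartDisc n x R')) ∧ chartDisc n x R ⊆ A := by
  set e := chartAt (Rn n) x
  have hx : e x ∈ e.target := mem_chart_target (Rn n) x
  have hpre : e.symm ⁻¹' A ∈ 𝓝 (e x) := by
    refine (e.continuousAt_symm hx).preimage_mem_nhds ?_
    rwa [e.left_inv (mem_chart_source (Rn n) x)]
  obtain ⟨R, hR, hsub⟩ := Metric.nhds_basis_closedBall.mem_iff.1
    (Filter.inter_mem (e.open_target.mem_nhds hx) hpre)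
  refine ⟨R, hR, fun R' hR' => ?_, fun z hz => ?_⟩
  · have hR't : Metric.closedBall (e x) R' ⊆ e.target :=
      (Metric.closedBall_subset_closedBall hR').trans (hsub.trans inter_subset_left)
    rw [chartDisc, ← e.symm_image_eq_source_inter_preimage hR't]
    exact (isCompact_closedBall _ _).image_of_continuousOn (e.continuousOn_symm.mono hR't)
  · rw [← e.left_inv hz.1]
    exact (hsub hz.2).2

variable [IsManifold 𝓘(ℝ, Rn n) ∞ X]

theorem contMDiffAt_chartSq (hz : z ∈ (chartAt (Rn n) x).source) :
    ContMDiffAt 𝓘(ℝ, Rn n) 𝓘(ℝ, ℝ) 2 (chartSq n x) z := by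
  have hsq : ContDiff ℝ 2 fun w : Rn n => ‖w - chartAt (Rn n) x x‖ ^ 2 :=
    (contDiff_id.sub contDiff_const).norm_sq ℝ
  exact contMDiffAt_comp_chart (IsManifold.chart_mem_maximalAtlas x) hz hsq.contDiffAt

end ChartBalls

section Perturbation

theorem jetF_add_const_mul_add_const {n : ℕ} {h k : Rn n → ℝ} {y : Rn n}
    (hh : ContDiffAt ℝ 2 h y) (hk : ContDiffAt ℝ 2 k y) (s κ : ℝ) :
    jetF (fun z => h z + s * k z + κ) y = jetF h y + s • jetF k y + (κ, 0, 0) := by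
  have hsk : ContDiffAt ℝ 2 (fun z => s * k z) y := contDiffAt_const.mul hk
  rw [← jetF_const_mul hk, ← jetF_const κ y, ← jetF_add hh hsk]
  exact jetF_add (hh.add hsk) contDiffAt_const

variable {n : ℕ} {X : Type*} [TopologicalSpace X] [ChartedSpace (Rn n) X]
  {f g : X → ℝ} {x : X}

theorem contMDiffAt_add_const_mul_add_const (hf : ContMDiffAt 𝓘(ℝ, Rn n) 𝓘(ℝ, ℝ) 2 f x)
    (hg : ContMDiffAt 𝓘(ℝ, Rn n) 𝓘(ℝ, ℝ) 2 g x) (s κ : ℝ) :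
    ContMDiffAt 𝓘(ℝ, Rn n) 𝓘(ℝ, ℝ) 2 (fun z => f z + s * g z + κ) x :=
  (hf.add (contMDiffAt_const.mul hg)).add contMDiffAt_const

variable [IsManifold 𝓘(ℝ, Rn n) ∞ X]

theorem eventually_contMDiffAt (hf : ContMDiffAt 𝓘(ℝ, Rn n) 𝓘(ℝ, ℝ) 2 f x) :
    ∀ᶠ z in 𝓝 x, ContMDiffAt 𝓘(ℝ, Rn n) 𝓘(ℝ, ℝ) 2 f z := by
  have : IsManifold 𝓘(ℝ, Rn n) 2 X := .of_le (n := ∞) (by norm_cast)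
  exact (contMDiffAt_iff_contMDiffAt_nhds (by simp)).1 hf

theorem exists_pos_eventually_jetAt_add_mem (hf : ContMDiffAt 𝓘(ℝ, Rn n) 𝓘(ℝ, ℝ) 2 f x)
    (hg : ContMDiffAt 𝓘(ℝ, Rn n) 𝓘(ℝ, ℝ) 2 g x) {O : Set (JetBundle n X)} (hO : IsOpen O)
    (h : (⟨x, jetAt n x f⟩ : JetBundle n X) ∈ O) :
    ∃ η > 0, ∀ᶠ z in 𝓝 x, ∀ s κ : ℝ, |s| ≤ η → |κ| ≤ η →
      (⟨z, jetAt n z (fun w => f w + s * g w + κ)⟩ : JetBundle n X) ∈ O := by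
  set e := chartAt (Rn n) x
  have he : e ∈ IsManifold.maximalAtlas 𝓘(ℝ, Rn n) ∞ X := IsManifold.chart_mem_maximalAtlas x
  have hx : x ∈ e.source := mem_chart_source (Rn n) x
  have hJ : ContinuousAt (fun p : X × ℝ × ℝ => jetF (f ∘ e.symm) (e p.1) +
      p.2.1 • jetF (g ∘ e.symm) (e p.1) + (p.2.2, 0, 0)) (x, 0, 0) := by
    have hbase : ContinuousAt (fun p : X × ℝ × ℝ => e p.1) (x, 0, 0) :=
      (e.continuousAt hx).comp continuousAt_fst
    have hF := (continuousAt_jetF (contDiffAt_comp_chartAt_symm hf)).comp_of_eq hbase rfl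
    have hG := (continuousAt_jetF (contDiffAt_comp_chartAt_symm hg)).comp_of_eq hbase rfl
    exact (hF.add ((by fun_prop : ContinuousAt (fun p : X × ℝ × ℝ => p.2.1) _).smul hG)).add
      (by fun_prop)
  have hxO : ofChart e (e x) (jetF (f ∘ e.symm) (e x)) ∈ O := by
    rw [ofChart_jetF he (e.map_source hx) (by rwa [e.left_inv hx]), e.left_inv hx]
    exact h
  obtain ⟨r, hr, -, hball⟩ := exists_ball_ofChart_mem he hO (e.map_source hx) hxO
  have hclose : ∀ᶠ p in 𝓝 (x, (0 : ℝ × ℝ)), ‖jetF (f ∘ e.symm) (e p.1) +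
      p.2.1 • jetF (g ∘ e.symm) (e p.1) + (p.2.2, 0, 0) - jetF (f ∘ e.symm) (e x)‖ < r := by
    refine (hJ.sub_const _).norm.eventually (gt_mem_nhds ?_)
    simpa using hr
  rw [nhds_prod_eq] at hclose
  obtain ⟨P, hP, Q, hQ, hPQ⟩ := Filter.eventually_prod_iff.1 hclose
  obtain ⟨η, hη, hηQ⟩ := Metric.nhds_basis_closedBall.eventually_iff.1 hQ
  refine ⟨η, hη, ?_⟩
  filter_upwards [hP, e.open_source.mem_nhds hx, eventually_contMDiffAt hf,
    eventually_contMDiffAt hg, (e.continuousAt hx).preimage_mem_nhds (Metric.ball_mem_nhds _ hr)]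
    with z hzP hz hfz hgz hzr s κ hs hκ
  have hfz' : ContMDiffAt 𝓘(ℝ, Rn n) 𝓘(ℝ, ℝ) 2 f (e.symm (e z)) := by rwa [e.left_inv hz]
  have hgz' : ContMDiffAt 𝓘(ℝ, Rn n) 𝓘(ℝ, ℝ) 2 g (e.symm (e z)) := by rwa [e.left_inv hz]
  have hsκ : ((s, κ) : ℝ × ℝ) ∈ Metric.closedBall 0 η := by
    rw [mem_closedBall_zero_iff]
    exact max_le hs hκ
  have hmem : ofChart e (e z) (jetF ((fun w => f w + s * g w + κ) ∘ e.symm) (e z)) ∈ O := by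
    have hadd := jetF_add_const_mul_add_const (contDiffAt_comp_symm he (e.map_source hz) hfz')
      (contDiffAt_comp_symm he (e.map_source hz) hgz') s κ
    exact hadd ▸ hball (e z) hzr _ (hPQ hzP (hηQ hsκ))
  rwa [ofChart_jetF he (e.map_source hz) (contMDiffAt_add_const_mul_add_const hfz' hgz' s κ),
    e.left_inv hz] at hmem

end Perturbation

section Envelopes

open Classical in
/-- The function equal to `max a b` on `W` and to `b` elsewhere: the gluing construction of
subsolutions, used where `a < b` near the boundary of `W`. -/
def glue {X : Type*} (W : Set X) (a b : X → ℝ) (x : X) : ℝ := if x ∈ W then max (a x) (b x) else b x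

section Glue

variable {X : Type*} {W C S : Set X} {a b : X → ℝ} {x : X}

theorem glue_of_mem (hx : x ∈ W) : glue W a b x = max (a x) (b x) := if_pos hx

theorem glue_of_notMem (hx : x ∉ W) : glue W a b x = b x := if_neg hx

theorem glue_eq_right (hab : ∀ x ∈ S, x ∈ W → x ∉ C → a x < b x) (hx : x ∈ S) (hxC : x ∉ C) :
    glue W a b x = b x := by
  by_cases hW : x ∈ W
  · rw [glue_of_mem hW, max_eq_right (hab x hx hW hxC).le]
  · exact glue_of_notMem hW

variable [TopologicalSpace X]

theorem upperSemicontinuousOn_glue (hW : IsOpen W) (hC : IsClosed C) (hCW : C ⊆ W)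
    (hab : ∀ x ∈ S, x ∈ W → x ∉ C → a x < b x) (ha : ContinuousOn a W)
    (hb : UpperSemicontinuousOn b S) : UpperSemicontinuousOn (glue W a b) S := by
  intro x hx
  by_cases hxW : x ∈ W
  · have hmax : UpperSemicontinuousWithinAt (fun z => max (a z) (b z)) S x :=
      ((ha.continuousAt (hW.mem_nhds hxW)).upperSemicontinuousAt.upperSemicontinuousWithinAt S).sup
        (hb x hx)
    refine hmax.congr_of_eventuallyEq hx ?_
    filter_upwards [mem_nhdsWithin_of_mem_nhds (hW.mem_nhds hxW)] with z hz
    exact (glue_of_mem hz).symm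
  · refine UpperSemicontinuousWithinAt.congr_of_eventuallyEq (hb x hx) hx ?_
    filter_upwards [mem_nhdsWithin_of_mem_nhds (hC.isOpen_compl.mem_nhds fun h => hxW (hCW h)),
      self_mem_nhdsWithin] with z hz hzS
    exact (glue_eq_right hab hzS hz).symm

end Glue

variable {X : Type*} [TopologicalSpace X] {S : Set X} {f : X → ℝ} {x : X} {c : ℝ}

/-- The upper semicontinuous envelope of `f` relative to `S`; meaningful at points of `S` near which
`f` is bounded above on `S`. -/
def uscEnv (S : Set X) (f : X → ℝ) (x : X) : ℝ := sInf {c | ∀ᶠ z in 𝓝[S] x, f z ≤ c}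

theorem le_uscEnv (hf : BddAbove (f '' S)) (hx : x ∈ S) : f x ≤ uscEnv S f x := by
  obtain ⟨b, hb⟩ := hf
  exact le_csInf ⟨b, eventually_nhdsWithin_of_forall fun z hz => hb ⟨z, hz, rfl⟩⟩
    fun c (hc : ∀ᶠ z in 𝓝[S] x, f z ≤ c) => hc.self_of_nhdsWithin hx

theorem uscEnv_le (hx : x ∈ S) (h : ∀ᶠ z in 𝓝[S] x, f z ≤ c) : uscEnv S f x ≤ c :=
  csInf_le ⟨f x, fun _ hc => hc.self_of_nhdsWithin hx⟩ h

theorem frequently_lt_of_lt_uscEnv (hx : x ∈ S) (h : c < uscEnv S f x) :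
    ∃ᶠ z in 𝓝[S] x, c < f z := fun hcon =>
  (uscEnv_le hx (hcon.mono fun _ => not_lt.1)).not_gt h

theorem upperSemicontinuousOn_uscEnv (hf : BddAbove (f '' S)) :
    UpperSemicontinuousOn (uscEnv S f) S := by
  obtain ⟨b, hb⟩ := hf
  intro x _ c hc
  obtain ⟨c', hc', hlt⟩ := exists_lt_of_csInf_lt
    ⟨b, eventually_nhdsWithin_of_forall fun z hz => hb ⟨z, hz, rfl⟩⟩ hc
  filter_upwards [eventually_eventually_nhdsWithin.2 hc', self_mem_nhdsWithin] with z hz hzS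
  exact (uscEnv_le hzS hz).trans_lt hlt

end Envelopes

namespace ViscAt

variable {n : ℕ} {X : Type*} [TopologicalSpace X] [ChartedSpace (Rn n) X]
  {G : Set (JetBundle n X)} {u v : X → ℝ} {x : X}

theorem congr (hu : ViscAt G u x) (h : u =ᶠ[𝓝 x] v) : ViscAt G v x := by
  intro φ hφ hle heq
  refine hu φ hφ ?_ (h.eq_of_nhds.trans heq)
  filter_upwards [h, hle] with z hz hz'
  rwa [hz]

theorem max (hu : ViscAt G u x) (hv : ViscAt G v x) :
    ViscAt G (fun z => Max.max (u z) (v z)) x := by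
  intro φ hφ hle heq
  rcases max_choice (u x) (v x) with h | h
  · exact hu φ hφ (hle.mono fun z hz => (le_max_left _ _).trans hz) (h ▸ heq)
  · exact hv φ hφ (hle.mono fun z hz => (le_max_right _ _).trans hz) (h ▸ heq)

theorem glue {W C Ω : Set X} {a b : X → ℝ} (hΩ : IsOpen Ω) (hW : IsOpen W) (hC : IsClosed C)
    (hCW : C ⊆ W) (hab : ∀ x ∈ Ω, x ∈ W → x ∉ C → a x < b x)
    (ha : ∀ x ∈ Ω, x ∈ W → ViscAt G a x) (hb : ∀ x ∈ Ω, ViscAt G b x) :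
    ∀ x ∈ Ω, ViscAt G (glue W a b) x := by
  intro x hx
  by_cases hxW : x ∈ W
  · refine ((ha x hx hxW).max (hb x hx)).congr ?_
    filter_upwards [hW.mem_nhds hxW] with z hz
    exact (glue_of_mem hz).symm
  · refine (hb x hx).congr ?_
    filter_upwards [hC.isOpen_compl.mem_nhds fun h => hxW (hCW h), hΩ.mem_nhds hx] with z hz hzΩ
    exact (glue_eq_right hab hzΩ hz).symm

end ViscAt

theorem viscAt_of_contMDiffAt {n : ℕ} {X : Type*} [TopologicalSpace X] [ChartedSpace (Rn n) X]
    [IsManifold 𝓘(ℝ, Rn n) ∞ X] {G : Set (JetBundle n X)} {x : X} (hG : PosNeg (fibre G x))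
    {u : X → ℝ} (hu : ContMDiffAt 𝓘(ℝ, Rn n) 𝓘(ℝ, ℝ) 2 u x) (hj : jetAt n x u ∈ fibre G x) :
    ViscAt G u x := by
  intro φ hφ hle heq
  set e := chartAt (Rn n) x
  have hsymm : e.symm (e x) = x := e.left_inv (mem_chart_source (Rn n) x)
  have hu' : ContMDiffAt 𝓘(ℝ, Rn n) 𝓘(ℝ, ℝ) 2 (fun z => (-1) * u z) x := contMDiffAt_const.mul hu
  have hmin : IsLocalMin ((fun z => φ z + (-1) * u z) ∘ e.symm) (e x) := by
    have htend := (e.continuousAt_symm (mem_chart_target (Rn n) x)).tendsto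
    rw [hsymm] at htend
    filter_upwards [htend.eventually hle] with z hz
    simp only [Function.comp_apply, hsymm]
    linarith
  obtain ⟨A, hA, hjet⟩ := exists_jetF_eq_of_isLocalMin
    (contDiffAt_comp_chartAt_symm (f := fun z => φ z + (-1) * u z) (hφ.add hu'))
    (by simp [heq]) hmin
  rw [← jetAt_eq_jetF, jetAt_add hφ hu', jetAt_const_mul hu, neg_one_smul ℝ (jetAt n x u),
    add_neg_eq_iff_eq_add] at hjet
  rw [hjet, add_comm]
  exact hG.1 _ hj A hA

section MonotoneFor

variable {n : ℕ} {X : Type*} [TopologicalSpace X] [ChartedSpace (Rn n) X]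
  {F M G : Set (JetBundle n X)} {x : X}

/-- The properties, shared by a subequation with monotonicity cone `M` and its dual, on which the
construction of subsolutions rests. -/
structure IsMonotoneFor (M G : Set (JetBundle n X)) : Prop where
  posNeg : ∀ x, PosNeg (fibre G x)
  add_mem : ∀ x, ∀ j ∈ fibre G x, ∀ m ∈ fibre M x, j + m ∈ fibre G x
  exists_interior : ∀ x, ∃ j : Jet n, (⟨x, j⟩ : JetBundle n X) ∈ interior G

theorem IsSubequation.dual_add_mem (hF : IsSubequation F) {j m : Jet n}
    (hm : ∀ k ∈ fibre F x, k + m ∈ fibre F x) (hj : j ∈ fibre (dual F) x) :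
    j + m ∈ fibre (dual F) x := by
  rw [hF.mem_fibre_dual] at hj ⊢
  intro h
  have hmem := add_mem_interior_of_forall hm h
  rw [neg_add, neg_add_cancel_right] at hmem
  exact hj hmem

variable [IsManifold 𝓘(ℝ, Rn n) ∞ X]

theorem neg_mem_interior_dual (hF : IsClosed F) {j : Jet n} (hj : j ∉ fibre F x) :
    (⟨x, -j⟩ : JetBundle n X) ∈ interior (dual F) := by
  have hO : IsOpen (dual Fᶜ)ᶜ := (isClosed_dual Fᶜ).isOpen_compl
  refine mem_interior.2 ⟨_, fun J hJ hJ' => ?_, hO, ?_⟩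
  · rw [dual, hF.isOpen_compl.interior_eq] at hJ
    exact hJ (not_not_intro (interior_subset hJ'))
  · rw [dual, hF.isOpen_compl.interior_eq]
    rw [mem_compl_iff, mem_ofPred_eq, not_not, neg_neg]
    exact hj

variable {F₀ : Set (Jet n)}

theorem fibre_nonempty (hF₀ : F₀.Nonempty) (hjet : LocallyAffinelyJetEquivalent F F₀) (x : X) :
    (fibre F x).Nonempty := by
  obtain ⟨e, he, hx, Ψ, hΨ⟩ := hjet x
  obtain ⟨k, hk⟩ := hF₀
  rw [← hΨ _ (e.map_source hx)] at hk
  obtain ⟨j, hj, -⟩ := hk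
  rw [← e.left_inv hx]
  exact ⟨_, (ofChart_mem_iff he (e.map_source hx) j F).1 hj⟩

theorem exists_notMem_fibre (hF₀ : F₀ ≠ univ) (hjet : LocallyAffinelyJetEquivalent F F₀) (x : X) :
    ∃ j, j ∉ fibre F x := by
  obtain ⟨e, he, hx, Ψ, hΨ⟩ := hjet x
  obtain ⟨k, hk⟩ := (ne_univ_iff_exists_notMem F₀).1 hF₀
  obtain ⟨j, rfl⟩ := Ψ.act_surjective (e x) k
  rw [← e.left_inv hx]
  refine ⟨fibreMap he (e.map_source hx) j, fun hj => hk ?_⟩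
  rw [← hΨ _ (e.map_source hx)]
  exact mem_image_of_mem _ ((ofChart_mem_iff he _ j F).2 hj)

theorem IsMonotonicityCone.isMonotoneFor (hF : IsSubequation F) (hM : IsMonotonicityCone M F)
    (hF₀ : F₀.Nonempty) (hjet : LocallyAffinelyJetEquivalent F F₀) : IsMonotoneFor M F where
  posNeg := hF.posNeg
  add_mem := hM.add_mem
  exists_interior x := by
    have hne := fibre_nonempty hF₀ hjet x
    rwa [hF.fibre_closure_interior x, closure_nonempty_iff, hF.interior_fibre x] at hne

theorem IsMonotonicityCone.isMonotoneFor_dual (hF : IsSubequation F)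
    (hM : IsMonotonicityCone M F) (hF₀ : F₀ ≠ univ)
    (hjet : LocallyAffinelyJetEquivalent F F₀) : IsMonotoneFor M (dual F) where
  posNeg x := ⟨fun _ hj A hA => hF.dual_add_mem (fun k hk => (hF.posNeg x).1 k hk A hA) hj,
    fun _ hj r hr => hF.dual_add_mem (fun k hk => (hF.posNeg x).2 k hk r hr) hj⟩
  add_mem x _ hj m hm := hF.dual_add_mem (fun k hk => hM.add_mem x k hk m hm) hj
  exists_interior x := by
    obtain ⟨k, hk⟩ := exists_notMem_fibre hF₀ hjet x
    exact ⟨-k, neg_mem_interior_dual hF.isClosed hk⟩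

variable {ψ : X → ℝ}

theorem eventually_smul_jetAt_mem (hM : IsMonotonicityCone M F) (hG : IsMonotoneFor M G)
    (hψ : IsStrictlySubharmonic M ψ) (x : X) :
    ∀ᶠ p : ℝ × X in atTop ×ˢ 𝓝 x, p.1 • jetAt n p.2 ψ ∈ fibre G p.2 := by
  set e := chartAt (Rn n) x
  have he : e ∈ IsManifold.maximalAtlas 𝓘(ℝ, Rn n) ∞ X := IsManifold.chart_mem_maximalAtlas x
  have hx : x ∈ e.source := mem_chart_source (Rn n) x
  have hy : e x ∈ e.target := e.map_source hx
  obtain ⟨j, hj⟩ := hG.exists_interior (e.symm (e x))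
  obtain ⟨j, rfl⟩ := fibreMap_surjective he hy j
  rw [← ofChart_eq he hy] at hj
  obtain ⟨r, hr, -, hball⟩ := exists_ball_ofChart_mem he isOpen_interior hy hj
  obtain ⟨r', hr', -, hcone⟩ := exists_ball_ofChart_mem_cone hM hψ he hy
  have hjetF : ∀ᶠ y in 𝓝 (e x), ‖jetF (ψ ∘ e.symm) y - jetF (ψ ∘ e.symm) (e x)‖ < r' / 2 := by
    have hcont := continuousAt_jetF (contDiffAt_comp_symm he hy (f := ψ) hψ.1.contMDiffAt)
    simpa only [dist_eq_norm] using Metric.tendsto_nhds.1 hcont (r' / 2) (by positivity)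
  have hnear := (e.continuousAt hx).eventually
    (hjetF.and (inter_mem (Metric.ball_mem_nhds (e x) hr) (Metric.ball_mem_nhds (e x) hr')))
  filter_upwards [(eventually_ge_atTop (2 * ‖j‖ / r' + 1)).prod_mk
    (hnear.and (e.open_source.mem_nhds hx))]
  rintro ⟨t, z⟩ ⟨ht, ⟨hjz, hzr, hzr'⟩, hz⟩
  have hzt : e z ∈ e.target := e.map_source hz
  have ht0 : 0 < t := lt_of_lt_of_le (by positivity) ht
  have hjt : ‖j‖ < t * (r' / 2) := by
    have hlt : 2 * ‖j‖ / r' < t := by linarith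
    rw [div_lt_iff₀ hr'] at hlt
    linarith
  have hm : ofChart e (e z) (t • jetF (ψ ∘ e.symm) (e z) - j) ∈ M := by
    refine hcone _ hzr' t ht0 _ ?_
    rw [sub_right_comm, ← smul_sub t (jetF (ψ ∘ e.symm) (e z))]
    refine (norm_sub_le _ _).trans_lt ?_
    rw [norm_smul, Real.norm_of_nonneg ht0.le]
    linarith [mul_lt_mul_of_pos_left hjz ht0]
  have hjG : ofChart e (e z) j ∈ G := interior_subset (hball _ hzr j (by simpa using hr))
  rw [ofChart_mem_iff he hzt] at hm hjG
  have hsum := hG.add_mem _ _ hjG _ hm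
  have hjet := ofChart_jetF he hzt (f := ψ) hψ.1.contMDiffAt
  rw [ofChart_eq he hzt, JetBundle.mk.injEq] at hjet
  rwa [← map_add, add_sub_cancel, map_smul, hjet.2, e.left_inv hz] at hsum

theorem eventually_forall_smul_jetAt_mem (hM : IsMonotonicityCone M F) (hG : IsMonotoneFor M G)
    (hψ : IsStrictlySubharmonic M ψ) {K : Set X} (hK : IsCompact K) :
    ∀ᶠ t : ℝ in atTop, ∀ z ∈ K, t • jetAt n z ψ ∈ fibre G z :=
  (Filter.Eventually.curry (hK.mem_prod_nhdsSet_of_forall fun x _ =>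
    eventually_smul_jetAt_mem hM hG hψ x)).mono fun _ h => h.self_of_nhdsSet

end MonotoneFor

section PerronClass

variable {n : ℕ} {X : Type*} [TopologicalSpace X] [ChartedSpace (Rn n) X]
  {G : Set (JetBundle n X)} {Ω : Set X} {φ : X → ℝ}

/-- The Perron family for the boundary values `φ`: the upper semicontinuous functions on `closure Ω`
that are `G`-subharmonic on `Ω` and at most `φ` on the boundary. -/
def perronClass (G : Set (JetBundle n X)) (Ω : Set X) (φ : X → ℝ) : Set (X → ℝ) :=
  {u | UpperSemicontinuousOn u (closure Ω) ∧ (∀ x ∈ Ω, ViscAt G u x) ∧ ∀ x ∈ frontier Ω, u x ≤ φ x}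

/-- Existence of barriers from below: at each boundary point the members of the Perron family come
arbitrarily close to `φ`. -/
def HasBarriers (G : Set (JetBundle n X)) (Ω : Set X) (φ : X → ℝ) : Prop :=
  ∀ x ∈ frontier Ω, ∀ c < φ x, ∃ w ∈ perronClass G Ω φ, ∀ᶠ z in 𝓝[closure Ω] x, c < w z

theorem glue_mem_perronClass (hΩ : IsOpen Ω) {W C : Set X} {a b : X → ℝ} (hW : IsOpen W)
    (hC : IsClosed C) (hCW : C ⊆ W) (hab : ∀ x ∈ closure Ω, x ∈ W → x ∉ C → a x < b x)
    (ha : ContinuousOn a W) (haG : ∀ x ∈ Ω, x ∈ W → ViscAt G a x)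
    (haφ : ∀ x ∈ frontier Ω, x ∈ W → a x ≤ φ x) (hb : b ∈ perronClass G Ω φ) :
    glue W a b ∈ perronClass G Ω φ := by
  refine ⟨upperSemicontinuousOn_glue hW hC hCW hab ha hb.1,
    ViscAt.glue hΩ hW hC hCW (fun x hx => hab x (subset_closure hx)) haG hb.2.1, fun x hx => ?_⟩
  by_cases hxW : x ∈ W
  · rw [glue_of_mem hxW]
    exact max_le (haφ x hx hxW) (hb.2.2 x hx)
  · rw [glue_of_notMem hxW]
    exact hb.2.2 x hx

variable [IsManifold 𝓘(ℝ, Rn n) ∞ X]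

theorem exists_mem_perronClass_bddBelow {F M : Set (JetBundle n X)} (hM : IsMonotonicityCone M F)
    (hG : IsMonotoneFor M G) {ψ : X → ℝ} (hψ : IsStrictlySubharmonic M ψ)
    (hΩc : IsCompact (closure Ω)) (hφ : BddBelow (φ '' frontier Ω)) :
    ∃ w ∈ perronClass G Ω φ, BddBelow (w '' closure Ω) := by
  obtain ⟨t, ht, ht0⟩ := ((eventually_forall_smul_jetAt_mem hM hG hψ hΩc).and
    (eventually_ge_atTop 0)).exists
  obtain ⟨b, hb⟩ := hΩc.bddAbove_image hψ.1.continuous.continuousOn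
  obtain ⟨c, hc⟩ := hφ
  set s := -max (t * b - c) 0
  have hsmooth : ∀ x, ContMDiffAt 𝓘(ℝ, Rn n) 𝓘(ℝ, ℝ) 2 (fun z => t * ψ z) x := fun x =>
    contMDiffAt_const.mul hψ.1.contMDiffAt
  have hcont : Continuous fun z => t * ψ z + s := (hψ.1.continuous.const_mul t).add_const s
  refine ⟨_, ⟨hcont.upperSemicontinuous.upperSemicontinuousOn _, fun x hx => ?_, fun x hx => ?_⟩,
    hΩc.bddBelow_image hcont.continuousOn⟩
  · refine viscAt_of_contMDiffAt (hG.posNeg x) ((hsmooth x).add contMDiffAt_const) ?_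
    rw [jetAt_add_const (hsmooth x), jetAt_const_mul hψ.1.contMDiffAt]
    exact (hG.posNeg x).2 _ (ht x (subset_closure hx)) _ (neg_nonpos.2 (le_max_right _ _))
  · have hψb : t * ψ x ≤ t * b :=
      mul_le_mul_of_nonneg_left (hb (mem_image_of_mem ψ (frontier_subset_closure hx))) ht0
    have hcφ : c ≤ φ x := hc (mem_image_of_mem φ hx)
    linarith [neg_le_neg (le_max_left (t * b - c) 0)]

end PerronClass

section Barriers

variable {n : ℕ} {X : Type*} [TopologicalSpace X] [ChartedSpace (Rn n) X] {Ω U : Set X} {ρ : X → ℝ}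

theorem IsDefiningFunction.nonpos_of_mem_closure (hρ : IsDefiningFunction n Ω U ρ) {z : X}
    (hzU : z ∈ U) (hz : z ∈ closure Ω) : ρ z ≤ 0 := by
  by_cases hzΩ : z ∈ Ω
  · exact (hρ.neg z hzU hzΩ).le
  · exact ((hρ.frontier_iff z hzU).1 ⟨hz, fun h => hzΩ (interior_subset h)⟩).le

theorem exists_isOpen_of_mem_asymptoticInterior {H : Set (RedJetBundle n X)}
    {J : RedJetBundle n X} (hJ : J ∈ asymptoticInterior H) :
    ∃ O : Set (JetBundle n X), IsOpen O ∧ ⟨J.base, (0, J.fib)⟩ ∈ O ∧ ∃ t₀ > (0 : ℝ), ∀ t ≥ t₀,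
      ∀ z j, (⟨z, (0, j)⟩ : JetBundle n X) ∈ O → (⟨z, t • j⟩ : RedJetBundle n X) ∈ H := by
  obtain ⟨N, hN, t₀, ht₀, ht⟩ := hJ
  obtain ⟨N', hN', hNN'⟩ := (mem_nhds_induced _ _ _).1 hN
  obtain ⟨O, hON', hO, hJO⟩ := mem_nhds_iff.1 hN'
  exact ⟨O, hO, hJO, t₀, ht₀, fun t htt₀ z j hj => ht t htt₀ ⟨z, j⟩ (hNN' (hON' hj))⟩

variable [IsManifold 𝓘(ℝ, Rn n) ∞ X] {G : Set (JetBundle n X)} {x : X} {l : ℝ}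

theorem StrictlyConvexAtRed.exists_peak (hG : ∀ z, PosNeg (fibre G z))
    (h : StrictlyConvexAtRed (slice G l) Ω x) (hx : x ∈ frontier Ω) :
    ∃ q : X → ℝ, ∃ η > 0, ∃ t₀ > (0 : ℝ), q x = 0 ∧ ∀ᶠ z in 𝓝 x,
      ContMDiffAt 𝓘(ℝ, Rn n) 𝓘(ℝ, ℝ) 2 q z ∧ (z ∈ closure Ω → q z ≤ -η * chartSq n x z) ∧
      ∀ t ≥ t₀, ∀ c ≤ l, ((c, t • (jetAt n z q).2) : Jet n) ∈ fibre G z := by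
  obtain ⟨U, ρ, hxU, hρ, hρJ⟩ := h
  obtain ⟨O, hO, hJO, t₀, ht₀, ht⟩ := exists_isOpen_of_mem_asymptoticInterior (hρJ x hxU)
  have hρ0 : ρ x = 0 := (hρ.frontier_iff x hxU).1 hx
  have hρO : (⟨x, jetAt n x ρ⟩ : JetBundle n X) ∈ O := by
    rwa [show jetAt n x ρ = (0, (jetAt n x ρ).2) from Prod.ext hρ0 rfl]
  have hρs : ∀ z ∈ U, ContMDiffAt 𝓘(ℝ, Rn n) 𝓘(ℝ, ℝ) 2 ρ z := fun z hz =>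
    (hρ.smooth.contMDiffAt (hρ.isOpen.mem_nhds hz)).of_le (by norm_cast)
  have hxs : x ∈ (chartAt (Rn n) x).source := mem_chart_source (Rn n) x
  obtain ⟨η, hη, hpert⟩ := exists_pos_eventually_jetAt_add_mem (hρs x hxU)
    (contMDiffAt_chartSq hxs) hO hρO
  set q : X → ℝ := fun z => ρ z + -η * chartSq n x z
  have hqs : ∀ z ∈ U, z ∈ (chartAt (Rn n) x).source → ContMDiffAt 𝓘(ℝ, Rn n) 𝓘(ℝ, ℝ) 2 q z :=
    fun z hz hz' => (hρs z hz).add (contMDiffAt_const.mul (contMDiffAt_chartSq hz'))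
  have hq0 : q x = 0 := by simp [q, hρ0, chartSq_self]
  have hqη : ∀ᶠ z in 𝓝 x, |q z| < η :=
    (hqs x hxU hxs).continuousAt.abs.eventually (gt_mem_nhds (by simpa [hq0]))
  refine ⟨q, η, hη, t₀, ht₀, hq0, ?_⟩
  filter_upwards [hpert, hqη, hρ.isOpen.mem_nhds hxU,
    (chartAt (Rn n) x).open_source.mem_nhds hxs] with z hz hzη hzU hzs
  have hqz := hqs z hzU hzs
  refine ⟨hqz, fun hzΩ => ?_, fun t htt₀ c hc => ?_⟩
  · exact add_le_of_nonpos_left (hρ.nonpos_of_mem_closure hzU hzΩ)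
  · have hmem : (⟨z, (0, (jetAt n z q).2)⟩ : JetBundle n X) ∈ O := by
      have hsub := hz (-η) (-q z) (by rw [abs_neg, abs_of_pos hη]) (by rw [abs_neg]; exact hzη.le)
      rwa [jetAt_add_const (f := q) hqz,
        show jetAt n z q + (-q z, 0, 0) = (0, (jetAt n z q).2) from
          Prod.ext (add_neg_cancel (q z)) (add_zero _)] at hsub
    have hfib := (hG z).2 _ (ht t htt₀ z _ hmem) (c - l) (sub_nonpos.2 hc)
    convert hfib using 1
    exact Prod.ext (add_sub_cancel l c).symm (add_zero _).symm

theorem StrictlyConvexAtRed.exists_viscAt_peak (hG : ∀ z, PosNeg (fibre G z))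
    (h : StrictlyConvexAtRed (slice G l) Ω x) (hx : x ∈ frontier Ω) :
    ∃ q : X → ℝ, ∃ η > 0, ∃ t₀ > (0 : ℝ), q x = 0 ∧ ∀ᶠ z in 𝓝 x, ContinuousAt q z ∧
      (z ∈ closure Ω → q z ≤ -η * chartSq n x z ∧
        ∀ t ≥ t₀, ∀ c ≤ l, ViscAt G (fun w => t * q w + c) z) := by
  obtain ⟨q, η, hη, t₀, ht₀, hq0, hq⟩ := h.exists_peak hG hx
  refine ⟨q, η, hη, t₀, ht₀, hq0, hq.mono fun z ⟨hqz, hle, hmem⟩ =>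
    ⟨hqz.continuousAt, fun hzΩ => ⟨hle hzΩ, fun t ht c hc => ?_⟩⟩⟩
  have htq : ContMDiffAt 𝓘(ℝ, Rn n) 𝓘(ℝ, ℝ) 2 (fun w => t * q w) z := contMDiffAt_const.mul hqz
  refine viscAt_of_contMDiffAt (hG z) (htq.add contMDiffAt_const) ?_
  have hq0 : q z ≤ 0 := (hle hzΩ).trans
    (mul_nonpos_of_nonpos_of_nonneg (neg_nonpos.2 hη.le) (chartSq_nonneg x z))
  have htq0 : t * q z ≤ 0 := mul_nonpos_of_nonneg_of_nonpos (ht₀.le.trans ht) hq0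
  rw [jetAt_add_const htq, jetAt_const_mul hqz]
  convert hmem t ht (t * q z + c) (by linarith) using 1
  exact Prod.ext rfl (add_zero _)

theorem StrictlyConvexBoundary.hasBarriers [T2Space X] (hG : ∀ z, PosNeg (fibre G z))
    (hΩ : IsOpen Ω) (hconv : StrictlyConvexBoundary G Ω) {φ : X → ℝ}
    (hφ : ContinuousOn φ (frontier Ω)) {w₀ : X → ℝ} (hw₀ : w₀ ∈ perronClass G Ω φ)
    (hw₀b : BddBelow (w₀ '' closure Ω)) : HasBarriers G Ω φ := by
  intro x hx c hc
  obtain ⟨c', hcc', hc'φ⟩ := exists_between hc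
  obtain ⟨m, hm⟩ := hw₀b
  obtain ⟨q, η, hη, t₀, ht₀, hq0, hq⟩ := (hconv x hx (φ x)).exists_viscAt_peak hG hx
  have hφc' : ∀ᶠ z in 𝓝 x, z ∈ frontier Ω → c' < φ z :=
    eventually_nhdsWithin_iff.1 ((hφ x hx).eventually (lt_mem_nhds hc'φ))
  obtain ⟨R, hR, hRc, hRsub⟩ := exists_chartDisc_subset (n := n) (hq.and hφc')
  have hBD := chartBall_subset_chartDisc (n := n) x R
  set d := η * (R / 2) ^ 2
  have hd : 0 < d := by positivity
  set t := max t₀ ((c' - m) / d)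
  have ht0 : 0 < t := lt_max_of_lt_left ht₀
  have htd : c' - m ≤ t * d := (div_le_iff₀ hd).1 (le_max_right _ _)
  set w : X → ℝ := fun z => t * q z + c'
  have hw : ∀ z ∈ chartBall n x R, ContinuousAt w z := fun z hz =>
    ((hRsub (hBD hz)).1.1.const_mul t).add_const c'
  have hxB : chartBall n x R ∈ 𝓝 x := chartBall_mem_nhds x hR
  have hwφ : ∀ z ∈ frontier Ω, z ∈ chartBall n x R → w z ≤ φ z := by
    intro z hz hzB
    have hqz := ((hRsub (hBD hzB)).1.2 (frontier_subset_closure hz)).1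
    have hq0 : t * q z ≤ 0 := mul_nonpos_of_nonneg_of_nonpos ht0.le
      (hqz.trans (mul_nonpos_of_nonpos_of_nonneg (neg_nonpos.2 hη.le) (chartSq_nonneg x z)))
    linarith [(hRsub (hBD hzB)).2 hz]
  have hab : ∀ z ∈ closure Ω, z ∈ chartBall n x R → z ∉ chartDisc n x (R / 2) → w z < w₀ z := by
    intro z hzΩ hzB hzC
    have hsq := sq_lt_chartSq_of_notMem_chartDisc (by positivity) hzB.1 hzC
    have hdsq : d < η * chartSq n x z := mul_lt_mul_of_pos_left hsq hη
    have hqd : q z < -d := by linarith [((hRsub (hBD hzB)).1.2 hzΩ).1]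
    linarith [mul_lt_mul_of_pos_left hqd ht0, hm (mem_image_of_mem w₀ hzΩ)]
  refine ⟨glue (chartBall n x R) w w₀, glue_mem_perronClass hΩ (isOpen_chartBall x R)
    (hRc _ (by linarith)).isClosed (chartDisc_subset_chartBall x (by linarith)) hab
    (fun z hz => (hw z hz).continuousWithinAt) (fun z hz hzB => ?_) hwφ hw₀, ?_⟩
  · exact ((hRsub (hBD hzB)).1.2 (subset_closure hz)).2 t (le_max_left _ _) c' hc'φ.le
  · have hcw : ∀ᶠ z in 𝓝 x, c < w z :=
      (hw x (mem_of_mem_nhds hxB)).eventually (lt_mem_nhds (by simpa [w, hq0]))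
    refine mem_nhdsWithin_of_mem_nhds ?_
    filter_upwards [hcw, hxB] with z hz hzB
    rw [glue_of_mem hzB]
    exact hz.trans_le (le_max_left _ _)

end Barriers

section Perron

variable {n : ℕ} {X : Type*} [TopologicalSpace X] [ChartedSpace (Rn n) X] {x : X}

theorem exists_touching_add_chartSq {u f : X → ℝ} {z₀ : X} {R η δ : ℝ} (hR : 0 ≤ R) (hη : 0 < η)
    (hc : IsCompact (chartDisc n x R)) (hu : UpperSemicontinuousOn u (chartDisc n x R))
    (hf : ContinuousOn f (chartDisc n x R)) (huf : ∀ z ∈ chartDisc n x R, u z ≤ f z)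
    (hδ : δ ≤ η * R ^ 2) (hz₀ : z₀ ∈ chartDisc n x R)
    (h : f z₀ + η * chartSq n x z₀ - δ < u z₀) :
    ∃ z ∈ chartBall n x R, ∃ κ, |κ| ≤ δ ∧ u z = f z + η * chartSq n x z + κ ∧
      ∀ᶠ w in 𝓝 z, u w ≤ f w + η * chartSq n x w + κ := by
  have hsq : ContinuousOn (chartSq n x) (chartDisc n x R) :=
    (((chartAt (Rn n) x).continuousOn.mono inter_subset_left).sub continuousOn_const).norm.pow 2
  obtain ⟨z, hz, hmax⟩ := UpperSemicontinuousOn.exists_isMaxOn ⟨z₀, hz₀⟩ hc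
    (f := fun z => u z + -(f z + η * chartSq n x z))
    (hu.add (hf.add (hsq.const_smul η)).neg.upperSemicontinuousOn)
  set κ := u z + -(f z + η * chartSq n x z) with hκ
  have hκδ : -δ < κ := by
    have hle : u z₀ + -(f z₀ + η * chartSq n x z₀) ≤ κ := hmax hz₀
    linarith
  have huz := huf z hz
  have hsq0 := mul_nonneg hη.le (chartSq_nonneg (n := n) x z)
  have hzB : z ∈ chartBall n x R := mem_chartBall_of_chartSq_lt hR hz.1
    (lt_of_mul_lt_mul_left (by linarith) hη.le)
  refine ⟨z, hzB, κ, abs_le.2 ⟨hκδ.le, by linarith⟩, by rw [hκ]; ring, ?_⟩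
  filter_upwards [(isOpen_chartBall x R).mem_nhds hzB] with w hw
  have hle : u w + -(f w + η * chartSq n x w) ≤ κ := hmax (chartBall_subset_chartDisc x R hw)
  linarith

variable [IsManifold 𝓘(ℝ, Rn n) ∞ X] {Ω : Set X}

theorem viscAt_uscEnv_iSup {G : Set (JetBundle n X)} (hG : IsClosed G) {S : Set X}
    (hΩ : IsOpen Ω) (hΩS : Ω ⊆ S) {ι : Type*} [Nonempty ι] {v : ι → X → ℝ}
    (husc : ∀ i, UpperSemicontinuousOn (v i) S) (hvisc : ∀ i, ∀ x ∈ Ω, ViscAt G (v i) x)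
    {b : ℝ} (hb : ∀ i, ∀ x ∈ S, v i x ≤ b) :
    ∀ x ∈ Ω, ViscAt G (uscEnv S fun z => ⨆ i, v i z) x := by
  intro x hx φ hφ hle heq
  set U : X → ℝ := fun z => ⨆ i, v i z
  have hvU : ∀ i, ∀ z ∈ S, v i z ≤ uscEnv S U z := fun i z hz =>
    (le_ciSup (f := fun i => v i z) ⟨b, forall_mem_range.2 fun i => hb i z hz⟩ i).trans
      (le_uscEnv ⟨b, forall_mem_image.2 fun z hz => ciSup_le fun i => hb i z hz⟩ hz)
  by_contra hcon
  have hxs : x ∈ (chartAt (Rn n) x).source := mem_chart_source (Rn n) x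
  obtain ⟨η, hη, hpert⟩ := exists_pos_eventually_jetAt_add_mem hφ (contMDiffAt_chartSq hxs)
    hG.isOpen_compl hcon
  obtain ⟨R, hR, hRc, hRsub⟩ := exists_chartDisc_subset (n := n)
    (((hpert.and (eventually_contMDiffAt hφ)).and hle).and (hΩ.eventually_mem hx))
  set δ := min η (η * R ^ 2)
  have hδ : 0 < δ := lt_min hη (by positivity)
  have hφx : ∀ᶠ z in 𝓝 x, φ z + η * chartSq n x z - δ < φ x - δ / 2 := by
    refine ((hφ.continuousAt.add ((contMDiffAt_chartSq hxs).continuousAt.const_mul η)).sub_const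
      δ).eventually (gt_mem_nhds ?_)
    change φ x + η * chartSq n x x - δ < φ x - δ / 2
    rw [chartSq_self]
    linarith
  obtain ⟨z₀, hz₀, hφz₀, hz₀B⟩ := ((frequently_lt_of_lt_uscEnv (hΩS hx)
    (show φ x - δ / 2 < uscEnv S U x by linarith)).and_eventually (mem_nhdsWithin_of_mem_nhds
      (hφx.and (chartBall_mem_nhds (n := n) x hR)))).exists
  obtain ⟨i, hi⟩ := exists_lt_of_lt_ciSup hz₀
  obtain ⟨z, hz, κ, hκ, htouch, hle'⟩ := exists_touching_add_chartSq hR.le hη (hRc R le_rfl)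
    ((husc i).mono fun z hz => hΩS (hRsub hz).2)
    (fun z hz => (hRsub hz).1.1.2.continuousAt.continuousWithinAt)
    (fun z hz => (hvU i z (hΩS (hRsub hz).2)).trans (hRsub hz).1.2) (min_le_right _ _)
    (chartBall_subset_chartDisc x R hz₀B) (hφz₀.trans hi)
  have hzD := hRsub (chartBall_subset_chartDisc x R hz)
  exact hzD.1.1.1 η κ (abs_of_pos hη).le (hκ.trans (min_le_left _ _)) (hvisc i z hzD.2 _
    (contMDiffAt_add_const_mul_add_const hzD.1.1.2 (contMDiffAt_chartSq hz.1) η κ) hle' htouch)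

theorem exists_viscAt_bump [T2Space X] {F : Set (JetBundle n X)} (hF : ∀ z, PosNeg (fibre F z))
    {g : X → ℝ} (hg : ContMDiffAt 𝓘(ℝ, Rn n) 𝓘(ℝ, ℝ) 2 g x)
    (hj : (⟨x, jetAt n x g⟩ : JetBundle n X) ∈ interior F) {N : Set X} (hN : N ∈ 𝓝 x) :
    ∃ (W C : Set X) (w : X → ℝ), IsOpen W ∧ IsClosed C ∧ C ⊆ W ∧ W ⊆ N ∧ x ∈ W ∧
      ContinuousOn w W ∧ (∀ z ∈ W, ViscAt F w z) ∧ (∀ z ∈ W, z ∉ C → w z < g z) ∧ g x < w x := by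
  obtain ⟨η, hη, hpert⟩ := exists_pos_eventually_jetAt_add_mem hg
    (contMDiffAt_chartSq (mem_chart_source (Rn n) x)) isOpen_interior hj
  obtain ⟨R, hR, hRc, hRsub⟩ := exists_chartDisc_subset (n := n)
    ((hpert.and (eventually_contMDiffAt hg)).and hN)
  have hBD := chartBall_subset_chartDisc (n := n) x R
  set δ := min η (η * (R / 2) ^ 2)
  have hδ : 0 < δ := lt_min hη (by positivity)
  set w : X → ℝ := fun z => g z + (-η) * chartSq n x z + δ
  have hw : ∀ z ∈ chartBall n x R, ContMDiffAt 𝓘(ℝ, Rn n) 𝓘(ℝ, ℝ) 2 w z := fun z hz =>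
    contMDiffAt_add_const_mul_add_const (hRsub (hBD hz)).1.2 (contMDiffAt_chartSq hz.1) (-η) δ
  refine ⟨chartBall n x R, chartDisc n x (R / 2), w, isOpen_chartBall x R,
    (hRc _ (by linarith)).isClosed, chartDisc_subset_chartBall x (by linarith),
    fun z hz => (hRsub (hBD hz)).2, mem_of_mem_nhds (chartBall_mem_nhds x hR),
    fun z hz => (hw z hz).continuousAt.continuousWithinAt, fun z hz => ?_, fun z hzB hzC => ?_, ?_⟩
  · exact viscAt_of_contMDiffAt (hF z) (hw z hz) (interior_subset (s := F)
      ((hRsub (hBD hz)).1.1 (-η) δ (by rw [abs_neg, abs_of_pos hη])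
        (by rw [abs_of_pos hδ]; exact min_le_left _ _)))
  · have hsq := mul_lt_mul_of_pos_left
      (sq_lt_chartSq_of_notMem_chartDisc (by positivity) hzB.1 hzC) hη
    have hδle : δ ≤ η * (R / 2) ^ 2 := min_le_right _ _
    simp only [w]
    linarith
  · simp only [w, chartSq_self]
    linarith

theorem viscAt_dual_uscEnv_neg [T2Space X] {F : Set (JetBundle n X)} (hF : IsSubequation F)
    (hΩ : IsOpen Ω) {φ U : X → ℝ} (hU : U ∈ perronClass F Ω φ)
    (hmax : ∀ v ∈ perronClass F Ω φ, ∀ z ∈ closure Ω, v z ≤ U z)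
    (hUb : BddAbove ((-U) '' closure Ω)) :
    ∀ x ∈ Ω, ViscAt (dual F) (uscEnv (closure Ω) (-U)) x := by
  intro x hx θ hθ hle heq
  rw [hF.mem_fibre_dual, hF.interior_fibre]
  intro hcon
  obtain ⟨W, C, w, hW, hC, hCW, hWN, hxW, hwc, hwF, hab, hwx⟩ := exists_viscAt_bump hF.posNeg
    (g := fun z => (-1) * θ z) (contMDiffAt_const.mul hθ)
    (by rwa [jetAt_const_mul hθ, neg_one_smul ℝ (jetAt n x θ)])
    (hle.and (hΩ.eventually_mem hx))
  have hab' : ∀ z ∈ closure Ω, z ∈ W → z ∉ C → w z < U z := fun z hz hzW hzC => by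
    linarith [hab z hzW hzC, (le_uscEnv hUb hz).trans (hWN hzW).1,
      Pi.neg_apply U z]
  have hglue := hmax (glue W w U) (glue_mem_perronClass hΩ hW hC hCW hab' hwc (fun z _ => hwF z)
    (fun z hz hzW => (hz.2 (hΩ.interior_eq.symm ▸ (hWN hzW).2)).elim) hU)
  obtain ⟨c, hθc, hcw⟩ := exists_between hwx
  obtain ⟨z, hz, hwz, hzW⟩ := ((frequently_lt_of_lt_uscEnv (subset_closure hx)
    (show -c < uscEnv (closure Ω) (-U) x by linarith)).and_eventually
      (mem_nhdsWithin_of_mem_nhds (((hwc.continuousAt (hW.mem_nhds hxW)).eventually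
        (lt_mem_nhds hcw)).and (hW.mem_nhds hxW)))).exists
  have hwU : w z ≤ U z := (le_max_left _ _).trans
    (glue_of_mem (a := w) hzW ▸ hglue z (subset_closure (hWN hzW).2))
  rw [Pi.neg_apply] at hz
  linarith

end Perron

section PerronFunction

variable {n : ℕ} {X : Type*} [TopologicalSpace X] [ChartedSpace (Rn n) X]
  {F G : Set (JetBundle n X)} {Ω : Set X} {φ u v : X → ℝ} {b : ℝ} {x : X}

/-- The Perron function: the upper semicontinuous envelope on `closure Ω` of the supremum of the
Perron family. -/
def perronFun (G : Set (JetBundle n X)) (Ω : Set X) (φ : X → ℝ) : X → ℝ :=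
  uscEnv (closure Ω) fun z => ⨆ u : perronClass G Ω φ, u.1 z

theorem bddAbove_image_iSup_perronClass (hne : (perronClass G Ω φ).Nonempty)
    (hb : ∀ u ∈ perronClass G Ω φ, ∀ x ∈ closure Ω, u x ≤ b) :
    BddAbove ((fun z => ⨆ u : perronClass G Ω φ, u.1 z) '' closure Ω) :=
  have := hne.to_subtype
  ⟨b, forall_mem_image.2 fun z hz => ciSup_le fun u => hb u.1 u.2 z hz⟩

theorem le_perronFun (hb : ∀ u ∈ perronClass G Ω φ, ∀ x ∈ closure Ω, u x ≤ b)
    (hu : u ∈ perronClass G Ω φ) (hx : x ∈ closure Ω) : u x ≤ perronFun G Ω φ x :=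
  (le_ciSup (f := fun u : perronClass G Ω φ => u.1 x)
    ⟨b, forall_mem_range.2 fun v => hb v.1 v.2 x hx⟩ ⟨u, hu⟩).trans
    (le_uscEnv (bddAbove_image_iSup_perronClass ⟨u, hu⟩ hb) hx)

theorem HasBarriers.perronFun_le (hbar : HasBarriers F Ω (-φ)) (hne : (perronClass G Ω φ).Nonempty)
    (hcomp : ∀ u ∈ perronClass G Ω φ, ∀ v ∈ perronClass F Ω (-φ), ∀ x ∈ closure Ω, u x + v x ≤ 0)
    (hx : x ∈ frontier Ω) : perronFun G Ω φ x ≤ φ x := by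
  have := hne.to_subtype
  refine le_of_forall_gt_imp_ge_of_dense fun c hc => ?_
  obtain ⟨v, hv, hvx⟩ := hbar x hx (-c) (neg_lt_neg hc)
  refine uscEnv_le (frontier_subset_closure hx) ?_
  filter_upwards [hvx, self_mem_nhdsWithin] with z hz hzΩ
  exact ciSup_le fun u => by linarith [hcomp u.1 u.2 v hv z hzΩ]

theorem HasBarriers.uscEnv_neg_le (hbar : HasBarriers G Ω φ)
    (hu : ∀ w ∈ perronClass G Ω φ, ∀ x ∈ closure Ω, w x ≤ u x) (hx : x ∈ frontier Ω) :
    uscEnv (closure Ω) (-u) x ≤ -φ x := by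
  refine le_of_forall_gt_imp_ge_of_dense fun c hc => ?_
  obtain ⟨w, hw, hwx⟩ := hbar x hx (-c) (neg_lt.1 hc)
  refine uscEnv_le (frontier_subset_closure hx) ?_
  filter_upwards [hwx, self_mem_nhdsWithin] with z hz hzΩ
  rw [Pi.neg_apply]
  linarith [hu w hw z hzΩ]

theorem continuousOn_of_upperSemicontinuousOn_neg {Y : Type*} [TopologicalSpace Y] {S : Set Y}
    {f : Y → ℝ} (hf : UpperSemicontinuousOn f S) (hf' : UpperSemicontinuousOn (-f) S) :
    ContinuousOn f S := by
  refine continuousOn_iff_lower_upperSemicontinuousOn.2 ⟨fun y hy c hc => ?_, hf⟩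
  filter_upwards [hf' y hy (-c) (neg_lt_neg hc)] with z hz
  exact neg_lt_neg_iff.1 hz

variable [IsManifold 𝓘(ℝ, Rn n) ∞ X]

theorem perronFun_mem_perronClass (hG : IsClosed G) (hΩ : IsOpen Ω)
    (hne : (perronClass G Ω φ).Nonempty)
    (hb : ∀ u ∈ perronClass G Ω φ, ∀ x ∈ closure Ω, u x ≤ b)
    (hφ : ∀ x ∈ frontier Ω, perronFun G Ω φ x ≤ φ x) :
    perronFun G Ω φ ∈ perronClass G Ω φ := by
  have := hne.to_subtype
  exact ⟨upperSemicontinuousOn_uscEnv (bddAbove_image_iSup_perronClass hne hb),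
    viscAt_uscEnv_iSup hG hΩ subset_closure (fun u => u.2.1) (fun u => u.2.2.1)
      fun u => hb u.1 u.2, hφ⟩

theorem exists_continuousOn_mem_perronClass_neg_mem [T2Space X] (hF : IsSubequation F)
    (hΩ : IsOpen Ω) (hcomp : ∀ u ∈ perronClass F Ω φ, ∀ v ∈ perronClass (dual F) Ω (-φ),
      ∀ x ∈ closure Ω, u x + v x ≤ 0)
    (hbar : HasBarriers F Ω φ) (hbar' : HasBarriers (dual F) Ω (-φ))
    (hu : u ∈ perronClass F Ω φ) (hub : BddBelow (u '' closure Ω))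
    (hv : v ∈ perronClass (dual F) Ω (-φ)) (hvb : BddBelow (v '' closure Ω)) :
    ∃ U ∈ perronClass F Ω φ, -U ∈ perronClass (dual F) Ω (-φ) ∧ ContinuousOn U (closure Ω) := by
  obtain ⟨m, hm⟩ := hub
  obtain ⟨m', hm'⟩ := hvb
  have hb : ∀ u ∈ perronClass F Ω φ, ∀ x ∈ closure Ω, u x ≤ -m' := fun u hu x hx => by
    linarith [hcomp u hu v hv x hx, hm' (mem_image_of_mem v hx)]
  set U := perronFun F Ω φ
  have hUmax : ∀ w ∈ perronClass F Ω φ, ∀ x ∈ closure Ω, w x ≤ U x := fun w hw x hx =>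
    le_perronFun hb hw hx
  have hU : U ∈ perronClass F Ω φ := perronFun_mem_perronClass hF.isClosed hΩ ⟨u, hu⟩ hb
    fun x hx => hbar'.perronFun_le ⟨u, hu⟩ hcomp hx
  have hUb : BddAbove ((-U) '' closure Ω) := ⟨-m, forall_mem_image.2 fun x hx =>
    neg_le_neg ((hm (mem_image_of_mem u hx)).trans (hUmax u hu x hx))⟩
  set V := uscEnv (closure Ω) (-U)
  have hV : V ∈ perronClass (dual F) Ω (-φ) := ⟨upperSemicontinuousOn_uscEnv hUb,
    viscAt_dual_uscEnv_neg hF hΩ hU hUmax hUb, fun x hx => hbar.uscEnv_neg_le hUmax hx⟩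
  have hVU : ∀ x ∈ closure Ω, V x = -U x := fun x hx =>
    le_antisymm (by linarith [hcomp U hU V hV x hx]) (le_uscEnv hUb hx)
  have hVU' : -U ∈ perronClass (dual F) Ω (-φ) :=
    ⟨fun x hx => UpperSemicontinuousWithinAt.congr_of_eventuallyEq (hV.1 x hx) hx
        (eventually_mem_nhdsWithin.mono hVU), fun x hx => (hV.2.1 x hx).congr (by
        filter_upwards [hΩ.mem_nhds hx] with z hz using hVU z (subset_closure hz)),
      fun x hx => (hVU x (frontier_subset_closure hx)).symm.trans_le (hV.2.2 x hx)⟩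
  exact ⟨U, hU, hVU', continuousOn_of_upperSemicontinuousOn_neg hU.1 hVU'.1⟩

end PerronFunction

section Dirichlet

open Classical in
/-- Extension of a function on a subset by zero, so that functions on `closure Ω` and `frontier Ω`
can be handled as functions on `X`; only the values on the subset matter. -/
def extendZero {X : Type*} {S : Set X} (u : S → ℝ) (x : X) : ℝ := if h : x ∈ S then u ⟨x, h⟩ else 0

theorem extendZero_of_mem {X : Type*} {S : Set X} (u : S → ℝ) {x : X} (h : x ∈ S) :
    extendZero u x = u ⟨x, h⟩ :=
  dif_pos h

theorem continuousOn_extendZero {X : Type*} [TopologicalSpace X] {S : Set X} (u : C(S, ℝ)) :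
    ContinuousOn (extendZero u) S :=
  continuousOn_iff_continuous_domRestrict.2
    (u.continuous.congr fun x => (extendZero_of_mem u x.2).symm)

variable {n : ℕ} {X : Type*} [TopologicalSpace X] [ChartedSpace (Rn n) X]
  {F G M : Set (JetBundle n X)} {F₀ : Set (Jet n)} {Ω : Set X} {ψ φ u : X → ℝ}

theorem isSubharmonic_coe_iff (hΩ : IsOpen Ω) (hu : ContinuousOn u Ω) :
    IsSubharmonic G Ω (fun x => (u x : EReal)) ↔ ∀ x ∈ Ω, ViscAt G u x := by
  have hnhds : ∀ (x : Ω) (θ : X → ℝ), (∀ᶠ y : Ω in 𝓝 x, (u y : EReal) ≤ (θ y : EReal)) ↔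
      ∀ᶠ z in 𝓝 (x : X), u z ≤ θ z := fun x θ => by
    rw [← hΩ.isOpenEmbedding_subtypeVal.map_nhds_eq x, eventually_map]
    simp only [EReal.coe_le_coe_iff]
  constructor
  · intro h x hx θ hθ hle heq
    exact h.2.2 ⟨x, hx⟩ θ hθ ((hnhds ⟨x, hx⟩ θ).2 hle) (congrArg _ heq)
  · intro h
    have husc : Continuous fun x : Ω => (u x : EReal) :=
      continuous_coe_real_ereal.comp (continuousOn_iff_continuous_domRestrict.1 hu)
    exact ⟨husc.upperSemicontinuous, fun x => EReal.coe_lt_top _, fun x θ hθ hle heq =>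
      h x x.2 θ hθ ((hnhds x θ).1 hle) (EReal.coe_eq_coe_iff.1 heq)⟩

theorem solvesDirichlet_iff (hΩ : IsOpen Ω) {φ : C(frontier Ω, ℝ)} {u : C(closure Ω, ℝ)}
    {v : X → ℝ} (hv : ∀ x (hx : x ∈ closure Ω), v x = u ⟨x, hx⟩) :
    SolvesDirichlet F Ω φ u ↔ v ∈ perronClass F Ω (extendZero φ) ∧
      -v ∈ perronClass (dual F) Ω (-extendZero φ) := by
  have hvc : ContinuousOn v (closure Ω) :=
    continuousOn_iff_continuous_domRestrict.2 (u.continuous.congr fun x => (hv x x.2).symm)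
  have hvΩ : ContinuousOn v Ω := hvc.mono subset_closure
  have hbd : (∀ x : frontier Ω, u ⟨x, frontier_subset_closure x.2⟩ = φ x) ↔
      (∀ x ∈ frontier Ω, v x ≤ extendZero φ x) ∧
        ∀ x ∈ frontier Ω, (-v) x ≤ (-extendZero φ) x := by
    simp only [Subtype.forall, ← forall₂_and, Pi.neg_apply, neg_le_neg_iff, ← le_antisymm_iff]
    refine forall₂_congr fun x hx => ?_
    rw [hv x (frontier_subset_closure hx), extendZero_of_mem _ hx]
  have hu : ∀ x : Ω, u ⟨x, subset_closure x.2⟩ = v x := fun x => (hv x (subset_closure x.2)).symm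
  have hneg := isSubharmonic_coe_iff (G := dual F) hΩ hvΩ.neg
  simp only [Pi.neg_apply, EReal.coe_neg] at hneg
  simp only [SolvesDirichlet, IsHarmonic, hu]
  rw [isSubharmonic_coe_iff hΩ hvΩ, hneg, hbd]
  exact ⟨fun h => ⟨⟨hvc.upperSemicontinuousOn, h.1.1, h.2.1⟩,
    hvc.neg.upperSemicontinuousOn, h.1.2, h.2.2⟩,
    fun h => ⟨⟨h.1.2.1, h.2.2.1⟩, h.1.2.2, h.2.2.2⟩⟩

variable [IsManifold 𝓘(ℝ, Rn n) ∞ X]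

theorem add_nonpos_of_mem_perronClass (hF : IsSubequation F) (hM : IsMonotonicityCone M F)
    (hF₀ : PosNeg F₀) (hjet : LocallyAffinelyJetEquivalent F F₀) (hψ : IsStrictlySubharmonic M ψ)
    (hΩ : IsOpen Ω) (hΩc : IsCompact (closure Ω)) :
    ∀ u ∈ perronClass F Ω φ, ∀ v ∈ perronClass (dual F) Ω (-φ), ∀ x ∈ closure Ω, u x + v x ≤ 0 :=
  fun _ hu _ hv => comparison hF hM hF₀ hjet hψ hΩ hΩc hu.1 hv.1 hu.2.1 hv.2.1 fun x hx =>
    (add_le_add (hu.2.2 x hx) (hv.2.2 x hx)).trans_eq (add_neg_cancel (φ x))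

theorem exists_mem_perronClass_neg_mem [T2Space X] (hF : IsSubequation F)
    (hM : IsMonotonicityCone M F) (hF₀ : IsConstSubequation F₀)
    (hjet : LocallyAffinelyJetEquivalent F F₀)
    (hψ : IsStrictlySubharmonic M ψ) (hΩ : IsOpen Ω) (hΩc : IsCompact (closure Ω))
    (hconv : StrictlyConvexBoundary F Ω) (hconv' : StrictlyConvexBoundary (dual F) Ω)
    (hφ : ContinuousOn φ (frontier Ω)) :
    ∃ u ∈ perronClass F Ω φ, -u ∈ perronClass (dual F) Ω (-φ) ∧ ContinuousOn u (closure Ω) := by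
  have hΩf : IsCompact (frontier Ω) :=
    hΩc.of_isClosed_subset isClosed_frontier frontier_subset_closure
  have hF' := hM.isMonotoneFor hF hF₀.nonempty hjet
  have hD := hM.isMonotoneFor_dual hF hF₀.ne_univ hjet
  obtain ⟨u, hu, hub⟩ :=
    exists_mem_perronClass_bddBelow hM hF' hψ hΩc (hΩf.bddBelow_image hφ)
  obtain ⟨v, hv, hvb⟩ :=
    exists_mem_perronClass_bddBelow hM hD hψ hΩc (hΩf.bddBelow_image hφ.neg)
  exact exists_continuousOn_mem_perronClass_neg_mem hF hΩ
    (add_nonpos_of_mem_perronClass hF hM hF₀.posNeg hjet hψ hΩ hΩc)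
    (hconv.hasBarriers hF'.posNeg hΩ hφ hu hub) (hconv'.hasBarriers hD.posNeg hΩ hφ.neg hv hvb)
    hu hub hv hvb

end Dirichlet

end

theorem theorem8p1p2_general {n : ℕ} {X : Type*} [TopologicalSpace X] [T2Space X]
    [ChartedSpace (Rn n) X] [IsManifold 𝓘(ℝ, Rn n) ∞ X]
    (F M : Set (JetBundle n X)) (hF : IsSubequation F) (hM : IsMonotonicityCone M F)
    (hjet : ∃ F₀ : Set (Jet n), IsConstSubequation F₀ ∧ LocallyAffinelyJetEquivalent F F₀)
    (hψ : ∃ ψ : X → ℝ, IsStrictlySubharmonic M ψ)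
    (Ω : Set X) (hΩ : IsOpen Ω) (hΩc : IsCompact (closure Ω))
    (hconv : StrictlyConvexBoundary F Ω) (hconv' : StrictlyConvexBoundary (dual F) Ω) :
    ∀ φ : C(frontier Ω, ℝ), ∃! u : C(closure Ω, ℝ), SolvesDirichlet F Ω φ u := by
  intro φ
  obtain ⟨F₀, hF₀, hjet⟩ := hjet
  obtain ⟨ψ, hψ⟩ := hψ
  obtain ⟨u, hu, hu', huc⟩ := exists_mem_perronClass_neg_mem hF hM hF₀ hjet hψ hΩ hΩc hconv hconv'
    (continuousOn_extendZero φ)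
  have hcomp := add_nonpos_of_mem_perronClass (φ := extendZero φ) hF hM hF₀.posNeg hjet hψ hΩ hΩc
  refine ⟨⟨(closure Ω).domRestrict u, continuousOn_iff_continuous_domRestrict.1 huc⟩,
    (solvesDirichlet_iff hΩ fun _ _ => rfl).2 ⟨hu, hu'⟩, fun v hv => ContinuousMap.ext ?_⟩
  obtain ⟨hv, hv'⟩ := (solvesDirichlet_iff hΩ fun x hx => extendZero_of_mem v hx).1 hv
  rintro ⟨x, hx⟩
  calc v ⟨x, hx⟩ = extendZero v x := (extendZero_of_mem v hx).symm
    _ = u x := le_antisymm (add_neg_nonpos_iff.1 (hcomp _ hv _ hu' x hx))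
      (add_neg_nonpos_iff.1 (hcomp _ hu _ hv' x hx))

end DirichletDuality

open scoped Manifold ContDiff in
open DirichletDuality in
theorem theorem8p1p2 {n : ℕ} {X : Type*} [TopologicalSpace X] [T2Space X]
    [SecondCountableTopology X] [ChartedSpace (Rn n) X] [IsManifold 𝓘(ℝ, Rn n) ∞ X]
    (F M : Set (JetBundle n X)) (hF : IsSubequation F) (hM : IsMonotonicityCone M F)
    (hjet : ∃ F₀ : Set (Jet n), IsConstSubequation F₀ ∧ LocallyAffinelyJetEquivalent F F₀)
    (hψ : ∃ ψ : X → ℝ, IsStrictlySubharmonic M ψ)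
    (Ω : Set X) (hΩ : IsOpen Ω) (hΩc : IsCompact (closure Ω)) (hΩb : HasSmoothBoundary n Ω)
    (hconv : StrictlyConvexBoundary F Ω) (hconv' : StrictlyConvexBoundary (dual F) Ω) :
    ∀ φ : C(frontier Ω, ℝ), ∃! u : C(closure Ω, ℝ), SolvesDirichlet F Ω φ u := by
  exact theorem8p1p2_general F M hF hM hjet hψ Ω hΩ hΩc hconv hconv'
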